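/- Let $K\subset S^3$ be a tame knot, that is, an embedded circle that is ambient isotopic to a simple closed polygon in $\mathbb{R}^3\subset S^3$. A diagram on a surface $S$ ($S=\mathbb{R}^2$ or $S=S^2$) is a closed curve in $S$ whose only multiple points are finitely many (possibly zero) transverse double points, with a choice of over- and undercrossing branch at each of them; it is a diagram of $K$ if lifting it to $S\times\mathbb{R}\subset S^3$ according to the crossings gives a knot ambient isotopic to $K$ (here $\mathbb{R}^2\times\mathbb{R}=\mathbb{R}^3\subset S^3$, and $S^2\times\mathbb{R}\cong\mathbb{R}^3\setminus\{0\}\subset S^3$). Diagrams are unoriented. The Reidemeister graph $\mathcal{G}(K)$ is the multigraph whose vertices are the diagrams of $K$ in $\mathbb{R}^2$ up to ambient isotopy of $\mathbb{R}^2$, and whose edges between two vertices are the single Reidemeister moves (of type $\Omega_1$, $\Omega_2$ or $\Omega_3$) relating diagrams in these two classes, where a move and its inverse give the same edge and moves coinciding up to planar isotopy are identified. The $S^2$-Reidemeister graph $\mathcal{G}_S(K)$ is defined in the same way, with diagrams, moves and isotopies on $S^2$. Then each of the graphs $\mathcal{G}(K)$ and $\mathcal{G}_S(K)$ contains the complete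 graph $K_5$ as a minor, and neither of them is planar: neither can be drawn in the plane with distinct points for the vertices and with edges that meet, each other and the vertices, only at their ends. -/

import Mathlib

open Set

noncomputable section

namespace Reidemeister

/-! ## Ambient spaces -/

/-- The plane `ℝ²`. -/
abbrev Plane : Type := EuclideanSpace ℝ (Fin 2)

/-- Three-space `ℝ³`. -/
abbrev Space : Type := EuclideanSpace ℝ (Fin 3)

/-- The two-sphere, as the unit sphere of `ℝ³`. -/
abbrev Sphere2 : Type := Metric.sphere (0 : Space) 1

/-- The three-sphere, as the one-point compactification of `ℝ³`. -/
abbrev Sphere3 : Type := OnePoint Space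

/-- The closed unit disc of the plane. -/
def disc : Set Plane := Metric.closedBall 0 1

/-! ## Ambient isotopy -/

/-- `h` is the end of an ambient isotopy of `X`, that is, of a family `H t`, `t ∈ [0,1]`, of
homeomorphisms of `X` which is jointly continuous and starts at the identity. -/
def IsIsotopicToId {X : Type*} [TopologicalSpace X] (h : X ≃ₜ X) : Prop :=
  ∃ H : unitInterval → (X ≃ₜ X),
    Continuous (fun p : unitInterval × X => H p.1 p.2) ∧ H 0 = Homeomorph.refl X ∧ H 1 = h

theorem IsIsotopicToId.refl (X : Type*) [TopologicalSpace X] :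
    IsIsotopicToId (Homeomorph.refl X) :=
  ⟨fun _ => Homeomorph.refl X, continuous_snd, rfl, rfl⟩

theorem IsIsotopicToId.symm {X : Type*} [TopologicalSpace X] {h : X ≃ₜ X}
    (hh : IsIsotopicToId h) : IsIsotopicToId h.symm := by
  obtain ⟨H, hc, h0, h1⟩ := hh
  refine ⟨fun t => h.symm.trans (H (unitInterval.symm t)), ?_, ?_, ?_⟩
  · have hk : Continuous (fun p : unitInterval × X => (unitInterval.symm p.1, h.symm p.2)) := by
      fun_prop
    exact hc.comp hk
  · ext x; simp [h1]
  · ext x; simp [h0]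

theorem IsIsotopicToId.trans {X : Type*} [TopologicalSpace X] {h k : X ≃ₜ X}
    (hh : IsIsotopicToId h) (hk : IsIsotopicToId k) : IsIsotopicToId (h.trans k) := by
  obtain ⟨H, hc, h0, h1⟩ := hh
  obtain ⟨L, lc, l0, l1⟩ := hk
  refine ⟨fun t => (H t).trans (L t), ?_, ?_, ?_⟩
  · have hm : Continuous (fun p : unitInterval × X => (p.1, H p.1 p.2)) :=
      continuous_fst.prodMk hc
    exact lc.comp hm
  · ext x; simp [h0, l0]
  · ext x; simp [h1, l1]

/-- Two subsets of `X` are ambient isotopic. -/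
def AmbientIsotopic {X : Type*} [TopologicalSpace X] (A B : Set X) : Prop :=
  ∃ h : X ≃ₜ X, IsIsotopicToId h ∧ h '' A = B

/-! ## Tame knots -/

/-- `A` is a simple closed polygon in `ℝ³`, with vertices `p i` indexed cyclically: the map that
runs along the half-open edges `[p i, p (i+1))` is injective, and `A` is its image. -/
def IsSimpleClosedPolygon (A : Set Space) : Prop :=
  ∃ (n : ℕ) (_ : NeZero n) (p : ZMod n → Space),
    InjOn (fun q : ZMod n × ℝ => AffineMap.lineMap (p q.1) (p (q.1 + 1)) q.2)
      (univ ×ˢ Ico (0 : ℝ) 1) ∧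
    A = (fun q : ZMod n × ℝ => AffineMap.lineMap (p q.1) (p (q.1 + 1)) q.2) ''
      (univ ×ˢ Ico (0 : ℝ) 1)

/-- `K` is the image of a tame embedding of the circle in `S³`: an embedded circle which is ambient
isotopic to a polygon. -/
def IsTameKnot (K : Set Sphere3) : Prop :=
  (∃ f : Circle → Sphere3, Topology.IsEmbedding f ∧ range f = K) ∧
  ∃ A : Set Space, IsSimpleClosedPolygon A ∧ AmbientIsotopic ((fun x : Space => (x : Sphere3)) '' A) K

/-! ## Local pictures in a disc -/

/-- A picture of `k` strands in the unit disc: every strand is parametrized by `[-1,1]`, `pos` is its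
projection to the disc and `height` says which strand is on top at a crossing. -/
structure Picture (k : ℕ) where
  pos : Fin k → ℝ → Plane
  height : Fin k → ℝ → ℝ

/-- The parameters at which the `i`-th strand of the picture passes over another piece of strand. -/
def Picture.upper {k : ℕ} (T : Picture k) (i : Fin k) : Set ℝ :=
  {u | ∃ j, ∃ v ∈ Icc (-1 : ℝ) 1, T.pos j v = T.pos i u ∧ T.height j v < T.height i u}

/-- `φ` embeds the closed unit disc in `S`. -/
def IsDisc {S : Type*} [TopologicalSpace S] (φ : Plane → S) : Prop :=
  ContinuousOn φ disc ∧ InjOn φ disc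

/-- `e` is a family of `k` pairwise disjoint embedded closed arcs in the circle. -/
def IsArcs {k : ℕ} (e : Fin k → ℝ → Circle) : Prop :=
  (∀ j, ContinuousOn (e j) (Icc (-1) 1)) ∧
  InjOn (fun p : Fin k × ℝ => e p.1 p.2) (univ ×ˢ Icc (-1 : ℝ) 1)

/-- The part of the circle covered by the arcs `e`. -/
def arcsRange {k : ℕ} (e : Fin k → ℝ → Circle) : Set Circle :=
  {t | ∃ j, ∃ u ∈ Icc (-1 : ℝ) 1, e j u = t}

/-- The part of the closed curve `γ` in the disc `φ` consists of the arcs `e`, and `φ` identifies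
these arcs with the given curves `pos` in the unit disc. -/
def TracesIn {S : Type*} [TopologicalSpace S] {k : ℕ} (γ : Circle → S) (φ : Plane → S)
    (e : Fin k → ℝ → Circle) (pos : Fin k → ℝ → Plane) : Prop :=
  γ ⁻¹' (φ '' disc) = arcsRange e ∧
  ∀ j, ∀ u ∈ Icc (-1 : ℝ) 1, pos j u ∈ disc ∧ γ (e j u) = φ (pos j u)

/-- Two diameters of the disc that cross at the centre. -/
def crossPos : Fin 2 → ℝ → Plane :=
  ![fun u => !₂[u, 0], fun u => !₂[0, u]]

/-- The branches of `γ` at the parameters `s` and `t` cross transversely: a disc around their common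
point identifies the curve with a pair of crossing diameters. -/
def CrossesAt {S : Type*} [TopologicalSpace S] (γ : Circle → S) (s t : Circle) : Prop :=
  ∃ (φ : Plane → S) (e : Fin 2 → ℝ → Circle),
    IsDisc φ ∧ IsArcs e ∧ TracesIn γ φ e crossPos ∧ e 0 0 = s ∧ e 1 0 = t

/-! ## Knot diagrams -/

/-- A knot diagram on the surface `S`: a closed curve whose only multiple points are finitely many
transverse double points, with the choice of one of the two branches, the overcrossing one, at each
of them. `upper` is the set of parameters of the overcrossing branches. The crossingless diagrams are
allowed. -/
structure Diagram (S : Type*) [TopologicalSpace S] where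
  curve : Circle → S
  upper : Set Circle
  continuous_curve : Continuous curve
  finite_double : {t | ∃ s, s ≠ t ∧ curve s = curve t}.Finite
  no_triple : ∀ r s t, curve r = curve s → curve s = curve t → r = s ∨ s = t ∨ r = t
  crosses : ∀ s t, s ≠ t → curve s = curve t → CrossesAt curve s t
  upper_subset : ∀ t ∈ upper, ∃ s, s ≠ t ∧ curve s = curve t
  upper_iff : ∀ s t, s ≠ t → curve s = curve t → (s ∈ upper ↔ t ∉ upper)

variable {S : Type*} [TopologicalSpace S]

/-- The homeomorphism `h` of the surface takes the (unoriented) diagram `D` to `D'`. -/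
def Diagram.Carries (h : S ≃ₜ S) (D D' : Diagram S) : Prop :=
  ∃ ρ : Circle ≃ₜ Circle, ∀ t, h (D.curve t) = D'.curve (ρ t) ∧ (t ∈ D.upper ↔ ρ t ∈ D'.upper)

theorem Diagram.Carries.refl (D : Diagram S) : Diagram.Carries (Homeomorph.refl S) D D :=
  ⟨Homeomorph.refl _, fun _ => ⟨rfl, Iff.rfl⟩⟩

theorem Diagram.Carries.symm {h : S ≃ₜ S} {D D' : Diagram S} (c : Diagram.Carries h D D') :
    Diagram.Carries h.symm D' D := by
  obtain ⟨ρ, hρ⟩ := c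
  refine ⟨ρ.symm, fun t => ⟨?_, ?_⟩⟩
  · have := (hρ (ρ.symm t)).1
    rw [ρ.apply_symm_apply] at this
    rw [← this, h.symm_apply_apply]
  · have := (hρ (ρ.symm t)).2
    rw [ρ.apply_symm_apply] at this
    exact this.symm

theorem Diagram.Carries.trans {h k : S ≃ₜ S} {D D' D'' : Diagram S}
    (c : Diagram.Carries h D D') (c' : Diagram.Carries k D' D'') :
    Diagram.Carries (h.trans k) D D'' := by
  obtain ⟨ρ, hρ⟩ := c
  obtain ⟨σ, hσ⟩ := c'
  refine ⟨ρ.trans σ, fun t => ⟨?_, ?_⟩⟩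
  · simp [(hρ t).1, (hσ (ρ t)).1]
  · exact (hρ t).2.trans (hσ (ρ t)).2

/-- Diagrams up to isotopy of the surface (planar isotopy if `S` is the plane). -/
def diagramSetoid (S : Type*) [TopologicalSpace S] : Setoid (Diagram S) where
  r D D' := ∃ h : S ≃ₜ S, IsIsotopicToId h ∧ Diagram.Carries h D D'
  iseqv :=
    { refl := fun D => ⟨_, IsIsotopicToId.refl S, Diagram.Carries.refl D⟩
      symm := fun ⟨_, i, c⟩ => ⟨_, i.symm, c.symm⟩
      trans := fun ⟨_, i, c⟩ ⟨_, i', c'⟩ => ⟨_, i.trans i', c.trans c'⟩ }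

/-- Isotopy classes of diagrams on `S`. -/
abbrev DiagramClass (S : Type*) [TopologicalSpace S] : Type _ := Quotient (diagramSetoid S)

/-! ## Reidemeister moves -/

/-- In the disc `φ` the diagram `D` is the picture `T`. -/
def Diagram.LooksLike {k : ℕ} (D : Diagram S) (φ : Plane → S) (e : Fin k → ℝ → Circle)
    (T : Picture k) : Prop :=
  TracesIn D.curve φ e T.pos ∧ ∀ j, ∀ u ∈ Icc (-1 : ℝ) 1, (e j u ∈ D.upper ↔ u ∈ T.upper j)

/-- `D'` is obtained from `D` by replacing the picture `T`, in some disc, by the picture `T'`, and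
leaving `D` unchanged outside of this disc. The disc is embedded with either orientation, so `T` and
`T'` may be reflected simultaneously in a line of the plane. -/
def ChangesBy {k : ℕ} (T T' : Picture k) (D D' : Diagram S) : Prop :=
  ∃ (φ : Plane → S) (e : Fin k → ℝ → Circle),
    IsDisc φ ∧ IsArcs e ∧ D.LooksLike φ e T ∧ D'.LooksLike φ e T' ∧
    ∀ t ∉ arcsRange e, D.curve t = D'.curve t ∧ (t ∈ D.upper ↔ t ∈ D'.upper)

/-- First move, before: one straight strand. -/
def r1Before : Picture 1 where
  pos := fun _ u => !₂[u, 0]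
  height := fun _ _ => 0

/-- First move, after: one strand with a curl, which crosses itself at the parameters `±1/√2`. The
other three types of curl are obtained from this one by reflections of the disc. -/
def r1After : Picture 1 where
  pos := fun _ u => !₂[2 * u ^ 3 - u, (1 - u ^ 2) / 2]
  height := fun _ u => u

/-- Second move, before: two parallel strands. -/
def r2Before : Picture 2 where
  pos := ![fun u => !₂[4 / 5 * u, -(3 / 5)], fun u => !₂[4 / 5 * u, 3 / 5]]
  height := fun j _ => (j : ℝ)

/-- Second move, after: one strand is pushed over the other one, with two crossings. -/
def r2After : Picture 2 where
  pos := ![fun u => !₂[4 / 5 * u, 3 / 5 * (1 - 2 * u ^ 2)],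
    fun u => !₂[4 / 5 * u, -(3 / 5 * (1 - 2 * u ^ 2))]]
  height := fun j _ => (j : ℝ)

/-- Third move: two diameters cross at the centre and a third strand passes on one side of the centre
(for `ε = 1`) or on the other side (for `ε = -1`). The permutation `σ` tells which strand is at the
top, in the middle and at the bottom. -/
def r3Picture (σ : Equiv.Perm (Fin 3)) (ε : ℝ) : Picture 3 where
  pos := ![fun u => !₂[3 / 5 * u, 4 / 5 * u], fun u => !₂[-(3 / 5 * u), 4 / 5 * u],
    fun u => !₂[u, ε * ((1 - u ^ 2) / 2)]]
  height := fun j _ => ((σ j : Fin 3) : ℝ)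

/-- `D'` is obtained from `D` by a single Reidemeister move; moves of the first and second kind are
here in the direction that creates crossings. -/
def IsMove (D D' : Diagram S) : Prop :=
  ChangesBy r1Before r1After D D' ∨ ChangesBy r2Before r2After D D' ∨
    ∃ σ : Equiv.Perm (Fin 3), ChangesBy (r3Picture σ 1) (r3Picture σ (-1)) D D'

/-- A Reidemeister move, recorded by the diagrams before and after it. -/
def Move (S : Type*) [TopologicalSpace S] : Type _ :=
  {p : Diagram S × Diagram S // IsMove p.1 p.2}

/-- Moves up to isotopy of the surface and reversal: two moves coincide if a single isotopy takes both
diagrams of one to both diagrams of the other, in the same or in the opposite order. -/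
def moveSetoid (S : Type*) [TopologicalSpace S] : Setoid (Move S) where
  r p q := ∃ h : S ≃ₜ S, IsIsotopicToId h ∧
    ((Diagram.Carries h p.1.1 q.1.1 ∧ Diagram.Carries h p.1.2 q.1.2) ∨
      (Diagram.Carries h p.1.1 q.1.2 ∧ Diagram.Carries h p.1.2 q.1.1))
  iseqv :=
    { refl := fun p => ⟨_, IsIsotopicToId.refl S, Or.inl ⟨.refl _, .refl _⟩⟩
      symm := by
        rintro p q ⟨h, i, ⟨c, d⟩ | ⟨c, d⟩⟩
        · exact ⟨_, i.symm, Or.inl ⟨c.symm, d.symm⟩⟩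
        · exact ⟨_, i.symm, Or.inr ⟨d.symm, c.symm⟩⟩
      trans := by
        rintro p q r ⟨h, i, ⟨c, d⟩ | ⟨c, d⟩⟩ ⟨h', i', ⟨c', d'⟩ | ⟨c', d'⟩⟩
        · exact ⟨_, i.trans i', Or.inl ⟨c.trans c', d.trans d'⟩⟩
        · exact ⟨_, i.trans i', Or.inr ⟨c.trans c', d.trans d'⟩⟩
        · exact ⟨_, i.trans i', Or.inr ⟨c.trans d', d.trans c'⟩⟩
        · exact ⟨_, i.trans i', Or.inl ⟨c.trans d', d.trans c'⟩⟩ }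

/-- Isotopy classes of Reidemeister moves. -/
abbrev MoveClass (S : Type*) [TopologicalSpace S] : Type _ := Quotient (moveSetoid S)

/-! ## The Reidemeister graphs -/

/-- `ℝ² × ℝ` in `S³`: the plane with the vertical lines over its points. -/
def planeLift (x : Plane) (h : ℝ) : Sphere3 := ((!₂[x 0, x 1, h] : Space) : Sphere3)

/-- `S² × ℝ` in `S³`: the sphere with the rays that start at the origin, going outwards. -/
def sphereLift (x : Sphere2) (h : ℝ) : Sphere3 := ((Real.exp h • (x : Space) : Space) : Sphere3)

/-- `D` is a diagram of the knot `K`: the curve of `D`, lifted off the surface by a height function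
that is larger on the overcrossing than on the undercrossing branch of each crossing, is ambient
isotopic to `K`. -/
def Diagram.Represents (lift : S → ℝ → Sphere3) (D : Diagram S) (K : Set Sphere3) : Prop :=
  ∃ h : Circle → ℝ, Continuous h ∧
    (∀ s t, s ≠ t → D.curve s = D.curve t → s ∈ D.upper → h t < h s) ∧
    AmbientIsotopic (range fun t => lift (D.curve t) (h t)) K

/-- The graph of diagrams of `K` on the surface `S`: its vertices are the isotopy classes of diagrams
of `K`, its edges are the isotopy classes of Reidemeister moves between them. -/
def reidemeisterGraph (lift : S → ℝ → Sphere3) (K : Set Sphere3) :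
    Graph (DiagramClass S) (MoveClass S) where
  vertexSet := {v | ∃ D : Diagram S, Quotient.mk (diagramSetoid S) D = v ∧ D.Represents lift K}
  IsLink e x y :=
    (∃ D : Diagram S, Quotient.mk (diagramSetoid S) D = x ∧ D.Represents lift K) ∧
    (∃ D : Diagram S, Quotient.mk (diagramSetoid S) D = y ∧ D.Represents lift K) ∧
    ∃ p : Move S, Quotient.mk (moveSetoid S) p = e ∧
      ((Quotient.mk (diagramSetoid S) p.1.1 = x ∧ Quotient.mk (diagramSetoid S) p.1.2 = y) ∨
        (Quotient.mk (diagramSetoid S) p.1.1 = y ∧ Quotient.mk (diagramSetoid S) p.1.2 = x))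
  isLink_symm := by
    intro e _
    refine ⟨?_⟩
    rintro x y ⟨hx, hy, p, hp, h⟩
    exact ⟨hy, hx, p, hp, h.symm⟩
  eq_or_eq_of_isLink_of_isLink := by
    rintro e x y v w ⟨-, -, p, hp, h⟩ ⟨-, -, q, hq, h'⟩
    obtain ⟨k, i, c⟩ := Quotient.exact (hp.trans hq.symm)
    have key : ∀ A B : Diagram S, Diagram.Carries k A B →
        Quotient.mk (diagramSetoid S) A = Quotient.mk (diagramSetoid S) B :=
      fun A B cc => Quotient.sound ⟨k, i, cc⟩
    rcases c with ⟨c, d⟩ | ⟨c, d⟩ <;>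
      have c := key _ _ c <;> have d := key _ _ d <;>
      rcases h with ⟨rfl, rfl⟩ | ⟨rfl, rfl⟩ <;> rcases h' with ⟨rfl, rfl⟩ | ⟨rfl, rfl⟩ <;>
      simp_all
  left_mem_of_isLink := by
    rintro e x y ⟨hx, -⟩
    exact hx

/-- The Reidemeister graph `G(K)` of diagrams in the plane. -/
def planarGraph (K : Set Sphere3) : Graph (DiagramClass Plane) (MoveClass Plane) :=
  reidemeisterGraph planeLift K

/-- The Reidemeister graph `G_S(K)` of diagrams on the two-sphere. -/
def sphericalGraph (K : Set Sphere3) : Graph (DiagramClass Sphere2) (MoveClass Sphere2) :=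
  reidemeisterGraph sphereLift K

/-! ## Minors and planarity of multigraphs -/

/-- The set `B` of vertices is connected in `G`: any two of its elements are joined by a path of `G`
with all vertices in `B`. -/
def ConnectedOn {V E : Type*} (G : Graph V E) (B : Set V) : Prop :=
  ∀ x ∈ B, ∀ y ∈ B, Relation.ReflTransGen (fun a b => a ∈ B ∧ b ∈ B ∧ G.Adj a b) x y

/-- The simple graph `H` is a minor of `G`: there are disjoint non-empty connected branch sets in `G`,
one for each vertex of `H`, and an edge of `G` between the branch sets of any two adjacent vertices. -/
def HasMinor {ι V E : Type*} (H : SimpleGraph ι) (G : Graph V E) : Prop :=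
  ∃ B : ι → Set V,
    (∀ i, B i ⊆ G.vertexSet ∧ (B i).Nonempty ∧ ConnectedOn G (B i)) ∧
    (∀ i j, i ≠ j → Disjoint (B i) (B j)) ∧
    ∀ i j, H.Adj i j → ∃ x ∈ B i, ∃ y ∈ B j, G.Adj x y

/-- `G` is planar: it can be drawn in the plane without crossings. Vertices are distinct points; each
edge is a curve between the points of its ends, without self-intersections in its interior; interiors
of edges avoid the vertices and each other. -/
def IsPlanar {V E : Type*} (G : Graph V E) : Prop :=
  ∃ (f : V → Plane) (c : E → ℝ → Plane),
    InjOn f G.vertexSet ∧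
    (∀ e ∈ G.edgeSet, ContinuousOn (c e) (Icc 0 1) ∧ InjOn (c e) (Ioo 0 1)) ∧
    (∀ e x y, G.IsLink e x y →
      (c e 0 = f x ∧ c e 1 = f y) ∨ (c e 0 = f y ∧ c e 1 = f x)) ∧
    (∀ e ∈ G.edgeSet, ∀ v ∈ G.vertexSet, ∀ u ∈ Ioo (0 : ℝ) 1, c e u ≠ f v) ∧
    ∀ e ∈ G.edgeSet, ∀ e' ∈ G.edgeSet, e ≠ e' →
      Disjoint (c e '' Ioo 0 1) (c e' '' Ioo 0 1)

end Reidemeister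

end

noncomputable section

namespace Reidemeister

/-! ## The complete graph `K₅` cannot be drawn in the plane -/

/-! Both graphs contain a four-dimensional cube, and such a cube has a `K₅` minor. A tame knot is
represented by a polygon, and a generic projection of the polygon gives a diagram with a short
straight arc free of crossings. Choose four disjoint pieces of this arc. In the `i`-th piece the
first Reidemeister move creates a curl, the top of the curl's loop is again a flat arc, and the move
can be repeated there; so any number `H i` of nested curls can be inserted without changing the knot
(`exists_isNest`). For `s ⊆ {0,1,2,3}` let `H i` be `i + 1`, increased by one if `i ∈ s`. Adding an
element to `s` is then a single move, which gives the edges of the cube.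

The sixteen diagrams must be pairwise non-isotopic. The invariant counts the parameters of crossings
whose two parameters are joined by an arc of the circle containing at most `m` parameters of
crossings. The curl at depth `j` of the `i`-th piece cuts off an arc with exactly `2 (H i - j)` such
parameters, while arcs that go around the other way contain too many. Hence for `m = 2k`, `k ≤ 5`,
the invariant is a constant depending only on `k` and the original diagram plus `2 ∑ min (H i) k`
(`ncard_shortSet_nest`), and `k = 2, 3, 4, 5` determine `H` successively. Only coincidences of
parameters and the topology of the circle enter, so the count is invariant under any homeomorphism
of any surface. Central projection embeds the plane in the sphere and carries diagrams, moves and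
represented knots along; hence the same cube works in the spherical graph.

Non-planarity needs that `K₅` has no planar drawing (`independent_edges_meet`). If independent edges
were disjoint, the difference of two points moving on them would have a continuous logarithm on a
square, so its increments around the boundary would cancel. The fifteen resulting relations between
winding integers are contradictory modulo 2, which is van Kampen's obstruction. A drawing of a graph
with a `K₅` minor contains such a drawing of `K₅`, with edges running through the branch sets. -/

/-- The square is simply connected, so maps to the punctured plane lift through the covering `exp`.
-/
theorem exists_log_on_square (F : C(unitInterval × unitInterval, ℂ)) (hF : ∀ x, F x ≠ 0) :
    ∃ L : C(unitInterval × unitInterval, ℂ), ∀ x, Complex.exp (L x) = F x := by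
  have : ContractibleSpace unitInterval := (convex_Icc (0 : ℝ) 1).contractibleSpace ⟨0, by simp⟩
  have : LocallyPathConnectedSpace unitInterval := (convex_Icc (0 : ℝ) 1).locallyPathConnectedSpace
  have : SimplyConnectedSpace (unitInterval × unitInterval) := inferInstance
  obtain ⟨L, ⟨-, hL⟩, -⟩ := Complex.isCoveringMapOn_exp.existsUnique_continuousMap_lifts F
    (Complex.exp_log (hF (0, 0))) (fun x => hF x)
  exact ⟨L, fun x => congrFun hL x⟩

/-- The difference of the two logarithms is a lift of a constant, hence constant by uniqueness of
lifts. The factor `c` absorbs the sign between looking from a vertex at an edge and from the edge at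
the vertex. -/
theorem log_increment_unique {ℓ m : unitInterval → ℂ} (hℓ : Continuous ℓ) (hm : Continuous m)
    (c : ℂ) (h : ∀ t, Complex.exp (ℓ t) = c * Complex.exp (m t)) : ℓ 1 - ℓ 0 = m 1 - m 0 := by
  have key : ∀ t, Complex.exp (ℓ t - m t) = c := fun t => by
    rw [Complex.exp_sub, h t, mul_div_cancel_right₀ _ (Complex.exp_ne_zero _)]
  have := Complex.isCoveringMap_exp.eq_of_comp_eq (g₁ := fun t => ℓ t - m t)
    (g₂ := fun _ : unitInterval => ℓ 0 - m 0) (hℓ.sub hm) continuous_const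
    (by funext t; simp [key]) 0 rfl
  have h1 := congrFun this 1
  linear_combination h1

/-- The combinatorial parity argument: the angle increments of the edges of `K₅` seen from the vertices
cannot satisfy the relations given by the pairs of disjoint edges. -/
theorem k5_parity (θ : Fin 5 → Fin 5 → ℂ) (a : Fin 5 → Fin 5 → Fin 5 → ℂ)
    (hθ : ∀ v w, v < w → θ w v = θ v w + Real.pi * Complex.I)
    (ha : ∀ v w w', w < w' → v ≠ w → v ≠ w' →
      Complex.exp (a v w w') = Complex.exp (θ v w' - θ v w))
    (hsq : ∀ v v' w w', v < v' → w < w' → v ≠ w → v ≠ w' → v' ≠ w → v' ≠ w' →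
      a w' v v' - a w v v' = a v' w w' - a v w w') : False := by
  -- The conditions on the indices stand inside the existential, with default value 0 when they
  -- fail, so that `choose` gives integers indexed by all triples.
  have ha' : ∀ v w w', ∃ n : ℤ, w < w' → v ≠ w → v ≠ w' →
      a v w w' = θ v w' - θ v w + n * (2 * Real.pi * Complex.I) := by
    intro v w w'
    by_cases h : w < w' ∧ v ≠ w ∧ v ≠ w'
    · obtain ⟨n, hn⟩ := Complex.exp_eq_exp_iff_exists_int.1 (ha v w w' h.1 h.2.1 h.2.2)
      exact ⟨n, fun _ _ _ => hn⟩
    · exact ⟨0, fun h1 h2 h3 => absurd ⟨h1, h2, h3⟩ h⟩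
  choose n hn using ha'
  have hpi : (Real.pi * Complex.I : ℂ) ≠ 0 := by
    simp [Real.pi_ne_zero]
  -- Four vertices split into two disjoint edges in three ways. The three families are named after
  -- the position of the edges, regarded as chords over the ordered vertices; only the interleaved
  -- chords produce an odd constant.
  have cross : ∀ i j k l : Fin 5, i < j → j < k → k < l →
      n l i k - n j i k - n k j l + n i j l = -1 := by
    intro i j k l hij hjk hkl
    have e := hsq i k j l (hij.trans hjk) (hjk.trans hkl) hij.ne (hij.trans (hjk.trans hkl)).ne
      hjk.ne' hkl.ne
    rw [hn l i k (hij.trans hjk) (hij.trans (hjk.trans hkl)).ne' hkl.ne',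
      hn j i k (hij.trans hjk) hij.ne' hjk.ne, hn k j l (hjk.trans hkl) hjk.ne' hkl.ne,
      hn i j l (hjk.trans hkl) hij.ne (hij.trans (hjk.trans hkl)).ne,
      hθ k l hkl, hθ i l (hij.trans (hjk.trans hkl)), hθ j k hjk, hθ i j hij] at e
    have : (Real.pi * Complex.I : ℂ) * (2 * (n l i k - n j i k - n k j l + n i j l + 1 : ℤ) : ℂ)
        = 0 := by
      push_cast
      linear_combination e
    have h2 := (mul_eq_zero.1 this).resolve_left hpi
    have h3 : (n l i k - n j i k - n k j l + n i j l + 1 : ℤ) = 0 := by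
      have := (mul_eq_zero.1 h2).resolve_left two_ne_zero
      exact_mod_cast this
    omega
  have parallel : ∀ i j k l : Fin 5, i < j → j < k → k < l →
      n l i j - n k i j - n j k l + n i k l = 0 := by
    intro i j k l hij hjk hkl
    have e := hsq i j k l hij hkl (hij.trans hjk).ne (hij.trans (hjk.trans hkl)).ne
      hjk.ne (hjk.trans hkl).ne
    rw [hn l i j hij (hij.trans (hjk.trans hkl)).ne' (hjk.trans hkl).ne',
      hn k i j hij (hij.trans hjk).ne' hjk.ne', hn j k l hkl hjk.ne (hjk.trans hkl).ne,
      hn i k l hkl (hij.trans hjk).ne (hij.trans (hjk.trans hkl)).ne,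
      hθ j l (hjk.trans hkl), hθ i l (hij.trans (hjk.trans hkl)), hθ j k hjk,
      hθ i k (hij.trans hjk)] at e
    have : (Real.pi * Complex.I : ℂ) * (2 * (n l i j - n k i j - n j k l + n i k l : ℤ) : ℂ)
        = 0 := by
      push_cast
      linear_combination e
    have h2 := (mul_eq_zero.1 this).resolve_left hpi
    have := (mul_eq_zero.1 h2).resolve_left two_ne_zero
    exact_mod_cast this
  have nested : ∀ i j k l : Fin 5, i < j → j < k → k < l →
      n k i l - n j i l - n l j k + n i j k = 0 := by
    intro i j k l hij hjk hkl
    have e := hsq i l j k (hij.trans (hjk.trans hkl)) hjk hij.ne (hij.trans hjk).ne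
      (hjk.trans hkl).ne' hkl.ne'
    rw [hn k i l (hij.trans (hjk.trans hkl)) (hij.trans hjk).ne' hkl.ne,
      hn j i l (hij.trans (hjk.trans hkl)) hij.ne' (hjk.trans hkl).ne,
      hn l j k hjk (hjk.trans hkl).ne' hkl.ne', hn i j k hjk hij.ne (hij.trans hjk).ne,
      hθ i k (hij.trans hjk), hθ i j hij, hθ k l hkl, hθ j l (hjk.trans hkl)] at e
    have : (Real.pi * Complex.I : ℂ) * (2 * (n k i l - n j i l - n l j k + n i j k : ℤ) : ℂ)
        = 0 := by
      push_cast
      linear_combination e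
    have h2 := (mul_eq_zero.1 this).resolve_left hpi
    have := (mul_eq_zero.1 h2).resolve_left two_ne_zero
    exact_mod_cast this
  have c0 := cross 0 1 2 3 (by decide) (by decide) (by decide)
  have c1 := cross 0 1 2 4 (by decide) (by decide) (by decide)
  have c2 := cross 0 1 3 4 (by decide) (by decide) (by decide)
  have c3 := cross 0 2 3 4 (by decide) (by decide) (by decide)
  have c4 := cross 1 2 3 4 (by decide) (by decide) (by decide)
  have p0 := parallel 0 1 2 3 (by decide) (by decide) (by decide)
  have p1 := parallel 0 1 2 4 (by decide) (by decide) (by decide)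
  have p2 := parallel 0 1 3 4 (by decide) (by decide) (by decide)
  have p3 := parallel 0 2 3 4 (by decide) (by decide) (by decide)
  have p4 := parallel 1 2 3 4 (by decide) (by decide) (by decide)
  have n0 := nested 0 1 2 3 (by decide) (by decide) (by decide)
  have n1 := nested 0 1 2 4 (by decide) (by decide) (by decide)
  have n2 := nested 0 1 3 4 (by decide) (by decide) (by decide)
  have n3 := nested 0 2 3 4 (by decide) (by decide) (by decide)
  have n4 := nested 1 2 3 4 (by decide) (by decide) (by decide)
  -- A vertex and a disjoint edge leave two further vertices, so each integer `n v w w'` occurs in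
  -- exactly two of the fifteen relations and the left sides have an even sum. The right sides add
  -- up to `-5`.
  omega

/-- In any drawing of `K₅` in the plane there are two independent edges which meet. -/
theorem independent_edges_meet (P : Fin 5 → ℂ) (γ : ∀ i j, Path (P i) (P j))
    (h : ∀ i j k l, i < j → k < l → i ≠ k → i ≠ l → j ≠ k → j ≠ l →
      ∀ s t, γ i j s ≠ γ k l t) : False := by
  -- Any two vertices are ends of two independent edges, which are disjoint by assumption.
  have hP : ∀ i j, i ≠ j → P i ≠ P j := by
    intro i j hij
    obtain ⟨k, hki, hkj⟩ : ∃ k : Fin 5, k ≠ i ∧ k ≠ j := by revert i j; decide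
    obtain ⟨l, hli, hlj, hlk⟩ : ∃ l : Fin 5, l ≠ i ∧ l ≠ j ∧ l ≠ k := by revert i j k; decide
    have e1 : ∃ u v s, u < v ∧ γ u v s = P i ∧ (u = i ∨ u = k) ∧ (v = i ∨ v = k) := by
      rcases lt_or_gt_of_ne hki with h | h
      · exact ⟨k, i, 1, h, by simp, by simp, by simp⟩
      · exact ⟨i, k, 0, h, by simp, by simp, by simp⟩
    have e2 : ∃ u v s, u < v ∧ γ u v s = P j ∧ (u = j ∨ u = l) ∧ (v = j ∨ v = l) := by
      rcases lt_or_gt_of_ne hlj with h | h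
      · exact ⟨l, j, 1, h, by simp, by simp, by simp⟩
      · exact ⟨j, l, 0, h, by simp, by simp, by simp⟩
    obtain ⟨u, v, s, huv, es, hu, hv⟩ := e1
    obtain ⟨u', v', s', huv', es', hu', hv'⟩ := e2
    rw [← es, ← es']
    apply h u v u' v' huv huv' <;> grind
  -- The logarithms of opposite vectors are chosen to differ by exactly `πi`, and not only modulo
  -- `2πi`; the parity count depends on this.
  let θ : Fin 5 → Fin 5 → ℂ := fun v w => if v < w then Complex.log (P w - P v)
    else Complex.log (P v - P w) + Real.pi * Complex.I
  have hexpθ : ∀ v w, v ≠ w → Complex.exp (θ v w) = P w - P v := by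
    intro v w hvw
    simp only [θ]
    split_ifs
    · exact Complex.exp_log (sub_ne_zero.2 (hP _ _ hvw.symm))
    · rw [Complex.exp_add, Complex.exp_pi_mul_I, Complex.exp_log (sub_ne_zero.2 (hP _ _ hvw))]
      ring
  -- a logarithm of the difference of two independent edges
  have hL : ∀ i j k l, ∃ L : C(unitInterval × unitInterval, ℂ),
      i < j → k < l → i ≠ k → i ≠ l → j ≠ k → j ≠ l →
        ∀ x, Complex.exp (L x) = γ i j x.1 - γ k l x.2 := by
    intro i j k l
    by_cases hh : i < j ∧ k < l ∧ i ≠ k ∧ i ≠ l ∧ j ≠ k ∧ j ≠ l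
    · obtain ⟨h1, h2, h3, h4, h5, h6⟩ := hh
      obtain ⟨L, hL⟩ := exists_log_on_square ⟨fun x => γ i j x.1 - γ k l x.2, by fun_prop⟩
        (fun x => sub_ne_zero.2 (h i j k l h1 h2 h3 h4 h5 h6 _ _))
      exact ⟨L, fun _ _ _ _ _ _ => hL⟩
    · exact ⟨0, fun h1 h2 h3 h4 h5 h6 => absurd ⟨h1, h2, h3, h4, h5, h6⟩ hh⟩
  -- a logarithm of an edge seen from a vertex
  have hℓ : ∀ v w w', ∃ ℓ : C(unitInterval, ℂ), w < w' → v ≠ w → v ≠ w' →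
      ∀ t, Complex.exp (ℓ t) = γ w w' t - P v := by
    intro v w w'
    by_cases hh : w < w' ∧ v ≠ w ∧ v ≠ w'
    · obtain ⟨h1, h2, h3⟩ := hh
      -- The edge from `v` to a vertex `k` off `w w'` is independent of `w w'`; the logarithm on the
      -- square of the two edges is restricted to the side where the second point rests at `v`.
      obtain ⟨k, hk, hkw, hkw'⟩ : ∃ k : Fin 5, k ≠ v ∧ k ≠ w ∧ k ≠ w' := by
        clear h1 h2 h3; revert v w w'; decide
      rcases lt_or_gt_of_ne hk with hkv | hkv
      · obtain ⟨L, hL⟩ := hL w w' k v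
        refine ⟨⟨fun t => L (t, 1), by fun_prop⟩, fun _ _ _ t => ?_⟩
        simpa using hL h1 hkv hkw.symm h2.symm hkw'.symm h3.symm (t, 1)
      · obtain ⟨L, hL⟩ := hL w w' v k
        refine ⟨⟨fun t => L (t, 0), by fun_prop⟩, fun _ _ _ t => ?_⟩
        simpa using hL h1 hkv h2.symm hkw.symm h3.symm hkw'.symm (t, 0)
    · exact ⟨0, fun h1 h2 h3 => absurd ⟨h1, h2, h3⟩ hh⟩
  choose L hL using hL
  choose ℓ hℓ using hℓ
  refine k5_parity θ (fun v w w' => ℓ v w w' 1 - ℓ v w w' 0) ?_ ?_ ?_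
  · intro v w hvw
    simp [θ, hvw, hvw.not_gt]
  · intro v w w' h1 h2 h3
    rw [Complex.exp_sub, Complex.exp_sub, hexpθ _ _ h2, hexpθ _ _ h3, hℓ _ _ _ h1 h2 h3,
      hℓ _ _ _ h1 h2 h3]
    simp
  · intro v v' w w' h1 h2 h3 h4 h5 h6
    have E := hL v v' w w' h1 h2 h3 h4 h5 h6
    have i1 := log_increment_unique (ℓ := fun t => L v v' w w' (t, 1)) (m := ℓ w' v v')
      (by fun_prop) (by fun_prop) 1 (fun t => by
        rw [E, hℓ _ _ _ h1 h4.symm h6.symm]; simp)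
    have i2 := log_increment_unique (ℓ := fun t => L v v' w w' (t, 0)) (m := ℓ w v v')
      (by fun_prop) (by fun_prop) 1 (fun t => by
        rw [E, hℓ _ _ _ h1 h3.symm h5.symm]; simp)
    have i3 := log_increment_unique (ℓ := fun t => L v v' w w' (1, t)) (m := ℓ v' w w')
      (by fun_prop) (by fun_prop) (-1) (fun t => by
        rw [E, hℓ _ _ _ h2 h5 h6]; simp)
    have i4 := log_increment_unique (ℓ := fun t => L v v' w w' (0, t)) (m := ℓ v w w')
      (by fun_prop) (by fun_prop) (-1) (fun t => by
        rw [E, hℓ _ _ _ h2 h3 h4]; simp)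
    rw [← i1, ← i2, ← i3, ← i4]
    ring

/-! ## A graph with a `K₅` minor is not planar -/

/-- The part of a drawing which belongs to the vertices in `U` and the edges between them. -/
def drawnPart {V E : Type*} (G : Graph V E) (f : V → Plane) (c : E → ℝ → Plane) (U : Set V) :
    Set Plane :=
  f '' U ∪ {z | ∃ e x y, G.IsLink e x y ∧ x ∈ U ∧ y ∈ U ∧ z ∈ c e '' Icc 0 1}

/-- Pick a vertex in each branch set and join the points of two of them within the drawing of the
union of both branch sets. For independent edges of `K₅` the unions are disjoint, so the drawn parts
are disjoint. Paths for adjacent edges may overlap, which `independent_edges_meet` permits. -/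
theorem not_isPlanar_of_hasMinor {V E : Type*} (G : Graph V E)
    (hG : HasMinor (SimpleGraph.completeGraph (Fin 5)) G) : ¬ IsPlanar G := by
  rintro ⟨f, c, hf, hc, hends, hav, hdisj⟩
  obtain ⟨B, hB, hBd, hBa⟩ := hG
  -- the points of the drawing of an edge
  have hpt : ∀ e x y, G.IsLink e x y → ∀ z ∈ c e '' Icc 0 1,
      z = f x ∨ z = f y ∨ z ∈ c e '' Ioo 0 1 := by
    rintro e x y hl _ ⟨u, hu, rfl⟩
    rcases eq_or_lt_of_le hu.1 with h0 | h0
    · subst h0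
      rcases hends e x y hl with h | h <;> simp [h.1]
    rcases eq_or_lt_of_le hu.2 with h1 | h1
    · subst h1
      rcases hends e x y hl with h | h <;> simp [h.2]
    exact Or.inr (Or.inr ⟨u, ⟨h0, h1⟩, rfl⟩)
  have hsep : ∀ U U' : Set V, U ⊆ G.vertexSet → U' ⊆ G.vertexSet → Disjoint U U' →
      Disjoint (drawnPart G f c U) (drawnPart G f c U') := by
    intro U U' hU hU' hd
    -- End points of edges are counted as vertices, so that only vertices and open edges have to be
    -- compared.
    have hform : ∀ W : Set V, ∀ z ∈ drawnPart G f c W, z ∈ f '' W ∨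
        ∃ e x y, G.IsLink e x y ∧ x ∈ W ∧ y ∈ W ∧ z ∈ c e '' Ioo 0 1 := by
      rintro W z (hz | ⟨e, x, y, hl, hx, hy, hz⟩)
      · exact Or.inl hz
      · rcases hpt e x y hl z hz with rfl | rfl | h
        · exact Or.inl ⟨_, hx, rfl⟩
        · exact Or.inl ⟨_, hy, rfl⟩
        · exact Or.inr ⟨e, x, y, hl, hx, hy, h⟩
    rw [Set.disjoint_left]
    intro z hz hz'
    rcases hform _ z hz with ⟨v, hv, rfl⟩ | ⟨e, x, y, hl, hx, hy, hez⟩ <;>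
      rcases hform _ _ hz' with ⟨v', hv', h'⟩ | ⟨e', x', y', hl', hx', hy', hez'⟩
    · exact Set.disjoint_left.1 hd hv (hf (hU' hv') (hU hv) h' ▸ hv')
    · obtain ⟨u, hu, hu'⟩ := hez'
      exact hav e' hl'.edge_mem v (hU hv) u hu hu'
    · obtain ⟨u, hu, rfl⟩ := hez
      exact hav e hl.edge_mem v' (hU' hv') u hu h'.symm
    -- A common edge would have its ends both in `U` and in `U'`; different edges have disjoint
    -- interiors.
    · by_cases hee : e = e'
      · subst hee
        rcases hl.left_eq_or_eq hl' with rfl | rfl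
        · exact Set.disjoint_left.1 hd hx hx'
        · exact Set.disjoint_left.1 hd hx hy'
      · exact Set.disjoint_left.1 (hdisj e hl.edge_mem e' hl'.edge_mem hee) hez hez'
  have hjoin : ∀ U : Set V, ∀ x ∈ U, ∀ y ∈ U, G.Adj x y →
      JoinedIn (drawnPart G f c U) (f x) (f y) := by
    rintro U x hx y hy ⟨e, hl⟩
    have hcont := (hc e hl.edge_mem).1
    have hj : JoinedIn (drawnPart G f c U) (c e 0) (c e 1) := by
      have hpc : IsPathConnected (c e '' Icc 0 1) :=
        ((convex_Icc (0 : ℝ) 1).isPathConnected ⟨0, by simp⟩).image' hcont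
      exact (hpc.joinedIn _ ⟨0, by simp, rfl⟩ _ ⟨1, by simp, rfl⟩).mono
        (fun z hz => Or.inr ⟨e, x, y, hl, hx, hy, hz⟩)
    rcases hends e x y hl with h | h
    · rw [← h.1, ← h.2]; exact hj
    · rw [← h.1, ← h.2]; exact hj.symm
  have hpath : ∀ U : Set V, ∀ B : Set V, B ⊆ U → ConnectedOn G B → ∀ x ∈ B, ∀ y ∈ B,
      JoinedIn (drawnPart G f c U) (f x) (f y) := by
    intro U B hBU hcon x hx y hy
    have := hcon x hx y hy
    induction this with
    | refl => exact JoinedIn.refl (Or.inl ⟨x, hBU hx, rfl⟩)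
    | tail _ hab ih => exact (ih hab.1).trans (hjoin U _ (hBU hab.1) _ (hBU hab.2.1) hab.2.2)
  choose r hr using fun i => (hB i).2.1
  have hjoined : ∀ i j, JoinedIn (drawnPart G f c (B i ∪ B j)) (f (r i)) (f (r j)) := by
    intro i j
    by_cases hij : i = j
    · subst hij
      exact JoinedIn.refl (Or.inl ⟨r i, Or.inl (hr i), rfl⟩)
    · obtain ⟨x, hx, y, hy, hxy⟩ := hBa i j hij
      exact ((hpath _ (B i) subset_union_left (hB i).2.2 _ (hr i) x hx).trans
        (hjoin _ x (Or.inl hx) y (Or.inr hy) hxy)).trans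
        (hpath _ (B j) subset_union_right (hB j).2.2 y hy _ (hr j))
  let Ψ : Plane ≃L[ℝ] ℂ := Complex.orthonormalBasisOneI.repr.symm.toContinuousLinearEquiv
  refine independent_edges_meet (fun i => Ψ (f (r i)))
    (fun i j => (hjoined i j).somePath.map Ψ.continuous) ?_
  intro i j k l _ _ hik hil hjk hjl s t hst
  have hst' := Ψ.injective hst
  refine Set.disjoint_left.1 (hsep (B i ∪ B j) (B k ∪ B l) (union_subset (hB i).1 (hB j).1)
    (union_subset (hB k).1 (hB l).1) ?_) ((hjoined i j).somePath_mem s)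
    (hst' ▸ (hjoined k l).somePath_mem t)
  simp only [disjoint_union_left, disjoint_union_right]
  exact ⟨⟨hBd _ _ hik, hBd _ _ hjk⟩, ⟨hBd _ _ hil, hBd _ _ hjl⟩⟩

/-! ## Ambient isotopies of the three-sphere -/

open scoped Topology in
-- Properness uniform in time makes the extension by `∞ ↦ ∞` jointly continuous at infinity. Each
-- stage is then a continuous bijection of a compact Hausdorff space, hence a homeomorphism, and no
-- continuity of the inverses has to be assumed.
theorem ambientIsotopic_of_proper (H : unitInterval × Space → Space) (hc : Continuous H)
    (hbij : ∀ t, Function.Bijective fun x => H (t, x)) (h0 : ∀ x, H (0, x) = x)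
    (hp : ∀ R : ℝ, ∃ R' : ℝ, ∀ t x, ‖H (t, x)‖ ≤ R → ‖x‖ ≤ R') (A : Set Space) :
    AmbientIsotopic ((fun x : Space => (x : Sphere3)) '' A)
      ((fun x : Space => (x : Sphere3)) '' ((fun x => H (1, x)) '' A)) := by
  let G : unitInterval × Sphere3 → Sphere3 := fun p => OnePoint.map (fun x => H (p.1, x)) p.2
  have Ginfty : ∀ t, G (t, OnePoint.infty) = OnePoint.infty := fun t => rfl
  have Gcoe : ∀ t (x : Space), G (t, (x : Sphere3)) = ((H (t, x) : Space) : Sphere3) :=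
    fun t x => rfl
  have hG : Continuous G := by
    rw [continuous_iff_continuousAt]
    rintro ⟨t, x⟩
    induction x using OnePoint.rec with
    | infty =>
      rw [ContinuousAt, Ginfty, OnePoint.hasBasis_nhds_infty.tendsto_right_iff]
      rintro s ⟨-, hs⟩
      obtain ⟨R, hR⟩ := hs.isBounded.subset_closedBall 0
      obtain ⟨R', hR'⟩ := hp R
      have hN : (((fun x : Space => (x : Sphere3)) '' (Metric.closedBall 0 R'))ᶜ : Set Sphere3) ∈
          𝓝 (OnePoint.infty : Sphere3) := by
        refine (OnePoint.isOpen_compl_image_coe.2 ⟨Metric.isClosed_closedBall,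
          isCompact_closedBall _ _⟩).mem_nhds ?_
        simp
      filter_upwards [prod_mem_nhds (Filter.univ_mem (f := 𝓝 t)) hN] with p hpm
      obtain ⟨u, y⟩ := p
      induction y using OnePoint.rec with
      | infty => right; rfl
      | coe y =>
        left
        refine ⟨H (u, y), fun hin => hpm.2 ⟨y, ?_, rfl⟩, rfl⟩
        have := hR hin
        simp only [Metric.mem_closedBall, dist_zero_right] at this ⊢
        exact hR' _ _ this
    | coe x =>
      have hemb : Topology.IsOpenEmbedding
          (Prod.map id (fun x : Space => (x : Sphere3)) : unitInterval × Space → _) :=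
        Topology.IsOpenEmbedding.id.prodMap OnePoint.isOpenEmbedding_coe
      have := hemb.continuousAt_iff (g := G) (x := (t, x))
      exact this.1 (OnePoint.continuous_coe.comp hc).continuousAt
  have hGbij : ∀ t, Function.Bijective fun y => G (t, y) := by
    intro t
    refine ⟨fun y y' hy => ?_, fun y => ?_⟩
    · induction y using OnePoint.rec with
      | infty => induction y' using OnePoint.rec with
        | infty => rfl
        | coe y' => exact absurd hy.symm (OnePoint.coe_ne_infty _)
      | coe y => induction y' using OnePoint.rec with
        | infty => exact absurd hy (OnePoint.coe_ne_infty _)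
        | coe y' => exact congrArg _ ((hbij t).1 (OnePoint.coe_injective hy))
    · induction y using OnePoint.rec with
      | infty => exact ⟨OnePoint.infty, rfl⟩
      | coe y =>
        obtain ⟨x, hx⟩ := (hbij t).2 y
        exact ⟨(x : Sphere3), congrArg _ hx⟩
  let h : unitInterval → (Sphere3 ≃ₜ Sphere3) := fun t =>
    Continuous.homeoOfEquivCompactToT2 (f := Equiv.ofBijective _ (hGbij t))
      (hG.comp (Continuous.prodMk_right t))
  have hh : ∀ t y, h t y = G (t, y) := fun t y => rfl
  refine ⟨h 1, ⟨h, hG, ?_, rfl⟩, ?_⟩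
  · ext y
    rw [hh]
    induction y using OnePoint.rec with
    | infty => rfl
    | coe y => rw [Gcoe, h0]; rfl
  · ext y
    simp only [mem_image, exists_exists_and_eq_and, hh, Gcoe]

theorem AmbientIsotopic.symm {X : Type*} [TopologicalSpace X] {A B : Set X}
    (h : AmbientIsotopic A B) : AmbientIsotopic B A := by
  obtain ⟨g, hg, rfl⟩ := h
  exact ⟨g.symm, hg.symm, by ext x; simp⟩

theorem AmbientIsotopic.trans {X : Type*} [TopologicalSpace X] {A B C : Set X}
    (h : AmbientIsotopic A B) (h' : AmbientIsotopic B C) : AmbientIsotopic A C := by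
  obtain ⟨g, hg, rfl⟩ := h
  obtain ⟨k, hk, rfl⟩ := h'
  exact ⟨g.trans k, hg.trans hk, by rw [image_image]; rfl⟩

/-! ## Transverse crossings -/

theorem mem_disc_iff (w : Plane) : w ∈ disc ↔ w 0 ^ 2 + w 1 ^ 2 ≤ 1 := by
  rw [disc, mem_closedBall_zero_iff, EuclideanSpace.norm_eq, Real.sqrt_le_one,
    Fin.sum_univ_two, Real.norm_eq_abs, Real.norm_eq_abs, sq_abs, sq_abs]

theorem plane_ext {v w : Plane} (h0 : v 0 = w 0) (h1 : v 1 = w 1) : v = w := by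
  ext i; fin_cases i <;> assumption

theorem plane_eta (w : Plane) : !₂[w 0, w 1] = w := plane_ext (by simp) (by simp)

section Crossing

variable {S : Type*} [TopologicalSpace S]

theorem crossPos_mem_disc (j : Fin 2) {u : ℝ} (hu : u ∈ Icc (-1 : ℝ) 1) : crossPos j u ∈ disc := by
  rw [mem_disc_iff]
  fin_cases j <;> simp [crossPos] <;> exact abs_le.2 hu

theorem CrossesAt.symm {γ : Circle → S} {s t : Circle} (h : CrossesAt γ s t) :
    CrossesAt γ t s := by
  obtain ⟨φ, e, ⟨hφc, hφi⟩, ⟨hec, hei⟩, ⟨ht, hp⟩, hs, ht'⟩ := h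
  let sw : Plane → Plane := fun w => !₂[w 1, w 0]
  have hsw : ∀ w ∈ disc, sw w ∈ disc := by
    intro w hw
    rw [mem_disc_iff] at hw ⊢
    simp only [sw, Matrix.cons_val_zero, Matrix.cons_val_one]
    linarith
  have hsw2 : ∀ w, sw (sw w) = w := fun w => by simp [sw, plane_eta]
  have himg : (fun w => φ (sw w)) '' disc = φ '' disc := by
    ext x; constructor
    · rintro ⟨w, hw, rfl⟩; exact ⟨_, hsw w hw, rfl⟩
    · rintro ⟨w, hw, rfl⟩; exact ⟨_, hsw w hw, by simp [hsw2]⟩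
  refine ⟨fun w => φ (sw w), fun j => e (1 - j), ⟨hφc.comp (by fun_prop) hsw, ?_⟩, ⟨fun j => hec _, ?_⟩,
    ⟨?_, ?_⟩, by simpa using ht', by simpa using hs⟩
  · intro v hv w hw hvw
    rw [← hsw2 v, hφi (hsw _ hv) (hsw _ hw) hvw, hsw2]
  · rintro ⟨j, u⟩ hu ⟨k, v⟩ hv huv
    have := @hei (1 - j, u) ⟨trivial, hu.2⟩ (1 - k, v) ⟨trivial, hv.2⟩ huv
    simp only [Prod.mk.injEq, sub_right_inj] at this
    exact Prod.ext this.1 this.2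
  · rw [himg, ht]
    ext x; constructor
    · rintro ⟨j, u, hu, h⟩; exact ⟨1 - j, u, hu, by simpa using h⟩
    · rintro ⟨j, u, hu, h⟩; exact ⟨1 - j, u, hu, h⟩
  · intro j u hu
    refine ⟨crossPos_mem_disc j hu, ?_⟩
    rw [(hp (1 - j) u hu).2]
    fin_cases j <;> simp [sw, crossPos]

/-- Being a transverse crossing is a local property. -/
theorem CrossesAt.congr {γ γ' : Circle → S} {s t : Circle} (h : CrossesAt γ s t) (U : Set S)
    (hU : IsOpen U) (hsU : γ s ∈ U) (hUγ : ∀ x, γ x ∈ U ∨ γ' x ∈ U → γ x = γ' x) :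
    CrossesAt γ' s t := by
  obtain ⟨φ, e, ⟨hφc, hφi⟩, ⟨hec, hei⟩, ⟨ht, hp⟩, hs, ht'⟩ := h
  have h0 : γ s = φ 0 := by
    have := (hp 0 0 (by simp)).2
    rw [hs] at this
    rw [this]
    congr 1
    exact plane_ext (by simp [crossPos]) (by simp [crossPos])
  obtain ⟨r, hr, hrU⟩ : ∃ r > 0, ∀ w ∈ disc, ‖w‖ < r → φ w ∈ U := by
    have := (hφc 0 (by simp [disc])).preimage_mem_nhdsWithin (hU.mem_nhds (h0 ▸ hsU))
    obtain ⟨r, hr, hsub⟩ := Metric.mem_nhdsWithin_iff.1 this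
    exact ⟨r, hr, fun w hw hwr => hsub ⟨by simpa using hwr, hw⟩⟩
  -- Shrinking by `δ` puts the disc inside `U`. A pair of diameters is invariant under scaling, so
  -- the smaller disc shows the same crossing.
  obtain ⟨δ, hδ0, hδ1, hδr⟩ : ∃ δ > 0, δ ≤ 1 ∧ δ < r :=
    ⟨min 1 (r / 2), by positivity, min_le_left _ _, (min_le_right _ _).trans_lt (by linarith)⟩
  have hdisc : ∀ w ∈ disc, δ • w ∈ disc := by
    intro w hw
    simp only [disc, Metric.mem_closedBall, dist_zero_right, norm_smul, Real.norm_eq_abs,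
      abs_of_pos hδ0] at hw ⊢
    nlinarith [norm_nonneg w]
  have hin : ∀ w ∈ disc, φ (δ • w) ∈ U := by
    intro w hw
    refine hrU _ (hdisc w hw) ?_
    simp only [disc, Metric.mem_closedBall, dist_zero_right, norm_smul, Real.norm_eq_abs,
      abs_of_pos hδ0] at hw ⊢
    nlinarith [norm_nonneg w]
  have hIcc : ∀ u ∈ Icc (-1 : ℝ) 1, δ * u ∈ Icc (-1 : ℝ) 1 := by
    rintro u ⟨h1, h2⟩
    constructor <;> nlinarith
  have hcp : ∀ j u, crossPos j (δ * u) = δ • crossPos j u := by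
    intro j u
    fin_cases j <;> exact plane_ext (by simp [crossPos]) (by simp [crossPos])
  have hval : ∀ j, ∀ u ∈ Icc (-1 : ℝ) 1, γ' (e j (δ * u)) = φ (δ • crossPos j u) := by
    intro j u hu
    have h1 := (hp j (δ * u) (hIcc u hu)).2
    rw [hcp] at h1
    rw [← h1]
    refine (hUγ _ (Or.inl ?_)).symm
    rw [h1]
    exact hin _ (crossPos_mem_disc j hu)
  refine ⟨fun w => φ (δ • w), fun j u => e j (δ * u), ⟨hφc.comp (by fun_prop) hdisc, ?_⟩,
    ⟨fun j => (hec j).comp (by fun_prop) hIcc, ?_⟩, ⟨?_, ?_⟩, by simpa using hs, by simpa using ht'⟩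
  · intro v hv w hw hvw
    exact smul_right_injective _ hδ0.ne' (hφi (hdisc v hv) (hdisc w hw) hvw)
  · rintro ⟨j, u⟩ hu ⟨k, v⟩ hv huv
    have := @hei (j, δ * u) ⟨trivial, hIcc u hu.2⟩ (k, δ * v)
      ⟨trivial, hIcc v hv.2⟩ huv
    simp only [Prod.mk.injEq, mul_eq_mul_left_iff, hδ0.ne', or_false] at this
    exact Prod.ext this.1 this.2
  · ext x; constructor
    · rintro ⟨w, hw, hwx⟩
      have hwx : φ (δ • w) = γ' x := hwx
      have hx : γ x = φ (δ • w) := by rw [hUγ x (Or.inr (hwx ▸ hin w hw)), hwx]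
      have : x ∈ γ ⁻¹' (φ '' disc) := ⟨_, hdisc w hw, hx.symm⟩
      rw [ht] at this
      obtain ⟨j, u, hu, rfl⟩ := this
      have hw' : crossPos j u = δ • w :=
        hφi (hp j u hu).1 (hdisc w hw) ((hp j u hu).2.symm.trans hx)
      have hw2 := (mem_disc_iff _).1 hw
      have e0 := congrArg (fun v : Plane => v 0) hw'
      have e1 := congrArg (fun v : Plane => v 1) hw'
      simp only [PiLp.smul_apply, smul_eq_mul] at e0 e1
      refine ⟨j, u / δ, ?_, by simp only [mul_div_cancel₀ _ hδ0.ne']⟩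
      rw [mem_Icc, ← abs_le, ← sq_le_one_iff_abs_le_one]
      fin_cases j <;> simp [crossPos] at e0 e1
      · rw [e0, mul_div_cancel_left₀ _ hδ0.ne']; nlinarith
      · rw [e1, mul_div_cancel_left₀ _ hδ0.ne']; nlinarith
    · rintro ⟨j, u, hu, rfl⟩
      exact ⟨crossPos j u, crossPos_mem_disc j hu, (hval j u hu).symm⟩
  · exact fun j u hu => ⟨crossPos_mem_disc j hu, hval j u hu⟩

end Crossing

/-! ## Flat charts and the first Reidemeister move -/

/-- The homeomorphism `Φ` of the plane identifies the part of the curve `γ` in the image of the unit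
disc with the horizontal diameter of the disc; this part of the curve is parametrized by `e`. -/
structure FlatAt (γ : Circle → Plane) (Φ : Plane ≃ₜ Plane) (e : ℝ → Circle) : Prop where
  cont : ContinuousOn e (Icc (-1) 1)
  inj : InjOn e (Icc (-1) 1)
  apply_eq : ∀ u ∈ Icc (-1 : ℝ) 1, γ (e u) = Φ !₂[u, 0]
  mem_of : ∀ t, Φ.symm (γ t) ∈ disc → t ∈ e '' Icc (-1) 1

/-- The curl of the first Reidemeister move. -/
def curlPos (u : ℝ) : Plane := !₂[2 * u ^ 3 - u, (1 - u ^ 2) / 2]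

@[simp] theorem curlPos_zero (u : ℝ) : curlPos u 0 = 2 * u ^ 3 - u := rfl
@[simp] theorem curlPos_one (u : ℝ) : curlPos u 1 = (1 - u ^ 2) / 2 := rfl

theorem curlPos_mem_disc {u : ℝ} (hu : u ∈ Icc (-1 : ℝ) 1) : curlPos u ∈ disc := by
  rw [mem_disc_iff, curlPos_zero, curlPos_one]
  have : u ^ 2 ≤ 1 := by nlinarith [hu.1, hu.2]
  nlinarith [mul_nonneg (sub_nonneg.2 this)
    (by positivity : 0 ≤ 3 / 4 + u ^ 2 / 4 + 4 * (u ^ 2) ^ 2)]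

theorem curlPos_eq_iff {u v : ℝ} : curlPos u = curlPos v ↔ u = v ∨ (v = -u ∧ u ^ 2 = 1 / 2) := by
  constructor
  · intro h
    have h0 := congrArg (fun w : Plane => w 0) h
    have h1 := congrArg (fun w : Plane => w 1) h
    simp only [curlPos_zero, curlPos_one] at h0 h1
    have h2 : (u - v) * (u + v) = 0 := by linarith
    rcases mul_eq_zero.1 h2 with h | h
    · exact Or.inl (by linarith)
    · have hv : v = -u := by linarith
      subst hv
      have h3 : u * (2 * u ^ 2 - 1) = 0 := by linarith
      rcases mul_eq_zero.1 h3 with h | h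
      · left; rw [h]; simp
      · right; exact ⟨rfl, by linarith⟩
  · rintro (rfl | ⟨rfl, h⟩)
    · rfl
    · refine plane_ext ?_ ?_ <;> simp only [curlPos_zero, curlPos_one]
      · linear_combination 4 * u * h
      · ring

/-- The curve obtained from `γ` by the first Reidemeister move in the chart `Φ`. -/
def curlCurve (γ : Circle → Plane) (Φ : Plane ≃ₜ Plane) (t : Circle) : Plane :=
  open Classical in
  if Φ.symm (γ t) ∈ disc then Φ (curlPos (Φ.symm (γ t) 0)) else γ t

namespace FlatAt

variable {γ : Circle → Plane} {Φ : Plane ≃ₜ Plane} {e : ℝ → Circle} (F : FlatAt γ Φ e)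

include F

theorem symm_apply {u : ℝ} (hu : u ∈ Icc (-1 : ℝ) 1) : Φ.symm (γ (e u)) = !₂[u, 0] := by
  rw [F.apply_eq u hu, Φ.symm_apply_apply]

theorem symm_apply_mem {u : ℝ} (hu : u ∈ Icc (-1 : ℝ) 1) : Φ.symm (γ (e u)) ∈ disc := by
  rw [F.symm_apply hu, mem_disc_iff]
  simpa using abs_le.2 hu

theorem mem_iff (t : Circle) : Φ.symm (γ t) ∈ disc ↔ t ∈ e '' Icc (-1) 1 :=
  ⟨F.mem_of t, by rintro ⟨u, hu, rfl⟩; exact F.symm_apply_mem hu⟩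

theorem curl_apply {u : ℝ} (hu : u ∈ Icc (-1 : ℝ) 1) : curlCurve γ Φ (e u) = Φ (curlPos u) := by
  rw [curlCurve, if_pos (F.symm_apply_mem hu), F.symm_apply hu]
  rfl

theorem curl_of_notMem {t : Circle} (ht : t ∉ e '' Icc (-1) 1) : curlCurve γ Φ t = γ t := by
  rw [curlCurve, if_neg (mt (F.mem_of t) ht)]

theorem curl_mem_iff (t : Circle) :
    Φ.symm (curlCurve γ Φ t) ∈ disc ↔ t ∈ e '' Icc (-1) 1 := by
  by_cases ht : t ∈ e '' Icc (-1) 1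
  · obtain ⟨u, hu, rfl⟩ := ht
    rw [F.curl_apply hu, Φ.symm_apply_apply]
    exact iff_of_true (curlPos_mem_disc hu) ⟨u, hu, rfl⟩
  · rw [F.curl_of_notMem ht, F.mem_iff]

theorem continuous_curlCurve (hγ : Continuous γ) : Continuous (curlCurve γ Φ) := by
  classical
  unfold curlCurve
  refine Continuous.if ?_ ?_ hγ
  · intro t ht
    have hcl : IsClosed {t | Φ.symm (γ t) ∈ disc} :=
      Metric.isClosed_closedBall.preimage (Φ.symm.continuous.comp hγ)
    have htm : Φ.symm (γ t) ∈ disc := hcl.frontier_subset ht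
    obtain ⟨u, hu, rfl⟩ := F.mem_of t htm
    -- On the frontier only the ends of the flat arc occur, and there the curl and the diameter
    -- agree.
    have hu1 : u ^ 2 = 1 := by
      by_contra hne
      have hlt : u ^ 2 < 1 := lt_of_le_of_ne (by nlinarith [hu.1, hu.2]) hne
      have hin : e u ∈ interior {t | Φ.symm (γ t) ∈ disc} := by
        refine interior_maximal (t := (fun t => Φ.symm (γ t)) ⁻¹' Metric.ball 0 1) (fun x hx =>
          (Metric.ball_subset_closedBall : Metric.ball (0 : Plane) 1 ⊆ disc) hx) (Metric.isOpen_ball.preimage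
            (Φ.symm.continuous.comp hγ)) ?_
        rw [mem_preimage, F.symm_apply hu, mem_ball_zero_iff, EuclideanSpace.norm_eq,
          Real.sqrt_lt' one_pos]
        simpa using hlt
      exact ht.2 hin
    rw [F.symm_apply hu, F.apply_eq u hu]
    congr 1
    refine plane_ext ?_ ?_
    · rw [curlPos_zero]; simp; linear_combination 2 * u * hu1
    · rw [curlPos_one]; simp [hu1]
  · refine Φ.continuous.comp ?_
    unfold curlPos
    fun_prop

/-- The curl stays in the disc, which the curve visits only along the flat arc; hence coincidences
between the arc and the rest neither arise nor disappear. Inside the disc `curlPos_eq_iff` leaves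
one new crossing, at the parameters `±1/√2`. -/
theorem curl_eq_curl_iff {s t : Circle} (hst : s ≠ t) : curlCurve γ Φ s = curlCurve γ Φ t ↔
    γ s = γ t ∨ ∃ u ∈ Icc (-1 : ℝ) 1, u ^ 2 = 1 / 2 ∧ s = e u ∧ t = e (-u) := by
  have neg_mem : ∀ u ∈ Icc (-1 : ℝ) 1, -u ∈ Icc (-1 : ℝ) 1 := fun u hu =>
    ⟨by linarith [hu.2], by linarith [hu.1]⟩
  by_cases hs : s ∈ e '' Icc (-1) 1
  · by_cases ht : t ∈ e '' Icc (-1) 1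
    · obtain ⟨u, hu, rfl⟩ := hs
      obtain ⟨v, hv, rfl⟩ := ht
      have huv : u ≠ v := fun h => hst (h ▸ rfl)
      rw [F.curl_apply hu, F.curl_apply hv, Φ.injective.eq_iff, curlPos_eq_iff,
        F.apply_eq u hu, F.apply_eq v hv, Φ.injective.eq_iff]
      constructor
      · rintro (h | ⟨rfl, h⟩)
        · exact absurd h huv
        · exact Or.inr ⟨u, hu, h, rfl, rfl⟩
      · rintro (h | ⟨w, hw, hw2, h1, h2⟩)
        · exact absurd (by simpa using congrArg (fun w : Plane => w 0) h) huv
        · rw [F.inj hu hw h1, F.inj hv (neg_mem w hw) h2]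
          exact Or.inr ⟨rfl, hw2⟩
    · refine iff_of_false (fun h => ht ?_) ?_
      · rw [← F.curl_mem_iff, ← h, F.curl_mem_iff]; exact hs
      · rintro (h | ⟨u, hu, -, -, h⟩)
        · apply ht; rw [← F.mem_iff, ← h, F.mem_iff]; exact hs
        · exact ht ⟨_, neg_mem u hu, h.symm⟩
  · by_cases ht : t ∈ e '' Icc (-1) 1
    · refine iff_of_false (fun h => hs ?_) ?_
      · rw [← F.curl_mem_iff, h, F.curl_mem_iff]; exact ht
      · rintro (h | ⟨u, hu, -, h, -⟩)
        · apply hs; rw [← F.mem_iff, h, F.mem_iff]; exact ht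
        · exact hs ⟨_, hu, h.symm⟩
    · rw [F.curl_of_notMem hs, F.curl_of_notMem ht]
      refine ⟨Or.inl, ?_⟩
      rintro (h | ⟨u, hu, -, h, -⟩)
      · exact h
      · exact absurd ⟨u, hu, h.symm⟩ hs

theorem eq_of_apply_eq {u : ℝ} (hu : u ∈ Icc (-1 : ℝ) 1) {s : Circle} (h : γ s = γ (e u)) :
    s = e u := by
  obtain ⟨v, hv, rfl⟩ := F.mem_of s (by rw [h]; exact F.symm_apply_mem hu)
  have := F.symm_apply hv
  rw [h, F.symm_apply hu] at this
  have h0 : u = v := by simpa using congrArg (fun w : Plane => w 0) this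
  rw [h0]

/-- A flat chart is not affected by the first Reidemeister move in a disjoint chart. -/
theorem curl_of_disjoint {Φ' : Plane ≃ₜ Plane} {e' : ℝ → Circle} (F' : FlatAt γ Φ' e')
    (h : ∀ x, Φ.symm x ∈ disc → Φ'.symm x ∈ disc → False) : FlatAt (curlCurve γ Φ) Φ' e' where
  cont := F'.cont
  inj := F'.inj
  apply_eq u hu := by
    rw [F.curl_of_notMem, F'.apply_eq u hu]
    intro hm
    exact h _ ((F.mem_iff _).2 hm) (F'.symm_apply_mem hu)
  mem_of t ht := by
    by_cases hm : t ∈ e '' Icc (-1) 1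
    · exact (h _ ((F.curl_mem_iff t).2 hm) ht).elim
    · rw [F.curl_of_notMem hm] at ht
      exact F'.mem_of t ht

end FlatAt

/-! ## The diagram with a curl -/

/-- The parameter of the self-crossing of the curl. -/
def σ₀ : ℝ := √(1 / 2)

theorem σ₀_pos : 0 < σ₀ := Real.sqrt_pos.2 (by norm_num)
theorem σ₀_sq : σ₀ ^ 2 = 1 / 2 := Real.sq_sqrt (by norm_num)
theorem σ₀_lt_one : σ₀ < 1 := by nlinarith [σ₀_sq, σ₀_pos]
theorem σ₀_mem : σ₀ ∈ Icc (-1 : ℝ) 1 := ⟨by linarith [σ₀_pos], σ₀_lt_one.le⟩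
theorem neg_σ₀_mem : -σ₀ ∈ Icc (-1 : ℝ) 1 := ⟨by linarith [σ₀_lt_one], by linarith [σ₀_pos]⟩
theorem sq_eq_half_iff {u : ℝ} : u ^ 2 = 1 / 2 ↔ u = σ₀ ∨ u = -σ₀ := by
  rw [← σ₀_sq, sq_eq_sq_iff_eq_or_eq_neg]

/-- The half-width of the curl, as a function of the height. -/
def curlWidth (τ : ℝ) : ℝ := √((1 + τ) / 2)

theorem curlWidth_sq {τ : ℝ} (h : -1 ≤ τ) : curlWidth τ ^ 2 = (1 + τ) / 2 :=
  Real.sq_sqrt (by linarith)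

theorem curlWidth_pos {τ : ℝ} (h : -1 < τ) : 0 < curlWidth τ := Real.sqrt_pos.2 (by linarith)

theorem curlWidth_mem {τ : ℝ} (h : -1 < τ) (h' : τ ≤ 1) : curlWidth τ ∈ Icc (-1 : ℝ) 1 :=
  ⟨by linarith [curlWidth_pos h], by nlinarith [curlWidth_pos h, curlWidth_sq h.le]⟩

theorem curlWidth_inj {τ τ' : ℝ} (h : -1 < τ) (h' : -1 < τ') (he : curlWidth τ = curlWidth τ') :
    τ = τ' := by
  have := congrArg (· ^ 2) he
  simp only [curlWidth_sq h.le, curlWidth_sq h'.le] at this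
  linarith

/-- A chart around the self-crossing of the curl. -/
def curlCross (w : Plane) : Plane :=
  !₂[curlWidth ((w 0 + w 1) / 4) * ((w 0 - w 1) / 4), (1 - (w 0 + w 1) / 4) / 4]

theorem disc_bounds {w : Plane} (hw : w ∈ disc) :
    |w 0| ≤ 1 ∧ |w 1| ≤ 1 := by
  rw [mem_disc_iff] at hw
  constructor <;> rw [← sq_le_one_iff_abs_le_one] <;> nlinarith [sq_nonneg (w 0), sq_nonneg (w 1)]

theorem disc_sum_bounds {w : Plane} (hw : w ∈ disc) :
    -1 / 2 ≤ (w 0 + w 1) / 4 ∧ (w 0 + w 1) / 4 ≤ 1 / 2 := by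
  obtain ⟨h0, h1⟩ := disc_bounds hw
  rw [abs_le] at h0 h1
  constructor <;> linarith

theorem curlCross_mem_disc {w : Plane} (hw : w ∈ disc) : curlCross w ∈ disc := by
  obtain ⟨h0, h1⟩ := disc_sum_bounds hw
  rw [mem_disc_iff] at hw ⊢
  simp only [curlCross, Matrix.cons_val_zero, Matrix.cons_val_one]
  rw [mul_pow, curlWidth_sq (by linarith)]
  have h2 : ((w 0 - w 1) / 4) ^ 2 ≤ 1 / 8 := by nlinarith [sq_nonneg (w 0 + w 1)]
  nlinarith [sq_nonneg ((w 0 - w 1) / 4)]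

theorem curlCross_injOn : InjOn curlCross disc := by
  intro v hv w hw h
  have e0 := congrArg (fun x : Plane => x 0) h
  have e1 := congrArg (fun x : Plane => x 1) h
  simp only [curlCross, Matrix.cons_val_zero, Matrix.cons_val_one] at e0 e1
  have hs : (v 0 + v 1) / 4 = (w 0 + w 1) / 4 := by linarith
  rw [hs] at e0
  have := mul_left_cancel₀ (curlWidth_pos (by linarith [(disc_sum_bounds hw).1])).ne' e0
  exact plane_ext (by linarith) (by linarith)

theorem continuous_curlWidth : Continuous curlWidth := by unfold curlWidth; fun_prop

theorem continuous_curlCross : Continuous curlCross := by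
  have := continuous_curlWidth
  unfold curlCross
  fun_prop

/-- With `τ = 2u² - 1` the curl is `x = uτ`, `y = (1 - τ)/4` and `u = ±curlWidth τ`, so its two
branches are `x = ±curlWidth τ * τ`. The chart sets `τ = (w 0 + w 1)/4` and `x = curlWidth τ * (w 0
- w 1)/4`, which turns the branches into `w 1 = 0` and `w 0 = 0`. The divisor 4 keeps `τ` away from
`-1`, where the width vanishes. -/
theorem curlPos_mem_curlCross_iff {u : ℝ} {w : Plane} (hw : w ∈ disc) (h : curlPos u = curlCross w) :
    (w 1 = 0 ∧ u = curlWidth (w 0 / 4)) ∨ (w 0 = 0 ∧ u = -curlWidth (w 1 / 4)) := by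
  have e0 := congrArg (fun x : Plane => x 0) h
  have e1 := congrArg (fun x : Plane => x 1) h
  simp only [curlCross, curlPos_zero, curlPos_one, Matrix.cons_val_zero, Matrix.cons_val_one] at e0 e1
  obtain ⟨h0, -⟩ := disc_sum_bounds hw
  set τ := (w 0 + w 1) / 4 with hτ
  have hk := curlWidth_sq (τ := τ) (by linarith)
  have hkp := curlWidth_pos (τ := τ) (by linarith)
  have hu2 : u ^ 2 = curlWidth τ ^ 2 := by rw [hk]; linarith
  have e0' : u * τ = curlWidth τ * ((w 0 - w 1) / 4) := by
    rw [← e0]; linear_combination (-2 * u) * (hu2.trans hk)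
  rcases sq_eq_sq_iff_eq_or_eq_neg.1 hu2 with h | h
  · left
    rw [h] at e0'
    have := mul_left_cancel₀ hkp.ne' e0'
    have h1 : w 1 = 0 := by linarith
    refine ⟨h1, ?_⟩
    rw [h, hτ, h1, add_zero]
  · right
    rw [h] at e0'
    have := mul_left_cancel₀ hkp.ne' (show curlWidth τ * (-τ) = curlWidth τ * ((w 0 - w 1) / 4) by linarith)
    have h1 : w 0 = 0 := by linarith
    refine ⟨h1, ?_⟩
    rw [h, hτ, h1, zero_add]

theorem curlPos_curlWidth {τ : ℝ} (h : -1 ≤ τ) :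
    curlPos (curlWidth τ) = !₂[curlWidth τ * τ, (1 - τ) / 4] := by
  refine plane_ext ?_ ?_ <;> simp
  · linear_combination 2 * curlWidth τ * curlWidth_sq h
  · linear_combination (-1 / 2) * curlWidth_sq h

theorem curlPos_neg_curlWidth {τ : ℝ} (h : -1 ≤ τ) :
    curlPos (-curlWidth τ) = !₂[curlWidth τ * (-τ), (1 - τ) / 4] := by
  refine plane_ext ?_ ?_ <;> simp
  · linear_combination (-2) * curlWidth τ * curlWidth_sq h
  · linear_combination (-1 / 2) * curlWidth_sq h

namespace FlatAt

variable {γ : Circle → Plane} {Φ : Plane ≃ₜ Plane} {e : ℝ → Circle} (F : FlatAt γ Φ e)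

include F

theorem crossesAt_curl : CrossesAt (curlCurve γ Φ) (e σ₀) (e (-σ₀)) := by
  have hk0 : curlWidth 0 = σ₀ := by simp [curlWidth, σ₀]
  have hτ : ∀ u ∈ Icc (-1 : ℝ) 1, -1 < u / 4 ∧ u / 4 ≤ 1 := fun u hu =>
    ⟨by linarith [hu.1], by linarith [hu.2]⟩
  have hkm : ∀ u ∈ Icc (-1 : ℝ) 1, curlWidth (u / 4) ∈ Icc (-1 : ℝ) 1 := fun u hu =>
    curlWidth_mem (hτ u hu).1 (hτ u hu).2
  have hkm' : ∀ u ∈ Icc (-1 : ℝ) 1, -curlWidth (u / 4) ∈ Icc (-1 : ℝ) 1 := fun u hu =>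
    ⟨by linarith [(hkm u hu).2], by linarith [(hkm u hu).1]⟩
  have hkc : Continuous fun u : ℝ => curlWidth (u / 4) := continuous_curlWidth.comp (by fun_prop)
  have hval : ∀ j, ∀ u ∈ Icc (-1 : ℝ) 1, curlCurve γ Φ
      ((![fun u => e (curlWidth (u / 4)), fun u => e (-curlWidth (u / 4))] : Fin 2 → ℝ → Circle) j u)
        = Φ (curlCross (crossPos j u)) := by
    intro j u hu
    fin_cases j
    · simp only [Fin.zero_eta, Matrix.cons_val_zero]
      rw [F.curl_apply (hkm u hu), curlPos_curlWidth (by linarith [hu.1])]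
      simp [curlCross, crossPos]
    · simp only [Fin.mk_one, Matrix.cons_val_one, Matrix.cons_val_fin_one]
      rw [F.curl_apply (hkm' u hu), curlPos_neg_curlWidth (by linarith [hu.1])]
      simp [curlCross, crossPos, neg_div]
  refine ⟨fun w => Φ (curlCross w), ![fun u => e (curlWidth (u / 4)), fun u => e (-curlWidth (u / 4))],
    ⟨(Φ.continuous.comp continuous_curlCross).continuousOn,
      fun v hv w hw h => curlCross_injOn hv hw (Φ.injective h)⟩, ⟨?_, ?_⟩, ⟨?_, ?_⟩, ?_, ?_⟩
  · intro j
    fin_cases j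
    · exact F.cont.comp hkc.continuousOn hkm
    · exact F.cont.comp hkc.neg.continuousOn hkm'
  · rintro ⟨j, u⟩ ⟨-, hu⟩ ⟨k, v⟩ ⟨-, hv⟩ h
    simp only at hu hv h
    have pu := curlWidth_pos (hτ u hu).1
    have pv := curlWidth_pos (hτ v hv).1
    fin_cases j <;> fin_cases k <;> simp at h ⊢
    · have := curlWidth_inj (hτ u hu).1 (hτ v hv).1 (F.inj (hkm u hu) (hkm v hv) h)
      linarith
    · have := F.inj (hkm u hu) (hkm' v hv) h
      linarith
    · have := F.inj (hkm' u hu) (hkm v hv) h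
      linarith
    · have := curlWidth_inj (hτ u hu).1 (hτ v hv).1
        (neg_injective (F.inj (hkm' u hu) (hkm' v hv) h))
      linarith
  · ext t; constructor
    · rintro ⟨w, hw, h⟩
      have htm : t ∈ e '' Icc (-1) 1 := by
        rw [← F.curl_mem_iff, ← h, Φ.symm_apply_apply]
        exact curlCross_mem_disc hw
      obtain ⟨u, hu, rfl⟩ := htm
      rw [F.curl_apply hu] at h
      obtain ⟨b0, b1⟩ := disc_bounds hw
      rcases curlPos_mem_curlCross_iff hw (Φ.injective h).symm with ⟨-, h⟩ | ⟨-, h⟩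
      · exact ⟨0, w 0, abs_le.1 b0, by simp [h]⟩
      · exact ⟨1, w 1, abs_le.1 b1, by simp [h]⟩
    · rintro ⟨j, u, hu, rfl⟩
      exact ⟨_, crossPos_mem_disc j hu, (hval j u hu).symm⟩
  · exact fun j u hu => ⟨crossPos_mem_disc j hu, hval j u hu⟩
  · simp [hk0]
  · simp [hk0]

end FlatAt

/-- A curve with a flat chart has no double points there. -/
theorem FlatAt.notMem_upper {D : Diagram Plane} {Φ : Plane ≃ₜ Plane} {e : ℝ → Circle}
    (F : FlatAt D.curve Φ e) {u : ℝ} (hu : u ∈ Icc (-1 : ℝ) 1) : e u ∉ D.upper := by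
  intro h
  obtain ⟨s, hs, hse⟩ := D.upper_subset _ h
  exact hs (F.eq_of_apply_eq hu hse)

/-- The diagram obtained from `D` by the first Reidemeister move in the flat chart `Φ`. -/
def curlDiagram (D : Diagram Plane) (Φ : Plane ≃ₜ Plane) (e : ℝ → Circle)
    (F : FlatAt D.curve Φ e) : Diagram Plane where
  curve := curlCurve D.curve Φ
  upper := insert (e σ₀) D.upper
  continuous_curve := F.continuous_curlCurve D.continuous_curve
  finite_double := by
    refine (D.finite_double.union (toFinite {e σ₀, e (-σ₀)})).subset ?_
    rintro t ⟨s, hst, h⟩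
    rcases (F.curl_eq_curl_iff hst).1 h with h | ⟨u, -, hu2, rfl, rfl⟩
    · exact Or.inl ⟨s, hst, h⟩
    · right
      rcases sq_eq_half_iff.1 hu2 with rfl | rfl <;> simp
  no_triple := by
    intro r s t hrs hst
    by_contra! hne
    have key : ∀ u ∈ Icc (-1 : ℝ) 1, u ^ 2 = 1 / 2 → ∀ x, x ≠ e (-u) → x ≠ e u →
        curlCurve D.curve Φ x ≠ curlCurve D.curve Φ (e u) := by
      intro u hu hu2 x hx hx' h
      rcases (F.curl_eq_curl_iff hx').1 h with h | ⟨v, hv, hv2, rfl, h⟩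
      · exact hx' (F.eq_of_apply_eq hu h)
      · rcases sq_eq_half_iff.1 hu2 with rfl | rfl <;> rcases sq_eq_half_iff.1 hv2 with rfl | rfl <;>
          simp_all
    have hn : ∀ u ∈ Icc (-1 : ℝ) 1, -u ∈ Icc (-1 : ℝ) 1 := fun u hu =>
      ⟨by linarith [hu.2], by linarith [hu.1]⟩
    rcases (F.curl_eq_curl_iff hne.1).1 hrs with h | ⟨u, hu, hu2, rfl, rfl⟩
    · rcases (F.curl_eq_curl_iff hne.2.1).1 hst with h' | ⟨u, hu, hu2, rfl, rfl⟩
      · rcases D.no_triple r s t h h' with h | h | h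
        exacts [hne.1 h, hne.2.1 h, hne.2.2 h]
      · exact key u hu hu2 r hne.2.2 hne.1 hrs
    · refine key (-u) (hn u hu) (by rw [neg_sq]; exact hu2) t ?_ hne.2.1.symm hst.symm
      rw [neg_neg]
      exact hne.2.2.symm
  crosses := by
    intro s t hst h
    rcases (F.curl_eq_curl_iff hst).1 h with h' | ⟨u, hu, hu2, rfl, rfl⟩
    -- An old crossing lies outside the closed disc, and the curve has not changed on this open
    -- complement.
    · refine (D.crosses s t hst h').congr {x | Φ.symm x ∉ disc} ?_ ?_ ?_
      · exact (Metric.isClosed_closedBall.isOpen_compl).preimage Φ.symm.continuous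
      · intro hin
        obtain ⟨u, hu, rfl⟩ := F.mem_of s hin
        exact hst (F.eq_of_apply_eq hu h'.symm).symm
      · intro x hx
        have : x ∉ e '' Icc (-1) 1 := by
          rcases hx with hx | hx
          · exact fun hm => hx ((F.mem_iff x).2 hm)
          · exact fun hm => hx ((F.curl_mem_iff x).2 hm)
        exact (F.curl_of_notMem this).symm
    · rcases sq_eq_half_iff.1 hu2 with rfl | rfl
      · exact F.crossesAt_curl
      · rw [neg_neg]; exact F.crossesAt_curl.symm
  upper_subset := by
    rintro t (rfl | ht)
    · have hne : e (-σ₀) ≠ e σ₀ := fun h => by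
        have := F.inj neg_σ₀_mem σ₀_mem h
        linarith [σ₀_pos]
      refine ⟨e (-σ₀), hne, (F.curl_eq_curl_iff hne).2 (Or.inr ⟨-σ₀, neg_σ₀_mem, ?_, rfl, ?_⟩)⟩
      · rw [neg_sq, σ₀_sq]
      · rw [neg_neg]
    · obtain ⟨s, hst, h⟩ := D.upper_subset t ht
      exact ⟨s, hst, (F.curl_eq_curl_iff hst).2 (Or.inl h)⟩
  upper_iff := by
    intro s t hst h
    have hnd : ∀ u ∈ Icc (-1 : ℝ) 1, ∀ x y, x ≠ y → D.curve x = D.curve y → x ≠ e u := by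
      rintro u hu x y hxy hc rfl
      exact hxy (F.eq_of_apply_eq hu hc.symm).symm
    rcases (F.curl_eq_curl_iff hst).1 h with h | ⟨u, hu, hu2, rfl, rfl⟩
    · simp only [mem_insert_iff, hnd _ σ₀_mem s t hst h, hnd _ σ₀_mem t s hst.symm h.symm, false_or]
      exact D.upper_iff s t hst h
    · have hne : e (-σ₀) ≠ e σ₀ := fun h => by
        have := F.inj neg_σ₀_mem σ₀_mem h
        linarith [σ₀_pos]
      rcases sq_eq_half_iff.1 hu2 with rfl | rfl
      · simp [hne, F.notMem_upper neg_σ₀_mem]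
      · simp [hne, F.notMem_upper neg_σ₀_mem]

theorem isMove_curlDiagram (D : Diagram Plane) (Φ : Plane ≃ₜ Plane) (e : ℝ → Circle)
    (F : FlatAt D.curve Φ e) : IsMove D (curlDiagram D Φ e F) := by
  have harc : arcsRange (fun _ : Fin 1 => e) = e '' Icc (-1) 1 := by
    ext t; simp [arcsRange]
  have hpre : ∀ t, t ∈ Φ '' disc ↔ Φ.symm t ∈ disc := fun t =>
    ⟨by rintro ⟨w, hw, rfl⟩; simpa using hw, fun h => ⟨_, h, by simp⟩⟩
  refine Or.inl ⟨Φ, fun _ => e, ⟨Φ.continuous.continuousOn, Φ.injective.injOn⟩,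
    ⟨fun _ => F.cont, ?_⟩, ⟨⟨?_, ?_⟩, ?_⟩, ⟨⟨?_, ?_⟩, ?_⟩, ?_⟩
  · rintro ⟨j, u⟩ ⟨-, hu⟩ ⟨k, v⟩ ⟨-, hv⟩ h
    exact Prod.ext (Subsingleton.elim _ _) (F.inj hu hv h)
  · ext t; rw [harc, mem_preimage, hpre, F.mem_iff]
  · intro j u hu
    refine ⟨?_, F.apply_eq u hu⟩
    have := F.symm_apply_mem hu
    rwa [F.symm_apply hu] at this
  · intro j u hu
    refine iff_of_false (F.notMem_upper hu) ?_
    rintro ⟨k, v, hv, -, h⟩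
    exact lt_irrefl _ h
  · ext t; rw [harc, mem_preimage, hpre]; exact F.curl_mem_iff t
  · exact fun j u hu => ⟨curlPos_mem_disc hu, F.curl_apply hu⟩
  · intro j u hu
    have h1 : e u ∈ (curlDiagram D Φ e F).upper ↔ u = σ₀ := by
      simp only [curlDiagram, mem_insert_iff, F.notMem_upper hu, or_false]
      exact ⟨fun h => F.inj hu σ₀_mem h, fun h => h ▸ rfl⟩
    rw [h1]
    constructor
    · rintro rfl
      refine ⟨0, -σ₀, neg_σ₀_mem, ?_, ?_⟩
      · exact (curlPos_eq_iff.2 (Or.inr ⟨rfl, σ₀_sq⟩)).symm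
      · simp only [r1After]; linarith [σ₀_pos]
    · rintro ⟨k, v, hv, h, hlt⟩
      have hlt : v < u := hlt
      rcases curlPos_eq_iff.1 (show curlPos v = curlPos u from h) with h | ⟨h, h2⟩
      · exact absurd h hlt.ne
      · rcases sq_eq_half_iff.1 h2 with rfl | rfl
        · linarith [σ₀_pos]
        · rw [h, neg_neg]
  · intro t ht
    rw [harc] at ht
    refine ⟨(F.curl_of_notMem ht).symm, ?_⟩
    have : t ≠ e σ₀ := fun h => ht ⟨σ₀, σ₀_mem, h.symm⟩
    simp [curlDiagram, this]

/-! ## The flat chart in the loop of a curl -/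

/-- The projection of the line to `[-1,1]`. -/
def clamp (a : ℝ) : ℝ := max (-1) (min 1 a)

theorem clamp_mem (a : ℝ) : clamp a ∈ Icc (-1 : ℝ) 1 :=
  ⟨le_max_left _ _, max_le (by norm_num) (min_le_left _ _)⟩

theorem clamp_of_mem {a : ℝ} (h : a ∈ Icc (-1 : ℝ) 1) : clamp a = a := by
  rw [clamp, min_eq_right h.2, max_eq_right h.1]

theorem continuous_clamp : Continuous clamp := by unfold clamp; fun_prop

theorem clamp_mono : Monotone clamp := fun _ _ h => max_le_max le_rfl (min_le_min le_rfl h)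

theorem sub_clamp_mono : Monotone fun a => a - clamp a := by
  intro a b h
  simp only [clamp]
  grind

theorem abs_clamp_le (a : ℝ) : |clamp a| ≤ 1 := abs_le.2 (clamp_mem a)

/-- A homeomorphism of the line which is equal to `u ↦ 2 u³ - u` at `u = a / 4` for `|a| ≤ 1`, up to
sign. -/
def loopFun (a : ℝ) : ℝ := clamp a / 4 - clamp a ^ 3 / 32 + (a - clamp a)

theorem strictMono_loopFun : StrictMono loopFun := by
  intro a b h
  have h1 := clamp_mono h.le
  have h2 := sub_clamp_mono h.le
  have ha := clamp_mem a
  have hb := clamp_mem b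
  simp only [loopFun] at h2 ⊢
  rcases h1.eq_or_lt with h1 | h1
  · rw [h1]; linarith
  · have : clamp a ^ 2 + clamp a * clamp b + clamp b ^ 2 ≤ 3 := by
      nlinarith [ha.1, ha.2, hb.1, hb.2, sq_nonneg (clamp a - clamp b)]
    nlinarith [mul_pos (sub_pos.2 h1) (by linarith : 0 < 8 - (clamp a ^ 2 + clamp a * clamp b + clamp b ^ 2))]

theorem continuous_loopFun : Continuous loopFun := by
  have := continuous_clamp
  unfold loopFun
  fun_prop

theorem surjective_loopFun : Function.Surjective loopFun := by
  have hb : ∀ a, a - 3 ≤ loopFun a ∧ loopFun a ≤ a + 3 := by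
    intro a
    obtain ⟨h1, h2⟩ := clamp_mem a
    have h3 : clamp a ^ 3 ≤ 1 := by nlinarith [sq_nonneg (clamp a), sq_nonneg (clamp a + 1)]
    have h4 : -1 ≤ clamp a ^ 3 := by nlinarith [sq_nonneg (clamp a), sq_nonneg (clamp a - 1)]
    simp only [loopFun]
    constructor <;> linarith
  refine continuous_loopFun.surjective ?_ ?_
  · exact Filter.tendsto_atTop_mono (fun a => (hb a).1)
      (Filter.tendsto_atTop_add_const_right _ _ Filter.tendsto_id)
  · exact Filter.tendsto_atBot_mono (fun a => (hb a).2)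
      (Filter.tendsto_atBot_add_const_right _ _ Filter.tendsto_id)

def loopHomeo : ℝ ≃ₜ ℝ := (strictMono_loopFun.orderIsoOfSurjective _ surjective_loopFun).toHomeomorph

/-- The height of the loop of the curl. -/
def loopHeight (a : ℝ) : ℝ := (1 - (clamp a / 4) ^ 2) / 2

theorem continuous_loopHeight : Continuous loopHeight := by
  have := continuous_clamp
  unfold loopHeight
  fun_prop

/-- A homeomorphism of the plane which takes the disc to a neighbourhood of the top of the curl. -/
def loopChart : Plane ≃ₜ Plane where
  toFun w := !₂[-loopHomeo (w 0), loopHeight (w 0) + w 1 / 32]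
  invFun w := !₂[loopHomeo.symm (-(w 0)), 32 * (w 1 - loopHeight (loopHomeo.symm (-(w 0))))]
  left_inv w := by
    refine plane_ext ?_ ?_
    · simp
    · simp
      ring
  right_inv w := by
    refine plane_ext ?_ ?_ <;> simp
  continuous_toFun := by
    have := continuous_loopHeight
    fun_prop
  continuous_invFun := by
    have := continuous_loopHeight
    fun_prop

theorem loopChart_zero (w : Plane) : loopChart w 0 = -loopFun (w 0) := rfl
theorem loopChart_one (w : Plane) : loopChart w 1 = loopHeight (w 0) + w 1 / 32 := rfl

theorem loopChart_apply_diameter {u : ℝ} (hu : u ∈ Icc (-1 : ℝ) 1) :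
    loopChart !₂[u, 0] = curlPos (u / 4) := by
  refine plane_ext ?_ ?_
  · rw [loopChart_zero, curlPos_zero]
    simp only [loopFun, Matrix.cons_val_zero, clamp_of_mem hu]
    ring
  · rw [loopChart_one, curlPos_one]
    simp [loopHeight, clamp_of_mem hu]

theorem loopChart_mem_disc {w : Plane} (hw : w ∈ disc) : loopChart w ∈ disc := by
  obtain ⟨h0, h1⟩ := disc_bounds hw
  rw [abs_le] at h0 h1
  rw [mem_disc_iff, loopChart_zero, loopChart_one]
  have h2 : w 0 ^ 2 ≤ 1 := by nlinarith
  have e0 : loopFun (w 0) = w 0 * (8 - w 0 ^ 2) / 32 := by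
    simp only [loopFun, clamp_of_mem h0]; ring
  have e1 : (-loopFun (w 0)) ^ 2 ≤ 1 / 16 := by
    rw [e0]
    have : (-(w 0 * (8 - w 0 ^ 2) / 32)) ^ 2 = w 0 ^ 2 * (8 - w 0 ^ 2) ^ 2 / 1024 := by ring
    rw [this]
    have : (8 - w 0 ^ 2) ^ 2 ≤ 64 := by nlinarith [sq_nonneg (w 0)]
    nlinarith [sq_nonneg (w 0), mul_le_mul h2 this (sq_nonneg _) zero_le_one]
  have e2 : 0 ≤ loopHeight (w 0) ∧ loopHeight (w 0) ≤ 1 / 2 := by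
    simp only [loopHeight, clamp_of_mem h0]
    constructor <;> nlinarith
  nlinarith [sq_nonneg (loopHeight (w 0))]

/-- The chart is thin: comparing heights bounds `u²` by `1/8`. In this range `u ↦ 2u³ - u` is
injective, so the horizontal coordinate forces `u = w 0 / 4`. -/
theorem curlPos_mem_loopChart {u : ℝ} {w : Plane} (hw : w ∈ disc) (h : loopChart w = curlPos u) :
    u ∈ Icc (-1 / 4 : ℝ) (1 / 4) := by
  obtain ⟨h0, h1⟩ := disc_bounds hw
  rw [abs_le] at h0 h1
  have e0 := congrArg (fun x : Plane => x 0) h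
  have e1 := congrArg (fun x : Plane => x 1) h
  simp only [loopChart_zero, loopChart_one, curlPos_zero, curlPos_one, loopFun, loopHeight,
    clamp_of_mem h0] at e0 e1
  have h2 : w 0 ^ 2 ≤ 1 := by nlinarith
  have hu : u ^ 2 ≤ 1 / 8 := by nlinarith
  have e0' : (u - w 0 / 4) * (1 - 2 * (u ^ 2 + u * (w 0 / 4) + (w 0 / 4) ^ 2)) = 0 := by linarith
  have hpos : 0 < 1 - 2 * (u ^ 2 + u * (w 0 / 4) + (w 0 / 4) ^ 2) := by
    nlinarith [sq_nonneg (u - w 0 / 4)]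
  have := (mul_eq_zero.1 e0').resolve_right hpos.ne'
  constructor <;> linarith

/-- After the first Reidemeister move there is a flat chart in the loop of the curl. -/
theorem FlatAt.curl_loop {γ : Circle → Plane} {Φ : Plane ≃ₜ Plane} {e : ℝ → Circle}
    (F : FlatAt γ Φ e) : FlatAt (curlCurve γ Φ) (loopChart.trans Φ) (fun u => e (u / 4)) where
  cont := F.cont.comp (by fun_prop) fun u hu => ⟨by linarith [hu.1], by linarith [hu.2]⟩
  inj u hu v hv h := by
    have := F.inj (⟨by linarith [hu.1], by linarith [hu.2]⟩ : u / 4 ∈ Icc (-1 : ℝ) 1)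
      (⟨by linarith [hv.1], by linarith [hv.2]⟩ : v / 4 ∈ Icc (-1 : ℝ) 1) h
    linarith
  apply_eq u hu := by
    rw [F.curl_apply ⟨by linarith [hu.1], by linarith [hu.2]⟩, ← loopChart_apply_diameter hu]
    rfl
  mem_of t ht := by
    have hw : loopChart.symm (Φ.symm (curlCurve γ Φ t)) ∈ disc := ht
    have h1 : Φ.symm (curlCurve γ Φ t) ∈ disc := by
      simpa using loopChart_mem_disc hw
    obtain ⟨u, hu, rfl⟩ := (F.curl_mem_iff t).1 h1
    rw [F.curl_apply hu] at hw
    simp only [Homeomorph.symm_apply_apply] at hw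
    have := curlPos_mem_loopChart hw (loopChart.apply_symm_apply _)
    exact ⟨4 * u, ⟨by linarith [this.1], by linarith [this.2]⟩, congrArg e (by ring)⟩

/-! ## Isotopies of lifted curves -/

/-- Space as the product of the plane and the vertical line. -/
def spaceEquiv : Space ≃ₗ[ℝ] Plane × ℝ where
  toFun x := (!₂[x 0, x 1], x 2)
  invFun p := !₂[p.1 0, p.1 1, p.2]
  map_add' x y := by
    refine Prod.ext (plane_ext ?_ ?_) ?_ <;> simp
  map_smul' c x := by
    refine Prod.ext (plane_ext ?_ ?_) ?_ <;> simp
  left_inv x := by ext i; fin_cases i <;> simp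
  right_inv p := by
    refine Prod.ext (plane_ext ?_ ?_) ?_ <;> simp

def spaceEquivL : Space ≃L[ℝ] Plane × ℝ := spaceEquiv.toContinuousLinearEquiv

theorem planeLift_eq (x : Plane) (z : ℝ) :
    planeLift x z = ((spaceEquivL.symm (x, z) : Space) : Sphere3) := rfl

theorem lift_isotopic (G : unitInterval × (Plane × ℝ) → Plane × ℝ) (hc : Continuous G)
    (hbij : ∀ t, Function.Bijective fun p => G (t, p)) (h0 : ∀ p, G (0, p) = p)
    (hp : ∀ R : ℝ, ∃ R' : ℝ, ∀ t p, ‖G (t, p)‖ ≤ R → ‖p‖ ≤ R') {ι : Type*} (f : ι → Plane × ℝ) :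
    AmbientIsotopic (range fun i => planeLift (f i).1 (f i).2)
      (range fun i => planeLift (G (1, f i)).1 (G (1, f i)).2) := by
  obtain ⟨C, hC, hCb⟩ := spaceEquivL.toContinuousLinearMap.bound
  obtain ⟨C', hC', hCb'⟩ := spaceEquivL.symm.toContinuousLinearMap.bound
  have := ambientIsotopic_of_proper (fun q => spaceEquivL.symm (G (q.1, spaceEquivL q.2)))
    (by fun_prop)
    (fun t => spaceEquivL.symm.bijective.comp ((hbij t).comp spaceEquivL.bijective))
    (fun x => by simp [h0]) ?_ (range fun i => spaceEquivL.symm (f i))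
  · rw [← range_comp, ← range_comp, ← range_comp] at this
    convert! this using 2
    funext i
    simp [planeLift_eq]
  · intro R
    obtain ⟨R', hR'⟩ := hp (C * R)
    refine ⟨C' * R', fun t x hx => ?_⟩
    have h1 : ‖G (t, spaceEquivL x)‖ ≤ C * R := by
      have := hCb (spaceEquivL.symm (G (t, spaceEquivL x)))
      simp only [ContinuousLinearEquiv.coe_coe, ContinuousLinearEquiv.apply_symm_apply] at this
      exact this.trans (mul_le_mul_of_nonneg_left hx hC.le)
    have h2 := hCb' (spaceEquivL x)
    simp only [ContinuousLinearEquiv.coe_coe, ContinuousLinearEquiv.symm_apply_apply] at h2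
    exact h2.trans (mul_le_mul_of_nonneg_left (hR' t _ h1) hC'.le)

/-- Adding to the height a function of the point of the plane does not change the knot. -/
theorem vertical_isotopic (f : Plane → ℝ) (hf : Continuous f) {ι : Type*} (w : ι → Plane) (z : ι → ℝ) :
    AmbientIsotopic (range fun i => planeLift (w i) (z i))
      (range fun i => planeLift (w i) (z i + f (w i))) := by
  have := lift_isotopic (fun q => (q.2.1, q.2.2 + (q.1 : ℝ) * f q.2.1)) (by fun_prop) ?_ ?_ ?_
    (fun i => (w i, z i))
  · simpa using this
  · intro t
    refine Function.bijective_iff_has_inverse.2 ⟨fun p => (p.1, p.2 - (t : ℝ) * f p.1),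
      fun p => by simp, fun p => by simp⟩
  · intro p; simp
  · intro R
    obtain ⟨M, hM⟩ := (isCompact_closedBall (0 : Plane) R).exists_bound_of_continuousOn hf.continuousOn
    refine ⟨max R (R + M), fun t p hp => ?_⟩
    rw [Prod.norm_def, sup_le_iff] at hp ⊢
    simp only at hp
    have h1 := hM p.1 (by simpa using hp.1)
    have h2 := hp.2
    rw [Real.norm_eq_abs, abs_le] at h1 h2
    refine ⟨hp.1.trans (le_max_left _ _), le_trans ?_ (le_max_right _ _)⟩
    have t0 := t.2.1
    have t1 := t.2.2
    rw [Real.norm_eq_abs, abs_le]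
    constructor <;> nlinarith

/-- Solving `x + f x = y` means finding the fixed point of the contraction `x ↦ y - f x`. -/
theorem bijective_add_of_lipschitz {E : Type*} [NormedAddCommGroup E] [CompleteSpace E] (f : E → E)
    (K : NNReal) (hK : K < 1) (hf : LipschitzWith K f) : Function.Bijective fun x => x + f x := by
  have hcon : ∀ y, ContractingWith K fun x => y - f x := fun y =>
    ⟨hK, LipschitzWith.of_dist_le_mul fun a b => by
      rw [dist_sub_left]; exact hf.dist_le_mul a b⟩
  refine ⟨fun a b hab => ?_, fun y => ?_⟩
  · have ha : Function.IsFixedPt (fun x => (a + f a) - f x) a := by simp [Function.IsFixedPt]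
    have hb : Function.IsFixedPt (fun x => (a + f a) - f x) b := by
      have : a + f a = b + f b := hab
      simp [Function.IsFixedPt, this]
    exact (hcon _).fixedPoint_unique' ha hb
  · have := (hcon y).fixedPoint_isFixedPt
    exact ⟨ContractingWith.fixedPoint _ (hcon y), (sub_eq_iff_eq_add.1 this).symm⟩

/-- Pushing a point `p z` of the disc at height `z` in the direction `c z`. -/
theorem push_isotopic (Φ : Plane ≃ₜ Plane) (p c : ℝ → Plane) (r : ℝ → ℝ) (hp : Continuous p)
    (hc : Continuous c) (hr : Continuous r) (hc1 : ∀ z, ‖c z‖ < 1)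
    (hdisc : ∀ z w, ‖w - p z‖ < r z → w ∈ disc) {ι : Type*} (w : ι → Plane) (z : ι → ℝ) :
    AmbientIsotopic (range fun i => planeLift (Φ (w i)) (z i))
      (range fun i => planeLift (Φ (w i + max 0 (r (z i) - ‖w i - p (z i)‖) • c (z i))) (z i)) := by
  -- At height `z` the push has the profile of a cone with tip at `p z`. Its displacement is
  -- Lipschitz with constant at most `‖c z‖ < 1` and vanishes off the disc, so every stage is a
  -- bijection of each horizontal plane.
  let ψ : ℝ → ℝ → Plane → Plane := fun t z v => v + (t * max 0 (r z - ‖v - p z‖)) • c z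
  have hψ : ∀ t z v, v ∉ disc → ψ t z v = v := by
    intro t z v hv
    have : r z - ‖v - p z‖ ≤ 0 := by
      by_contra! h
      exact hv (hdisc z v (by linarith))
    simp [ψ, max_eq_left this]
  have hψbij : ∀ t ∈ unitInterval, ∀ z, Function.Bijective (ψ t z) := by
    intro t ht z
    refine bijective_add_of_lipschitz _ ⟨‖c z‖, norm_nonneg _⟩ (hc1 z) ?_
    refine LipschitzWith.of_dist_le_mul fun a b => ?_
    rw [dist_eq_norm, ← sub_smul, norm_smul, ← mul_sub, norm_mul, mul_comm]
    refine mul_le_mul_of_nonneg_left ?_ (norm_nonneg _)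
    rw [Real.norm_eq_abs, abs_of_nonneg ht.1, Real.norm_eq_abs]
    have h1 : |max 0 (r z - ‖a - p z‖) - max 0 (r z - ‖b - p z‖)| ≤ dist a b := by
      refine (abs_max_sub_max_le_max _ _ _ _).trans ?_
      rw [sub_self, abs_zero]
      refine max_le dist_nonneg ?_
      rw [sub_sub_sub_cancel_left, abs_sub_comm]
      refine (abs_norm_sub_norm_le _ _).trans ?_
      rw [sub_sub_sub_cancel_right, dist_eq_norm]
    exact (mul_le_mul ht.2 h1 (abs_nonneg _) zero_le_one).trans (one_mul _).le
  have := lift_isotopic (fun q => (Φ (ψ q.1 q.2.2 (Φ.symm q.2.1)), q.2.2)) (by fun_prop) ?_ ?_ ?_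
    (fun i => (Φ (w i), z i))
  · simpa [ψ] using this
  · intro t
    constructor
    · rintro ⟨a, x⟩ ⟨b, y⟩ h
      simp only [Prod.mk.injEq] at h
      obtain ⟨h, rfl⟩ := h
      rw [Φ.symm.injective ((hψbij t t.2 x).1 (Φ.injective h))]
    · rintro ⟨a, x⟩
      obtain ⟨v, hv⟩ := (hψbij t t.2 x).2 (Φ.symm a)
      exact ⟨(Φ v, x), by simp [hv]⟩
  · rintro ⟨a, x⟩
    simp [ψ]
  · intro R
    obtain ⟨M, hM⟩ := ((ProperSpace.isCompact_closedBall (0 : Plane) 1).image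
      Φ.continuous).isBounded.exists_norm_le
    refine ⟨max R M, ?_⟩
    rintro t ⟨a, x⟩ h
    rw [Prod.norm_def, sup_le_iff] at h ⊢
    simp only at h ⊢
    refine ⟨?_, h.2.trans (le_max_left _ _)⟩
    by_cases ha : Φ.symm a ∈ disc
    · exact (hM a ⟨_, ha, by simp⟩).trans (le_max_right _ _)
    · rw [hψ _ _ _ ha, Φ.apply_symm_apply] at h
      exact h.1.trans (le_max_left _ _)

/-! ## The first Reidemeister move does not change the knot -/

/-- The way of a point of the diameter to the corresponding point of the curl, in eight steps. -/
def curlStep (i : ℕ) (z : ℝ) : Plane :=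
  !₂[z, 0] + ((i : ℝ) / 8 * (1 - z ^ 2)) • !₂[-2 * z, 1 / 2]

theorem norm_le_of_sq {w : Plane} {a : ℝ} (ha : 0 ≤ a) (h : w 0 ^ 2 + w 1 ^ 2 ≤ a ^ 2) : ‖w‖ ≤ a := by
  rw [EuclideanSpace.norm_eq, Fin.sum_univ_two, Real.norm_eq_abs, Real.norm_eq_abs, sq_abs, sq_abs]
  exact Real.sqrt_le_iff.2 ⟨ha, h⟩

/-- The intermediate points are convex combinations of the points on the diameter and on the curl,
so both ends suffice. The bound leaves room in the unit disc for a ball of radius `3/8 * (1 - z²)`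
around each of them, the support of the next push. -/
theorem norm_curlStep_le {i : ℕ} (hi : i ≤ 8) {z : ℝ} (hz : z ^ 2 ≤ 1) :
    ‖curlStep i z‖ ≤ 1 - 3 / 8 * (1 - z ^ 2) := by
  have hθ : (i : ℝ) / 8 ≤ 1 := by
    have : (i : ℝ) ≤ 8 := by exact_mod_cast hi
    linarith
  have hθ0 : 0 ≤ (i : ℝ) / 8 := by positivity
  have e : curlStep i z = (1 - (i : ℝ) / 8) • !₂[z, 0] + ((i : ℝ) / 8) • curlPos z := by
    refine plane_ext ?_ ?_ <;> simp [curlStep] <;> ring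
  have h0 : ‖(!₂[z, 0] : Plane)‖ ≤ 1 - 3 / 8 * (1 - z ^ 2) := by
    refine norm_le_of_sq (by nlinarith) ?_
    simp only [Matrix.cons_val_zero, Matrix.cons_val_one]
    nlinarith [sq_nonneg z, mul_nonneg (sub_nonneg.2 hz) (sub_nonneg.2 hz)]
  have h1 : ‖curlPos z‖ ≤ 1 - 3 / 8 * (1 - z ^ 2) := by
    refine norm_le_of_sq (by nlinarith) ?_
    simp only [curlPos_zero, curlPos_one]
    nlinarith [mul_nonneg (sub_nonneg.2 hz)
      (by positivity : 0 ≤ z ^ 2 / 4 + 4 * (z ^ 2) ^ 2), sq_nonneg (1 - z ^ 2)]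
  rw [e]
  refine (norm_add_le _ _).trans ?_
  rw [norm_smul, norm_smul, Real.norm_of_nonneg hθ0, Real.norm_of_nonneg (by linarith)]
  nlinarith

/-- When the height along the arc is its own parameter, each horizontal plane meets the lifted arc
in at most one point, which can be moved within the disc from the diameter to the curl; other
strands stay outside the disc. The way is too long for a single push with displacement of Lipschitz
constant below 1, so it is cut into eight. -/
theorem FlatAt.curl_isotopic {γ : Circle → Plane} {Φ : Plane ≃ₜ Plane} {e : ℝ → Circle}
    (F : FlatAt γ Φ e) (h : Circle → ℝ) (he : ∀ u ∈ Icc (-1 : ℝ) 1, h (e u) = u) :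
    AmbientIsotopic (range fun t => planeLift (γ t) (h t))
      (range fun t => planeLift (curlCurve γ Φ t) (h t)) := by
  classical
  let A : Set Circle := e '' Icc (-1) 1
  let w : ℕ → Circle → Plane := fun i t => if t ∈ A then curlStep i (h t) else Φ.symm (γ t)
  -- The total displacement at height `z` is `(1 - z²) • (-2z, 1/2)`. One step is an eighth of it,
  -- split as the cone height `3/8 * (1 - z²)` times the direction `(1/3) • (-2z, 1/2)`, whose norm
  -- is below `9/10` for `|z| ≤ 1`; `clamp` keeps this bound for all `z`.
  let c : ℝ → Plane := fun z => (1 / 3 : ℝ) • !₂[-2 * clamp z, 1 / 2]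
  let r : ℝ → ℝ := fun z => 3 / 8 * max 0 (1 - z ^ 2)
  have hcc := continuous_clamp
  have hdisc : ∀ i ≤ 8, ∀ z v, ‖v - curlStep i z‖ < r z → v ∈ disc := by
    intro i hi z v hv
    rcases le_or_gt (1 - z ^ 2) 0 with hz | hz
    · simp only [r, max_eq_left hz, mul_zero] at hv
      exact absurd hv (norm_nonneg _).not_gt
    · simp only [r, max_eq_right hz.le] at hv
      have h1 := norm_curlStep_le hi (z := z) (by linarith)
      have h2 := norm_le_norm_add_norm_sub' v (curlStep i z)
      rw [disc, mem_closedBall_zero_iff]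
      linarith
  have hstep : ∀ i ≤ 8, ∀ t, w i t + max 0 (r (h t) - ‖w i t - curlStep i (h t)‖) • c (h t) =
      w (i + 1) t := by
    intro i hi t
    by_cases ht : t ∈ A
    · obtain ⟨u, hu, rfl⟩ := ht
      have hu2 : 0 ≤ 1 - u ^ 2 := by nlinarith [hu.1, hu.2]
      have hA : e u ∈ A := ⟨u, hu, rfl⟩
      simp only [w, if_pos hA, he u hu, sub_self, norm_zero, sub_zero, r, c, clamp_of_mem hu,
        max_eq_right hu2, max_eq_right (by positivity : 0 ≤ 3 / 8 * (1 - u ^ 2))]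
      refine plane_ext ?_ ?_ <;> simp [curlStep] <;> ring
    · simp only [w, if_neg ht]
      have : r (h t) - ‖Φ.symm (γ t) - curlStep i (h t)‖ ≤ 0 := by
        by_contra! hlt
        exact ht (F.mem_of t (hdisc i hi _ _ (by linarith)))
      simp [max_eq_left this]
  have hiso : ∀ i ≤ 8, AmbientIsotopic (range fun t => planeLift (Φ (w 0 t)) (h t))
      (range fun t => planeLift (Φ (w i t)) (h t)) := by
    intro i
    induction i with
    | zero => exact fun _ => ⟨_, IsIsotopicToId.refl _, by simp⟩
    | succ i ih =>
      intro hi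
      refine (ih (by omega)).trans ?_
      have := push_isotopic Φ (curlStep i) c r (by unfold curlStep; fun_prop) (by fun_prop)
        (by fun_prop) ?_ (hdisc i (by omega)) (w i) h
      · simpa only [hstep i (by omega)] using this
      · intro z
        have := abs_le.1 (abs_clamp_le z)
        refine lt_of_le_of_lt (norm_le_of_sq (a := 9 / 10) (by norm_num) ?_) (by norm_num)
        simp [c]
        nlinarith
  have := hiso 8 le_rfl
  convert! this using 4 with t t
  · by_cases ht : t ∈ A
    · obtain ⟨u, hu, rfl⟩ := ht
      have hA : e u ∈ A := ⟨u, hu, rfl⟩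
      simp only [w, if_pos hA, he u hu, F.apply_eq u hu]
      simp [curlStep]
    · simp [w, if_neg ht]
  · by_cases ht : t ∈ A
    · obtain ⟨u, hu, rfl⟩ := ht
      have hA : e u ∈ A := ⟨u, hu, rfl⟩
      simp only [w, if_pos hA, he u hu, F.curl_apply hu]
      congr 1
      refine plane_ext ?_ ?_ <;> simp [curlStep] <;> ring
    · simp only [w, if_neg ht, Homeomorph.apply_symm_apply]
      exact F.curl_of_notMem ht

/-- A vertical isotopy first makes the height equal to the parameter on the flat arc. It adds the
same amount at both branches of every old crossing, so the crossings persist; at the new one the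
heights are `±σ₀`, in agreement with the choice of the upper branch. Then `curl_isotopic` applies.
-/
theorem represents_curlDiagram {D : Diagram Plane} {Φ : Plane ≃ₜ Plane} {e : ℝ → Circle}
    (F : FlatAt D.curve Φ e) {K : Set Sphere3} (hD : D.Represents planeLift K) :
    (curlDiagram D Φ e F).Represents planeLift K := by
  obtain ⟨h, hc, hcross, hK⟩ := hD
  have hec : Continuous fun x => e (clamp x) :=
    F.cont.comp_continuous continuous_clamp clamp_mem
  -- The correction has to be a function on the whole plane: it reads off the horizontal coordinate
  -- in the chart, and `clamp` extends it beyond the arc.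
  let f : Plane → ℝ := fun w => clamp (Φ.symm w 0) - h (e (clamp (Φ.symm w 0)))
  have hf : Continuous f := by
    have h1 : Continuous fun w : Plane => Φ.symm w 0 := by fun_prop
    exact (continuous_clamp.comp h1).sub ((hc.comp hec).comp h1)
  have h1e : ∀ u ∈ Icc (-1 : ℝ) 1, h (e u) + f (D.curve (e u)) = u := by
    intro u hu
    simp only [f, F.symm_apply hu, Matrix.cons_val_zero, clamp_of_mem hu]
    ring
  refine ⟨fun t => h t + f (D.curve t), hc.add (hf.comp D.continuous_curve), ?_, ?_⟩
  · intro s t hst heq hs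
    beta_reduce
    rcases (F.curl_eq_curl_iff hst).1 heq with h' | ⟨u, hu, hu2, rfl, rfl⟩
    · rw [h']
      have : s ≠ e σ₀ := fun hse => by
        subst hse
        exact hst (F.eq_of_apply_eq σ₀_mem h'.symm).symm
      have := hcross s t hst h' (hs.resolve_left this)
      linarith
    · have hn : -u ∈ Icc (-1 : ℝ) 1 := ⟨by linarith [hu.2], by linarith [hu.1]⟩
      rw [h1e u hu, h1e (-u) hn]
      rcases hs with hs | hs
      · have := F.inj hu σ₀_mem hs
        rw [this]
        linarith [σ₀_pos]
      · exact absurd hs (F.notMem_upper hu)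
  · exact ((F.curl_isotopic _ h1e).symm.trans (vertical_isotopic f hf D.curve h).symm).trans hK

/-! ## Nested curls in four parts of a flat arc -/

/-- The affine homeomorphism of the plane which takes the unit disc to the disc of radius `1/8` around
`(x, 0)`. -/
def subChart (x : ℝ) : Plane ≃ₜ Plane where
  toFun w := !₂[x + w 0 / 8, w 1 / 8]
  invFun w := !₂[8 * (w 0 - x), 8 * w 1]
  left_inv w := by
    refine plane_ext ?_ ?_ <;> simp <;> ring
  right_inv w := by
    refine plane_ext ?_ ?_ <;> simp
  continuous_toFun := by fun_prop
  continuous_invFun := by fun_prop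

/-- The midpoints of the four parts. -/
def mid (i : Fin 4) : ℝ := (2 * (i : ℝ) - 3) / 4

theorem mid_bounds (i : Fin 4) : -3 / 4 ≤ mid i ∧ mid i ≤ 3 / 4 := by
  have : (i : ℝ) ≤ 3 := by exact_mod_cast Nat.lt_succ_iff.1 i.2
  have h0 : (0 : ℝ) ≤ i := by positivity
  simp only [mid]
  constructor <;> linarith

theorem mid_sep {i j : Fin 4} (h : i < j) : mid i + 1 / 2 ≤ mid j := by
  have : (i : ℝ) + 1 ≤ j := by exact_mod_cast h
  simp only [mid]
  linarith

theorem mid_dist {i j : Fin 4} (h : i ≠ j) : 1 / 2 ≤ |mid i - mid j| := by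
  rcases lt_or_gt_of_ne h with h | h
  · have := mid_sep h
    rw [abs_sub_comm, abs_of_pos] <;> linarith
  · have := mid_sep h
    rw [abs_of_pos] <;> linarith

theorem mid_add_mem (i : Fin 4) {u : ℝ} (hu : u ∈ Icc (-1 : ℝ) 1) :
    mid i + u / 8 ∈ Icc (-1 : ℝ) 1 := by
  have := mid_bounds i
  exact ⟨by linarith [hu.1], by linarith [hu.2]⟩

/-- The chart in the innermost loop of `m` nested curls in the `i`-th part. -/
def nestChart (Φ : Plane ≃ₜ Plane) (i : Fin 4) : ℕ → (Plane ≃ₜ Plane)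
  | 0 => (subChart (mid i)).trans Φ
  | m + 1 => loopChart.trans (nestChart Φ i m)

/-- The arc of the circle which belongs to `nestChart`. -/
def nestArc (E : ℝ → Circle) (i : Fin 4) (m : ℕ) (v : ℝ) : Circle := E (mid i + v / 4 ^ m / 8)

theorem nestChart_symm_mem {Φ : Plane ≃ₜ Plane} {i : Fin 4} {m : ℕ} {x : Plane}
    (h : (nestChart Φ i m).symm x ∈ disc) : |Φ.symm x 0 - mid i| ≤ 1 / 8 := by
  induction m with
  | zero =>
    have := (disc_bounds h).1
    have e : (nestChart Φ i 0).symm x 0 = 8 * (Φ.symm x 0 - mid i) := rfl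
    rw [e, abs_mul, abs_of_pos (by norm_num : (0 : ℝ) < 8)] at this
    linarith
  | succ m ih =>
    refine ih ?_
    have : loopChart.symm ((nestChart Φ i m).symm x) ∈ disc := h
    simpa using loopChart_mem_disc this

theorem nestChart_disjoint {Φ : Plane ≃ₜ Plane} {i j : Fin 4} (hij : i ≠ j) {m n : ℕ} (x : Plane)
    (h : (nestChart Φ i m).symm x ∈ disc) (h' : (nestChart Φ j n).symm x ∈ disc) : False := by
  have h1 := abs_le.1 (nestChart_symm_mem h)
  have h2 := abs_le.1 (nestChart_symm_mem h')
  have h3 := mid_dist hij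
  rcases le_abs.1 h3 with h3 | h3 <;> linarith

/-- The strand in the disc with `m` nested curls. -/
def nestPos (Φ : Plane ≃ₜ Plane) (i : Fin 4) : ℕ → ℝ → Plane
  | 0, u => nestChart Φ i 0 !₂[u, 0]
  | m + 1, u => open Classical in
      if |u| ≤ 1 / 4 ^ m then nestChart Φ i m (curlPos (4 ^ m * u)) else nestPos Φ i m u

section Family

variable (γ : Circle → Plane) (Φ : Plane ≃ₜ Plane) (E : ℝ → Circle)

/-- The curve with `H i` nested curls in the `i`-th part of the flat arc. -/
def nestCurve (H : Fin 4 → ℕ) (t : Circle) : Plane :=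
  open Classical in
  if h : ∃ i, ((nestChart Φ i 0).symm (γ t)) ∈ disc then
    nestPos Φ h.choose (H h.choose) ((nestChart Φ h.choose 0).symm (γ t) 0) else γ t

/-- The parameters of the crossings of the nested curls. -/
def nestPoint (p : (_ : Fin 4) × (ℕ × Bool)) : Circle :=
  nestArc E p.1 p.2.1 (if p.2.2 then σ₀ else -σ₀)

variable {γ Φ E}

theorem FlatAt.sub (F : FlatAt γ Φ E) (i : Fin 4) : FlatAt γ (nestChart Φ i 0) (nestArc E i 0) where
  cont := by
    refine F.cont.comp (by fun_prop) fun u hu => ?_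
    simpa using mid_add_mem i hu
  inj u hu v hv h := by
    simp only [nestArc, pow_zero, div_one] at h
    have := F.inj (mid_add_mem i hu) (mid_add_mem i hv) h
    linarith
  apply_eq u hu := by
    simp only [nestArc, pow_zero, div_one]
    rw [F.apply_eq _ (mid_add_mem i hu)]
    refine congrArg Φ ?_
    refine plane_ext ?_ ?_ <;> simp [subChart]
  mem_of t ht := by
    have h1 := nestChart_symm_mem ht
    have hw : (subChart (mid i)).symm (Φ.symm (γ t)) ∈ disc := ht
    have h2 : Φ.symm (γ t) ∈ disc := by
      rw [mem_disc_iff] at hw ⊢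
      have e0 : (subChart (mid i)).symm (Φ.symm (γ t)) 0 = 8 * (Φ.symm (γ t) 0 - mid i) := rfl
      have e1 : (subChart (mid i)).symm (Φ.symm (γ t)) 1 = 8 * Φ.symm (γ t) 1 := rfl
      rw [e0, e1] at hw
      have := mid_bounds i
      rw [abs_le] at h1
      have h3 : (Φ.symm (γ t) 0) ^ 2 ≤ (7 / 8) ^ 2 := sq_le_sq' (by linarith) (by linarith)
      nlinarith [sq_nonneg (Φ.symm (γ t) 0 - mid i)]
    obtain ⟨u, hu, rfl⟩ := F.mem_of t h2
    rw [F.symm_apply hu] at h1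
    simp only [Matrix.cons_val_zero] at h1
    rw [abs_le] at h1
    refine ⟨8 * (u - mid i), ⟨by linarith, by linarith⟩, ?_⟩
    simp [nestArc]

theorem nestCurve_apply (F : FlatAt γ Φ E) (H : Fin 4 → ℕ) (i : Fin 4) {u : ℝ}
    (hu : u ∈ Icc (-1 : ℝ) 1) :
    nestCurve γ Φ H (nestArc E i 0 u) = nestPos Φ i (H i) u := by
  have h : ∃ j, ((nestChart Φ j 0).symm (γ (nestArc E i 0 u))) ∈ disc :=
    ⟨i, (F.sub i).symm_apply_mem hu⟩
  have hi : h.choose = i := by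
    by_contra hne
    exact nestChart_disjoint hne _ h.choose_spec ((F.sub i).symm_apply_mem hu)
  rw [nestCurve, dif_pos h, hi, (F.sub i).symm_apply hu]
  rfl

theorem nestCurve_of_notMem (F : FlatAt γ Φ E) (H : Fin 4 → ℕ) {t : Circle}
    (ht : ∀ i, t ∉ nestArc E i 0 '' Icc (-1) 1) : nestCurve γ Φ H t = γ t := by
  rw [nestCurve, dif_neg]
  rintro ⟨i, hi⟩
  exact ht i ((F.sub i).mem_of t hi)

theorem nestCurve_zero (F : FlatAt γ Φ E) : nestCurve γ Φ 0 = γ := by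
  funext t
  by_cases h : ∃ i, t ∈ nestArc E i 0 '' Icc (-1) 1
  · obtain ⟨i, u, hu, rfl⟩ := h
    rw [nestCurve_apply F _ _ hu, (F.sub i).apply_eq u hu]
    rfl
  · push Not at h
    exact nestCurve_of_notMem F _ h

theorem four_pow_pos (m : ℕ) : (0 : ℝ) < 4 ^ m := by positivity

theorem one_le_four_pow (m : ℕ) : (1 : ℝ) ≤ 4 ^ m := one_le_pow₀ (by norm_num)

theorem nestArc_eq (i : Fin 4) (m : ℕ) (v : ℝ) : nestArc E i m v = nestArc E i 0 (v / 4 ^ m) := by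
  simp [nestArc]

theorem div_pow_mem (m : ℕ) {v : ℝ} (hv : v ∈ Icc (-1 : ℝ) 1) : v / 4 ^ m ∈ Icc (-1 : ℝ) 1 := by
  have h1 := one_le_four_pow m
  have := four_pow_pos m
  refine ⟨?_, ?_⟩
  · rw [le_div_iff₀ this]; nlinarith [hv.1]
  · rw [div_le_iff₀ this]; nlinarith [hv.2]

/-- Curling in the innermost loop changes only the parameters within `1 / 4 ^ H i` of the centre of
the `i`-th piece, which is precisely the case distinction in `nestPos`. -/
theorem nestCurve_update (F : FlatAt γ Φ E) (H : Fin 4 → ℕ) (i : Fin 4)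
    (Fi : FlatAt (nestCurve γ Φ H) (nestChart Φ i (H i)) (nestArc E i (H i))) :
    curlCurve (nestCurve γ Φ H) (nestChart Φ i (H i)) =
      nestCurve γ Φ (Function.update H i (H i + 1)) := by
  funext t
  by_cases ht : t ∈ nestArc E i (H i) '' Icc (-1) 1
  · obtain ⟨v, hv, rfl⟩ := ht
    rw [Fi.curl_apply hv, nestArc_eq, nestCurve_apply F _ i (div_pow_mem _ hv),
      Function.update_self, nestPos, if_pos, mul_div_cancel₀ _ (four_pow_pos _).ne']
    rw [abs_div, abs_of_pos (four_pow_pos _)]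
    exact div_le_div_of_nonneg_right (abs_le.2 hv) (four_pow_pos _).le
  · rw [Fi.curl_of_notMem ht]
    by_cases h : ∃ j, t ∈ nestArc E j 0 '' Icc (-1) 1
    · obtain ⟨j, u, hu, rfl⟩ := h
      rw [nestCurve_apply F _ j hu, nestCurve_apply F _ j hu]
      by_cases hj : j = i
      · subst hj
        rw [Function.update_self, nestPos, if_neg]
        intro hle
        refine ht ⟨4 ^ H j * u, ?_, ?_⟩
        · rw [mem_Icc, ← abs_le, abs_mul, abs_of_pos (four_pow_pos _)]
          rwa [le_div_iff₀ (four_pow_pos _), mul_comm] at hle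
        · rw [nestArc_eq, mul_div_cancel_left₀ _ (four_pow_pos _).ne']
      · rw [Function.update_of_ne hj]
    · push Not at h
      rw [nestCurve_of_notMem F _ h, nestCurve_of_notMem F _ h]

/-- `D'` is the diagram with `H i` nested curls in the `i`-th part of the flat arc of `D`. -/
structure IsNest (D : Diagram Plane) (Φ : Plane ≃ₜ Plane) (E : ℝ → Circle) (H : Fin 4 → ℕ)
    (D' : Diagram Plane) : Prop where
  curve_eq : D'.curve = nestCurve D.curve Φ H
  upper_eq : D'.upper = D.upper ∪ {t | ∃ i j, j < H i ∧ t = nestPoint E ⟨i, j, true⟩}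
  flat : ∀ i, FlatAt D'.curve (nestChart Φ i (H i)) (nestArc E i (H i))
  coincide : ∀ s t, s ≠ t → (D'.curve s = D'.curve t ↔ D.curve s = D.curve t ∨
    ∃ i j ε, j < H i ∧ s = nestPoint E ⟨i, j, ε⟩ ∧ t = nestPoint E ⟨i, j, !ε⟩)

/-- The diagram depends on the numbers of curls and not on the order in which they were added.
Consequently the corners of the cube are well defined, and each edge of the cube is an actual move.
-/
theorem IsNest.eq {D D₁ D₂ : Diagram Plane} {H : Fin 4 → ℕ} (h₁ : IsNest D Φ E H D₁)
    (h₂ : IsNest D Φ E H D₂) : D₁ = D₂ := by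
  have hc := h₁.curve_eq.trans h₂.curve_eq.symm
  have hu := h₁.upper_eq.trans h₂.upper_eq.symm
  cases D₁
  cases D₂
  simp only at hc hu
  subst hc
  subst hu
  rfl

theorem isNest_zero {D : Diagram Plane} (F : FlatAt D.curve Φ E) : IsNest D Φ E 0 D where
  curve_eq := (nestCurve_zero F).symm
  upper_eq := by simp
  flat i := F.sub i
  coincide s t _ := by simp

/-- In the `i`-th piece the new flat chart lies in the loop just created (`curl_loop`); in the other
pieces the old charts survive because they are disjoint from the disc of the move. -/
theorem IsNest.succ {D D' : Diagram Plane} (F : FlatAt D.curve Φ E) {H : Fin 4 → ℕ}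
    (h : IsNest D Φ E H D') (i : Fin 4) :
    IsNest D Φ E (Function.update H i (H i + 1))
      (curlDiagram D' (nestChart Φ i (H i)) (nestArc E i (H i)) (h.flat i)) where
  curve_eq := by
    have hF := h.flat i
    simp only [curlDiagram]
    rw [h.curve_eq] at hF ⊢
    exact nestCurve_update F H i hF
  upper_eq := by
    simp only [curlDiagram, h.upper_eq]
    ext t
    simp only [mem_insert_iff, mem_union, mem_ofPred_eq]
    constructor
    · rintro (rfl | ht | ⟨k, j, hj, rfl⟩)
      · exact Or.inr ⟨i, H i, by simp, by simp [nestPoint]⟩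
      · exact Or.inl ht
      · refine Or.inr ⟨k, j, ?_, rfl⟩
        rcases eq_or_ne k i with rfl | hk
        · simp; omega
        · rwa [Function.update_of_ne hk]
    · rintro (ht | ⟨k, j, hj, rfl⟩)
      · exact Or.inr (Or.inl ht)
      · rcases eq_or_ne k i with rfl | hk
        · rw [Function.update_self] at hj
          rcases Nat.lt_succ_iff_lt_or_eq.1 hj with hj | rfl
          · exact Or.inr (Or.inr ⟨k, j, hj, rfl⟩)
          · left; simp [nestPoint]
        · rw [Function.update_of_ne hk] at hj
          exact Or.inr (Or.inr ⟨k, j, hj, rfl⟩)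
  flat k := by
    rcases eq_or_ne k i with rfl | hk
    · have := (h.flat k).curl_loop
      rw [Function.update_self]
      have e : (fun u => nestArc E k (H k) (u / 4)) = nestArc E k (H k + 1) := by
        funext u
        rw [nestArc_eq, nestArc_eq _ (H k + 1), pow_succ', div_div]
      rwa [e] at this
    · rw [Function.update_of_ne hk]
      exact (h.flat i).curl_of_disjoint (h.flat k) fun x h1 h2 => nestChart_disjoint hk x h2 h1
  coincide s t hst := by
    refine ((h.flat i).curl_eq_curl_iff hst).trans ?_
    rw [h.coincide s t hst, or_assoc]
    refine or_congr_right ?_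
    constructor
    · rintro (⟨k, j, ε, hj, rfl, rfl⟩ | ⟨u, hu, hu2, rfl, rfl⟩)
      · refine ⟨k, j, ε, ?_, rfl, rfl⟩
        rcases eq_or_ne k i with rfl | hk
        · simp; omega
        · rwa [Function.update_of_ne hk]
      · rcases sq_eq_half_iff.1 hu2 with rfl | rfl
        · exact ⟨i, H i, true, by simp, by simp [nestPoint], by simp [nestPoint]⟩
        · exact ⟨i, H i, false, by simp, by simp [nestPoint], by simp [nestPoint]⟩
    · rintro ⟨k, j, ε, hj, rfl, rfl⟩
      rcases eq_or_ne k i with rfl | hk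
      · rw [Function.update_self] at hj
        rcases Nat.lt_succ_iff_lt_or_eq.1 hj with hj | rfl
        · exact Or.inl ⟨k, j, ε, hj, rfl, rfl⟩
        · right
          cases ε
          · exact ⟨-σ₀, neg_σ₀_mem, by rw [neg_sq, σ₀_sq], by simp [nestPoint], by simp [nestPoint]⟩
          · exact ⟨σ₀, σ₀_mem, σ₀_sq, by simp [nestPoint], by simp [nestPoint]⟩
      · rw [Function.update_of_ne hk] at hj
        exact Or.inl ⟨k, j, ε, hj, rfl, rfl⟩

/-- Diagrams with any numbers of nested curls exist, and represent the same knot. -/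
theorem exists_isNest {D : Diagram Plane} (F : FlatAt D.curve Φ E) {K : Set Sphere3}
    (hD : D.Represents planeLift K) (H : Fin 4 → ℕ) :
    ∃ D', IsNest D Φ E H D' ∧ D'.Represents planeLift K := by
  obtain ⟨n, hn⟩ : ∃ n, n = ∑ i, H i := ⟨_, rfl⟩
  induction n generalizing H with
  | zero =>
    have : H = 0 := by
      funext i
      exact (Finset.sum_eq_zero_iff.1 hn.symm) i (Finset.mem_univ i)
    exact ⟨D, this ▸ isNest_zero F, hD⟩
  | succ n ih =>
    obtain ⟨i, hi⟩ : ∃ i, H i ≠ 0 := by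
      by_contra! h
      simp [h] at hn
    obtain ⟨D', hD', hK⟩ := ih (Function.update H i (H i - 1)) (by
      rw [Finset.sum_update_of_mem (Finset.mem_univ i)]
      rw [← Finset.add_sum_erase _ _ (Finset.mem_univ i), ← Finset.sdiff_singleton_eq_erase] at hn
      omega)
    have := hD'.succ F i
    have e : Function.update (Function.update H i (H i - 1)) i
        (Function.update H i (H i - 1) i + 1) = H := by
      rw [Function.update_self, Function.update_idem, Nat.sub_add_cancel (Nat.pos_of_ne_zero hi),
        Function.update_eq_self]
    rw [e] at this
    exact ⟨_, this, represents_curlDiagram _ hK⟩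

/-- Adding one curl is a Reidemeister move. -/
theorem IsNest.isMove {D D₁ D₂ : Diagram Plane} (F : FlatAt D.curve Φ E) {H : Fin 4 → ℕ} {i : Fin 4}
    (h₁ : IsNest D Φ E H D₁) (h₂ : IsNest D Φ E (Function.update H i (H i + 1)) D₂) :
    IsMove D₁ D₂ := by
  rw [h₂.eq (h₁.succ F i)]
  exact isMove_curlDiagram _ _ _ _

end Family

/-! ## An isotopy invariant of diagrams -/

section Invariant

variable {X Y : Type*}

/-- The parameters of the double points of a closed curve. -/
def doubles (γ : Circle → X) : Set Circle := {t | ∃ s, s ≠ t ∧ γ s = γ t}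

/-- The parameters of the double points which are joined to the other parameter of the same point by
an arc of the circle with at most `m` parameters of double points. -/
def shortSet (γ : Circle → X) (m : ℕ) : Set Circle :=
  {s | ∃ s', s ≠ s' ∧ γ s = γ s' ∧ ∃ C, IsPreconnected C ∧ s ∈ C ∧ s' ∈ C ∧
    (C ∩ doubles γ).ncard ≤ m}

theorem shortSet_subset_doubles (γ : Circle → X) (m : ℕ) : shortSet γ m ⊆ doubles γ := by
  rintro s ⟨s', hne, h, -⟩
  exact ⟨s', hne.symm, h.symm⟩

theorem doubles_comp {f : X → Y} (hf : Function.Injective f) (γ : Circle → X) :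
    doubles (fun t => f (γ t)) = doubles γ := by
  simp only [doubles, hf.eq_iff]

/-- Only coincidences of parameters are used, so passing to another surface by an injective map
changes nothing. This transfers the distinction of the diagrams to the sphere. -/
theorem shortSet_comp {f : X → Y} (hf : Function.Injective f) (γ : Circle → X) (m : ℕ) :
    shortSet (fun t => f (γ t)) m = shortSet γ m := by
  simp only [shortSet, hf.eq_iff, doubles_comp hf]

theorem image_shortSet_subset {γ γ' : Circle → X} (ρ : Circle ≃ₜ Circle)
    (h : ∀ s t, γ s = γ t ↔ γ' (ρ s) = γ' (ρ t)) (m : ℕ) :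
    ρ '' shortSet γ m ⊆ shortSet γ' m := by
  have hd : doubles γ' = ρ '' doubles γ := by
    ext t
    constructor
    · rintro ⟨s, hs, hst⟩
      refine ⟨ρ.symm t, ⟨ρ.symm s, by simpa using hs, ?_⟩, by simp⟩
      rw [h]; simpa using hst
    · rintro ⟨t, ⟨s, hs, hst⟩, rfl⟩
      exact ⟨ρ s, by simpa using hs, (h s t).1 hst⟩
  rintro _ ⟨s, ⟨s', hne, hs, C, hC, hsC, hsC', hn⟩, rfl⟩
  refine ⟨ρ s', by simpa using hne, (h s s').1 hs, ρ '' C, hC.image _ ρ.continuous.continuousOn,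
    mem_image_of_mem _ hsC, mem_image_of_mem _ hsC', ?_⟩
  rwa [hd, ← image_inter ρ.injective, ncard_image_of_injective _ ρ.injective]

/-- The reparametrization of the circle maps double parameters to double parameters and connected
sets to connected sets. One inequality suffices, by symmetry. -/
theorem Diagram.Carries.ncard_shortSet {S : Type*} [TopologicalSpace S] {h : S ≃ₜ S}
    {D D' : Diagram S} (c : Diagram.Carries h D D') (m : ℕ) :
    (shortSet D.curve m).ncard = (shortSet D'.curve m).ncard := by
  have key : ∀ {h : S ≃ₜ S} {D D' : Diagram S}, Diagram.Carries h D D' →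
      (shortSet D.curve m).ncard ≤ (shortSet D'.curve m).ncard := by
    rintro h D D' ⟨ρ, hρ⟩
    rw [← ncard_image_of_injective _ ρ.injective]
    refine ncard_le_ncard (image_shortSet_subset ρ (fun s t => ?_) m)
      (D'.finite_double.subset (shortSet_subset_doubles _ _))
    rw [← (hρ s).1, ← (hρ t).1, h.injective.eq_iff]
  exact le_antisymm (key c) (key c.symm)

end Invariant

/-! ## Arcs of the circle -/

/-- The circle cut open at `exp θ` is an interval. Were `exp z` missing too, the open arcs on both
sides of it would separate the connected set `C`. -/
theorem exp_mem_of_isPreconnected {C : Set Circle} (hC : IsPreconnected C) {θ x y z : ℝ}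
    (hθ : Circle.exp θ ∉ C) (hx : θ < x) (hy : y < θ + 2 * Real.pi) (hxC : Circle.exp x ∈ C)
    (hyC : Circle.exp y ∈ C) (hz : z ∈ Icc x y) : Circle.exp z ∈ C := by
  by_contra hzC
  have hxz : x < z := lt_of_le_of_ne hz.1 fun h => hzC (h ▸ hxC)
  have hzy : z < y := lt_of_le_of_ne hz.2 fun h => hzC (h ▸ hyC)
  have hinj := Circle.exp_injOn_Ico (a := θ) (b := θ + 2 * Real.pi) (by linarith)
  have hopen := isLocalHomeomorph_circleExp.isOpenMap
  have hcov : C ⊆ Circle.exp '' Ioo θ z ∪ Circle.exp '' Ioo z (θ + 2 * Real.pi) := by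
    intro t ht
    obtain ⟨w, hw, rfl⟩ : ∃ w ∈ Ico θ (θ + 2 * Real.pi), Circle.exp w = t := by
      obtain ⟨w, rfl⟩ := Circle.exp_surjective t
      obtain ⟨w', hw', he⟩ := Circle.periodic_exp.exists_mem_Ico (by positivity) w θ
      exact ⟨w', hw', he.symm⟩
    rcases lt_trichotomy w z with h | rfl | h
    · left
      refine ⟨w, ⟨lt_of_le_of_ne hw.1 ?_, h⟩, rfl⟩
      rintro rfl
      exact hθ ht
    · exact absurd ht hzC
    · exact Or.inr ⟨w, ⟨h, hw.2⟩, rfl⟩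
  obtain ⟨t, -, ⟨u, hu, hut⟩, ⟨v, hv, hvt⟩⟩ := hC _ _ (hopen _ isOpen_Ioo) (hopen _ isOpen_Ioo)
    hcov ⟨_, hxC, x, ⟨hx, hxz⟩, rfl⟩ ⟨_, hyC, y, ⟨hzy, hy⟩, rfl⟩
  have := hinj (⟨hu.1.le, by linarith [hu.2]⟩ : u ∈ Ico θ (θ + 2 * Real.pi))
    (⟨by linarith [hv.1], hv.2⟩ : v ∈ Ico θ (θ + 2 * Real.pi)) (hut.trans hvt.symm)
  linarith [hu.2, hv.1]

/-! ## The invariant of nested curls -/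

/-- The position of a crossing parameter of the nested curls in the flat arc. -/
def nestPos₀ (p : (_ : Fin 4) × (ℕ × Bool)) : ℝ :=
  mid p.1 + (if p.2.2 then σ₀ else -σ₀) / 4 ^ p.2.1 / 8

/-- The distance from the midpoint of a piece to the two parameters of the curl at depth `j`. It
decreases with `j`: the parameters of inner curls lie between those of outer ones. -/
def nestRad (j : ℕ) : ℝ := σ₀ / 4 ^ j / 8

theorem nestRad_pos (j : ℕ) : 0 < nestRad j := by
  have := σ₀_pos
  unfold nestRad
  positivity

theorem nestRad_lt (j : ℕ) : nestRad j < 1 / 8 := by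
  have := one_le_four_pow j
  have h : σ₀ / 4 ^ j < 1 := by
    rw [div_lt_one (four_pow_pos j)]
    linarith [σ₀_lt_one]
  unfold nestRad
  linarith

theorem nestRad_strictAnti : StrictAnti nestRad := by
  refine strictAnti_nat_of_succ_lt fun j => ?_
  have := nestRad_pos j
  have e : nestRad (j + 1) = nestRad j / 4 := by
    unfold nestRad
    rw [pow_succ]
    field_simp
  rw [e]
  linarith

theorem nestPos₀_eq (i : Fin 4) (j : ℕ) (ε : Bool) :
    nestPos₀ ⟨i, j, ε⟩ = if ε then mid i + nestRad j else mid i - nestRad j := by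
  unfold nestPos₀ nestRad
  cases ε
  · simp; ring
  · simp

theorem abs_nestPos₀_sub (p : (_ : Fin 4) × (ℕ × Bool)) :
    |nestPos₀ p - mid p.1| = nestRad p.2.1 := by
  obtain ⟨i, j, ε⟩ := p
  rw [nestPos₀_eq]
  have := nestRad_pos j
  cases ε <;> simp [abs_of_pos this]

theorem nestPos₀_mem (p : (_ : Fin 4) × (ℕ × Bool)) : nestPos₀ p ∈ Icc (-1 : ℝ) 1 := by
  have h1 := abs_le.1 (abs_nestPos₀_sub p).le
  have h2 := nestRad_lt p.2.1
  have h3 := mid_bounds p.1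
  exact ⟨by linarith, by linarith⟩

theorem eq_of_near_mid {i j : Fin 4} {x : ℝ} (hi : |x - mid i| < 1 / 8) (hj : |x - mid j| < 1 / 8) :
    i = j := by
  by_contra h
  rw [abs_lt] at hi hj
  rcases le_abs.1 (mid_dist h) with h | h <;> linarith

theorem nestPos₀_injective : Function.Injective nestPos₀ := by
  intro p q h
  have hp := abs_nestPos₀_sub p
  have hq := abs_nestPos₀_sub q
  have hpq : p.1 = q.1 := eq_of_near_mid (x := nestPos₀ p) (by rw [hp]; exact nestRad_lt _)
    (by rw [h, hq]; exact nestRad_lt _)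
  obtain ⟨i, j, ε⟩ := p
  obtain ⟨i', j', ε'⟩ := q
  simp only at hpq
  subst hpq
  have hj : j = j' := nestRad_strictAnti.injective (by rw [← hp, ← hq, h])
  subst hj
  rw [nestPos₀_eq, nestPos₀_eq] at h
  have := nestRad_pos j
  cases ε <;> cases ε' <;> simp at h ⊢ <;> linarith

/-- The indices of the parameters on the `k` innermost curls in each part. -/
def nestIndex (H : Fin 4 → ℕ) (k : ℕ) : Finset ((_ : Fin 4) × (ℕ × Bool)) :=
  Finset.univ.sigma fun i => Finset.Ico (H i - k) (H i) ×ˢ Finset.univ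

theorem mem_nestIndex {H : Fin 4 → ℕ} {k : ℕ} {p : (_ : Fin 4) × (ℕ × Bool)} :
    p ∈ nestIndex H k ↔ p.2.1 < H p.1 ∧ H p.1 ≤ p.2.1 + k := by
  simp [nestIndex]
  omega

theorem card_nestIndex (H : Fin 4 → ℕ) (k : ℕ) :
    (nestIndex H k).card = 2 * ∑ i, min (H i) k := by
  rw [nestIndex, Finset.card_sigma, Finset.mul_sum]
  refine Finset.sum_congr rfl fun i _ => ?_
  rw [Finset.card_product, Nat.card_Ico, Finset.card_univ, Fintype.card_bool]
  omega

section Count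

variable {D D' : Diagram Plane} {Φ : Plane ≃ₜ Plane} {E : ℝ → Circle} {H : Fin 4 → ℕ}

theorem nestPoint_eq (p : (_ : Fin 4) × (ℕ × Bool)) : nestPoint E p = E (nestPos₀ p) := rfl

theorem nestPoint_injective (F : FlatAt D.curve Φ E) : Function.Injective (nestPoint E) :=
  fun p q h => nestPos₀_injective (F.inj (nestPos₀_mem p) (nestPos₀_mem q) h)

theorem FlatAt.notMem_doubles (F : FlatAt D.curve Φ E) {u : ℝ} (hu : u ∈ Icc (-1 : ℝ) 1) :
    E u ∉ doubles D.curve := by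
  rintro ⟨s, hs, h⟩
  exact hs (F.eq_of_apply_eq hu h)

theorem nestPoint_ne (F : FlatAt D.curve Φ E) (i : Fin 4) (j : ℕ) (ε : Bool) :
    nestPoint E ⟨i, j, ε⟩ ≠ nestPoint E ⟨i, j, !ε⟩ := by
  intro h
  have := nestPoint_injective F h
  simp at this

theorem IsNest.doubles_eq (F : FlatAt D.curve Φ E) (h : IsNest D Φ E H D') :
    doubles D'.curve = doubles D.curve ∪ nestPoint E '' {p | p.2.1 < H p.1} := by
  ext t
  constructor
  · rintro ⟨s, hs, hst⟩
    rcases (h.coincide s t hs).1 hst with h | ⟨i, j, ε, hj, -, rfl⟩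
    · exact Or.inl ⟨s, hs, h⟩
    · exact Or.inr ⟨⟨i, j, !ε⟩, hj, rfl⟩
  · rintro (⟨s, hs, hst⟩ | ⟨⟨i, j, ε⟩, hj, rfl⟩)
    · exact ⟨s, hs, (h.coincide s t hs).2 (Or.inl hst)⟩
    · refine ⟨nestPoint E ⟨i, j, !ε⟩, (nestPoint_ne F i j ε).symm, ?_⟩
      exact (h.coincide _ _ (nestPoint_ne F i j ε).symm).2 (Or.inr ⟨i, j, !ε, hj, rfl, by simp⟩)

/-- The double points of `D` which are joined by a short arc outside of the flat arc. -/
def outerShort (γ : Circle → Plane) (E : ℝ → Circle) (m : ℕ) : Set Circle :=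
  {s | ∃ s', s ≠ s' ∧ γ s = γ s' ∧ ∃ C, IsPreconnected C ∧ s ∈ C ∧ s' ∈ C ∧
    (∀ u ∈ Icc (-1 : ℝ) 1, E u ∉ C) ∧ (C ∩ doubles γ).ncard ≤ m}

variable {a b : ℝ} (hb : 0 < b) (hbπ : b < Real.pi)
  (F : FlatAt D.curve Φ fun u => Circle.exp (a + b * u))
  (h : IsNest D Φ (fun u => Circle.exp (a + b * u)) H D')

include F h in
theorem outerShort_subset (m : ℕ) :
    outerShort D.curve (fun u => Circle.exp (a + b * u)) m ⊆ shortSet D'.curve m := by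
  rintro s ⟨s', hne, hs, C, hC, hsC, hsC', hE, hn⟩
  refine ⟨s', hne, (h.coincide s s' hne).2 (Or.inl hs), C, hC, hsC, hsC', ?_⟩
  rw [h.doubles_eq F, inter_union_distrib_left]
  have : C ∩ nestPoint (fun u => Circle.exp (a + b * u)) '' {p | p.2.1 < H p.1} = ∅ := by
    rw [eq_empty_iff_forall_notMem]
    rintro _ ⟨hx, p, -, rfl⟩
    exact hE _ (nestPos₀_mem p) hx
  rwa [this, union_empty]

include F h in
-- The arc across the middle of the piece joins the two parameters of the curl at depth `j` and
-- contains only those of the curls at depths `j` to `H i - 1`, which are `2 (H i - j) ≤ 2k`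
-- parameters.
theorem inner_subset (k : ℕ) :
    nestPoint (fun u => Circle.exp (a + b * u)) '' (nestIndex H k) ⊆ shortSet D'.curve (2 * k) := by
  rintro _ ⟨⟨i, j, ε⟩, hp, rfl⟩
  have hp' := mem_nestIndex.1 hp
  simp only at hp'
  refine ⟨_, nestPoint_ne F i j ε, (h.coincide _ _ (nestPoint_ne F i j ε)).2
    (Or.inr ⟨i, j, ε, hp'.1, rfl, rfl⟩),
    (fun u => Circle.exp (a + b * u)) '' Icc (mid i - nestRad j) (mid i + nestRad j),
    isPreconnected_Icc.image _ (by fun_prop), ?_, ?_, ?_⟩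
  · refine ⟨_, ?_, rfl⟩
    have := nestRad_pos j
    change nestPos₀ _ ∈ _
    rw [nestPos₀_eq]
    cases ε <;> simp <;> linarith
  · refine ⟨_, ?_, rfl⟩
    have := nestRad_pos j
    change nestPos₀ _ ∈ _
    rw [nestPos₀_eq]
    cases ε <;> simp <;> linarith
  · have hsub : (fun u => Circle.exp (a + b * u)) '' Icc (mid i - nestRad j) (mid i + nestRad j) ∩
        doubles D'.curve ⊆ (fun q : ℕ × Bool => nestPoint (fun u => Circle.exp (a + b * u)) ⟨i, q⟩) ''
          (Finset.Ico j (H i) ×ˢ (Finset.univ : Finset Bool) : Finset (ℕ × Bool)) := by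
      rintro _ ⟨⟨u, hu, rfl⟩, hd⟩
      have hu1 : u ∈ Icc (-1 : ℝ) 1 := by
        have := mid_bounds i
        have := nestRad_lt j
        exact ⟨by linarith [hu.1], by linarith [hu.2]⟩
      rw [h.doubles_eq F] at hd
      rcases hd with hd | ⟨p, hpH, hpu⟩
      · exact absurd hd (F.notMem_doubles hu1)
      · have e : nestPos₀ p = u := F.inj (nestPos₀_mem p) hu1 hpu
        have hur : |u - mid i| ≤ nestRad j := abs_le.2 ⟨by linarith [hu.1], by linarith [hu.2]⟩
        have hpi : p.1 = i := eq_of_near_mid (x := u)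
          (by rw [← e, abs_nestPos₀_sub]; exact nestRad_lt _) (hur.trans_lt (nestRad_lt j))
        obtain ⟨i', j', ε'⟩ := p
        simp only at hpi
        subst hpi
        have h3 := abs_nestPos₀_sub ⟨i', j', ε'⟩
        rw [e] at h3
        simp only at h3
        rw [h3, nestRad_strictAnti.le_iff_ge] at hur
        refine ⟨(j', ε'), ?_, hpu⟩
        have hj' : j' < H i' := hpH
        simp [hur, hj']
    refine (ncard_le_ncard hsub ((Finset.finite_toSet _).image _)).trans ?_
    refine (ncard_image_le (Finset.finite_toSet _)).trans ?_
    rw [ncard_coe_finset, Finset.card_product, Nat.card_Ico, Finset.card_univ, Fintype.card_bool]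
    omega

theorem finite_inter_doubles (D' : Diagram Plane) (C : Set Circle) : (C ∩ doubles D'.curve).Finite :=
  D'.finite_double.subset inter_subset_right

include F h in
theorem card_le_of_forall_mem {m : ℕ} {C : Set Circle} (hn : (C ∩ doubles D'.curve).ncard ≤ m)
    (I : Finset ((_ : Fin 4) × (ℕ × Bool))) (hI : ∀ p ∈ I, p.2.1 < H p.1)
    (hIC : ∀ p ∈ I, nestPoint (fun u => Circle.exp (a + b * u)) p ∈ C) : I.card ≤ m := by
  rw [← ncard_coe_finset, ← ncard_image_of_injective _ (nestPoint_injective F)]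
  refine (ncard_le_ncard ?_ (finite_inter_doubles D' C)).trans hn
  rintro _ ⟨p, hp, rfl⟩
  refine ⟨hIC p hp, ?_⟩
  rw [h.doubles_eq F]
  exact Or.inr ⟨p, hI p hp, rfl⟩

include hb hbπ F h in
-- An arc with at most ten crossing parameters cannot swallow too many curls. For an old crossing it
-- misses some curl, so the parameters are already joined outside the flat arc. For a curl of depth
-- `j` it either crosses the middle of the piece, which forces `H i - j ≤ k`, or goes around through
-- all other pieces, which contain at least twelve crossing parameters.
theorem shortSet_subset (hH : ∀ i : Fin 4, (i : ℕ) + 1 ≤ H i) {k : ℕ} (hk : k ≤ 5) :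
    shortSet D'.curve (2 * k) ⊆ outerShort D.curve (fun u => Circle.exp (a + b * u)) (2 * k) ∪
      nestPoint (fun u => Circle.exp (a + b * u)) '' (nestIndex H k) := by
  have hHs := Fin.forall_fin_succ.1 hH
  have H0 := hH 0
  have H1 := hH 1
  have H2 := hH 2
  have H3 := hH 3
  simp only [Fin.val_zero, Fin.val_one, Fin.val_two, show ((3 : Fin 4) : ℕ) = 3 from rfl] at H0 H1 H2 H3
  rintro s ⟨s', hne, hs, C, hC, hsC, hsC', hn⟩
  rcases (h.coincide s s' hne).1 hs with hs | ⟨i, j, ε, hj, rfl, rfl⟩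
  · left
    -- some crossing of the nested curls is not in `C`
    obtain ⟨p, hp, hpC⟩ : ∃ p : (_ : Fin 4) × (ℕ × Bool), p.2.1 < H p.1 ∧
        nestPoint (fun u => Circle.exp (a + b * u)) p ∉ C := by
      by_contra! hall
      -- All curls together have at least `2 (1 + 2 + 3 + 4) = 20` parameters, more than `2k ≤ 10`.
      have := card_le_of_forall_mem F h hn (nestIndex H 5) (fun p hp => (mem_nestIndex.1 hp).1)
        (fun p hp => hall p (mem_nestIndex.1 hp).1)
      rw [card_nestIndex, Fin.sum_univ_four] at this
      omega
    set θ : ℝ := a + b * nestPos₀ p with hθ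
    have hθC : Circle.exp θ ∉ C := hpC
    have hpm := nestPos₀_mem p
    -- a parameter outside of the flat arc
    have hpar : ∀ t ∈ doubles D.curve, ∃ x, a + b < x ∧ x < a - b + 2 * Real.pi ∧
        Circle.exp x = t := by
      intro t ht
      obtain ⟨w, rfl⟩ := Circle.exp_surjective t
      obtain ⟨x, hx, he⟩ := Circle.periodic_exp.exists_mem_Ico (by positivity) w (a - b)
      refine ⟨x, ?_, by linarith [hx.2], he.symm⟩
      by_contra! hle
      have hu : (x - a) / b ∈ Icc (-1 : ℝ) 1 :=
        ⟨by rw [le_div_iff₀ hb]; linarith [hx.1], by rw [div_le_iff₀ hb]; linarith⟩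
      refine F.notMem_doubles hu ?_
      rw [mul_div_cancel₀ _ hb.ne', add_sub_cancel, ← he]
      exact ht
    obtain ⟨x, hx1, hx2, rfl⟩ := hpar s ⟨s', hne.symm, hs.symm⟩
    obtain ⟨y, hy1, hy2, rfl⟩ := hpar s' ⟨_, hne, hs⟩
    have hθ1 : θ ≤ a + b := by rw [hθ]; nlinarith [hpm.2]
    have hθ2 : a - b ≤ θ := by rw [hθ]; nlinarith [hpm.1]
    -- The circle is cut at the missed parameter `θ` of the flat arc; `x` and `y` are
    -- representatives beyond the end of this arc, so the segment between them lies in `C` and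
    -- avoids the flat arc.
    have hsub : Circle.exp '' Icc (min x y) (max x y) ⊆ C := by
      rintro _ ⟨z, hz, rfl⟩
      rcases le_total x y with hxy | hxy
      · rw [min_eq_left hxy, max_eq_right hxy] at hz
        exact exp_mem_of_isPreconnected hC hθC (by linarith) (by linarith) hsC hsC' hz
      · rw [min_eq_right hxy, max_eq_left hxy] at hz
        exact exp_mem_of_isPreconnected hC hθC (by linarith) (by linarith) hsC' hsC hz
    refine ⟨Circle.exp y, hne, hs, Circle.exp '' Icc (min x y) (max x y),
      isPreconnected_Icc.image _ (by fun_prop), ⟨x, by simp, rfl⟩, ⟨y, by simp, rfl⟩, ?_, ?_⟩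
    · rintro u hu ⟨z, hz, he⟩
      have hz1 : a + b < z := (lt_min hx1 hy1).trans_le hz.1
      have hz2 : z < a - b + 2 * Real.pi := hz.2.trans_lt (max_lt hx2 hy2)
      have := Circle.exp_injOn_Ico (a := a - b) (b := a - b + 2 * Real.pi) (by linarith)
        (⟨by linarith, hz2⟩ : z ∈ Ico (a - b) (a - b + 2 * Real.pi))
        (⟨by nlinarith [hu.1], by nlinarith [hu.2]⟩ : a + b * u ∈ Ico (a - b) (a - b + 2 * Real.pi)) he
      nlinarith [hu.2]
    · refine (ncard_le_ncard ?_ (finite_inter_doubles D' C)).trans hn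
      refine inter_subset_inter hsub ?_
      rw [h.doubles_eq F]
      exact subset_union_left
  · right
    refine ⟨⟨i, j, ε⟩, ?_, rfl⟩
    rw [Finset.mem_coe, mem_nestIndex]
    refine ⟨hj, ?_⟩
    by_contra! hlt
    simp only at hlt
    have hr := nestRad_pos j
    have hr8 := nestRad_lt j
    have hmi := mid_bounds i
    -- both ends of the chord
    have hends : Circle.exp (a + b * (mid i + nestRad j)) ∈ C ∧
        Circle.exp (a + b * (mid i - nestRad j)) ∈ C := by
      have h1 : Circle.exp (a + b * nestPos₀ ⟨i, j, ε⟩) ∈ C := hsC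
      have h2 : Circle.exp (a + b * nestPos₀ ⟨i, j, !ε⟩) ∈ C := hsC'
      rw [nestPos₀_eq] at h1 h2
      cases ε
      · exact ⟨by simpa using h2, by simpa using h1⟩
      · exact ⟨by simpa using h1, by simpa using h2⟩
    by_cases hall : ∀ z ∈ Icc (mid i - nestRad j) (mid i + nestRad j), Circle.exp (a + b * z) ∈ C
    · have := card_le_of_forall_mem F h hn
        ((Finset.Ico j (H i) ×ˢ (Finset.univ : Finset Bool)).map
          ⟨fun q => (⟨i, q⟩ : (_ : Fin 4) × (ℕ × Bool)), fun _ _ h => by simpa using h⟩) ?_ ?_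
      · rw [Finset.card_map, Finset.card_product, Nat.card_Ico, Finset.card_univ,
          Fintype.card_bool] at this
        omega
      · intro p hp
        simp only [Finset.mem_map, Finset.mem_product, Finset.mem_Ico, Finset.mem_univ, and_true] at hp
        obtain ⟨q, hq, rfl⟩ := hp
        exact hq.2
      · intro p hp
        simp only [Finset.mem_map, Finset.mem_product, Finset.mem_Ico, Finset.mem_univ, and_true] at hp
        obtain ⟨q, hq, rfl⟩ := hp
        have h1 := abs_nestPos₀_sub ⟨i, q⟩
        have h2 := nestRad_strictAnti.antitone hq.1
        have h3 := abs_le.1 (h1.le.trans h2)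
        dsimp only at h3
        change Circle.exp (a + b * nestPos₀ ⟨i, q⟩) ∈ C
        refine hall _ ?_
        exact ⟨by linarith, by linarith⟩
    · push Not at hall
      obtain ⟨z, hz, hzC⟩ := hall
      have hz1 : z < mid i + nestRad j := lt_of_le_of_ne hz.2 fun e => hzC (e ▸ hends.1)
      have hz0 : mid i - nestRad j < z := lt_of_le_of_ne hz.1 fun e => hzC (e ▸ hends.2)
      have hout : ∀ p : (_ : Fin 4) × (ℕ × Bool), p.1 ≠ i →
          nestPoint (fun u => Circle.exp (a + b * u)) p ∈ C := by
        intro p hpi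
        have hpm := nestPos₀_mem p
        have h1 := abs_le.1 (abs_nestPos₀_sub p).le
        have h2 := nestRad_lt p.2.1
        have h3 := mid_dist hpi
        -- With the circle cut at `z`, the set `C` contains the whole segment from the right end of
        -- the chord to its left end raised by a full turn. Pieces to the right of the `i`-th lie in
        -- it directly, those to the left after adding `2π`.
        have hend2 : Circle.exp (a + b * (mid i - nestRad j) + 2 * Real.pi) ∈ C := by
          rw [Circle.exp_add_two_pi]; exact hends.2
        have hzz : a + b * z < a + b * (mid i + nestRad j) := by nlinarith
        have hzz' : a + b * (mid i - nestRad j) < a + b * z := by nlinarith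
        rw [nestPoint_eq]
        rcases le_abs.1 h3 with h3 | h3
        · refine exp_mem_of_isPreconnected hC hzC (x := a + b * (mid i + nestRad j))
            (y := a + b * (mid i - nestRad j) + 2 * Real.pi) hzz (by linarith) hends.1 hend2 ⟨?_, ?_⟩
          · nlinarith
          · nlinarith [hpm.2]
        · rw [← Circle.exp_add_two_pi]
          refine exp_mem_of_isPreconnected hC hzC (x := a + b * (mid i + nestRad j))
            (y := a + b * (mid i - nestRad j) + 2 * Real.pi) hzz (by linarith) hends.1 hend2 ⟨?_, ?_⟩
          · nlinarith [hpm.1]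
          · nlinarith
      have := card_le_of_forall_mem F h hn ((nestIndex H 5).filter fun p => p.1 ≠ i)
        (fun p hp => (mem_nestIndex.1 (Finset.mem_filter.1 hp).1).1)
        (fun p hp => hout p (Finset.mem_filter.1 hp).2)
      have hcard : ((nestIndex H 5).filter fun p => p.1 ≠ i) =
          nestIndex (Function.update H i 0) 5 := by
        ext p
        rw [Finset.mem_filter, mem_nestIndex, mem_nestIndex]
        rcases eq_or_ne p.1 i with hp | hp
        · rw [hp]; simp
        · rw [Function.update_of_ne hp]; simp [hp]
      rw [hcard, card_nestIndex, Fin.sum_univ_four] at this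
      -- Even without the largest piece there remain `2 (1 + 2 + 3) = 12 > 10` parameters.
      fin_cases i <;> simp [Function.update] at this <;> omega

include hb hbπ F h in
-- The contribution of the original diagram does not involve `H`, so it cancels when two such
-- diagrams are compared.
theorem ncard_shortSet_nest (hH : ∀ i : Fin 4, (i : ℕ) + 1 ≤ H i) {k : ℕ} (hk : k ≤ 5) :
    (shortSet D'.curve (2 * k)).ncard =
      (outerShort D.curve (fun u => Circle.exp (a + b * u)) (2 * k)).ncard +
        2 * ∑ i, min (H i) k := by
  have e : shortSet D'.curve (2 * k) = outerShort D.curve (fun u => Circle.exp (a + b * u)) (2 * k) ∪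
      nestPoint (fun u => Circle.exp (a + b * u)) '' (nestIndex H k) :=
    (shortSet_subset hb hbπ F h hH hk).antisymm
      (union_subset (outerShort_subset F h _) (inner_subset F h k))
  have hfin : (shortSet D'.curve (2 * k)).Finite :=
    D'.finite_double.subset (shortSet_subset_doubles _ _)
  rw [e] at hfin ⊢
  rw [ncard_union_eq ?_ (hfin.subset subset_union_left) (hfin.subset subset_union_right),
    ncard_image_of_injective _ (nestPoint_injective F), ncard_coe_finset, card_nestIndex]
  rw [Set.disjoint_left]
  rintro _ ⟨s', hne, hs, -⟩ ⟨p, -, rfl⟩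
  exact F.notMem_doubles (nestPos₀_mem p) ⟨s', hne.symm, hs.symm⟩

end Count

/-- At threshold `k` the `i`-th piece contributes `H i` if `i + 2 ≤ k`, and the constant `k` if `i +
1 ≥ k`. Raising `k` therefore brings in one unknown at a time; this is why the pieces start from
different numbers of curls. -/
theorem sum_min_nest {H : Fin 4 → ℕ} (hH : ∀ i : Fin 4, H i = i + 1 ∨ H i = i + 2) :
    (∑ i, min (H i) 2 = H 0 + 6 ∧ ∑ i, min (H i) 3 = H 0 + H 1 + 6) ∧
      ∑ i, min (H i) 4 = H 0 + H 1 + H 2 + 4 ∧ ∑ i, min (H i) 5 = H 0 + H 1 + H 2 + H 3 := by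
  have a0 : H 0 = 1 ∨ H 0 = 2 := hH 0
  have a1 : H 1 = 2 ∨ H 1 = 3 := hH 1
  have a2 : H 2 = 3 ∨ H 2 = 4 := hH 2
  have a3 : H 3 = 4 ∨ H 3 = 5 := hH 3
  simp only [Fin.sum_univ_four]
  rcases a0 with a0 | a0 <;> rcases a1 with a1 | a1 <;> rcases a2 with a2 | a2 <;>
    rcases a3 with a3 | a3 <;> rw [a0, a1, a2, a3] <;> decide

/-- The invariant tells how many curls have been added. -/
theorem eq_of_shortSet_eq {D D₁ D₂ : Diagram Plane} {Φ : Plane ≃ₜ Plane} {a b : ℝ} (hb : 0 < b)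
    (hbπ : b < Real.pi) (F : FlatAt D.curve Φ fun u => Circle.exp (a + b * u)) {H₁ H₂ : Fin 4 → ℕ}
    (h₁ : IsNest D Φ (fun u => Circle.exp (a + b * u)) H₁ D₁)
    (h₂ : IsNest D Φ (fun u => Circle.exp (a + b * u)) H₂ D₂)
    (hH₁ : ∀ i : Fin 4, H₁ i = i + 1 ∨ H₁ i = i + 2) (hH₂ : ∀ i : Fin 4, H₂ i = i + 1 ∨ H₂ i = i + 2)
    (h : ∀ m, (shortSet D₁.curve m).ncard = (shortSet D₂.curve m).ncard) : H₁ = H₂ := by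
  have key : ∀ k ≤ 5, ∑ i, min (H₁ i) k = ∑ i, min (H₂ i) k := by
    intro k hk
    have := h (2 * k)
    rw [ncard_shortSet_nest hb hbπ F h₁ (fun i => by have := hH₁ i; omega) hk,
      ncard_shortSet_nest hb hbπ F h₂ (fun i => by have := hH₂ i; omega) hk] at this
    omega
  have k2 := key 2 (by norm_num)
  have k3 := key 3 (by norm_num)
  have k4 := key 4 (by norm_num)
  have k5 := key 5 (by norm_num)
  obtain ⟨⟨a2, a3⟩, a4, a5⟩ := sum_min_nest hH₁
  obtain ⟨⟨b2, b3⟩, b4, b5⟩ := sum_min_nest hH₂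
  have e0 : H₁ 0 = H₂ 0 := by omega
  have e1 : H₁ 1 = H₂ 1 := by omega
  have e2 : H₁ 2 = H₂ 2 := by omega
  have e3 : H₁ 3 = H₂ 3 := by omega
  funext i
  fin_cases i <;> assumption

/-! ## Embedding a surface in another one -/

section Embed

variable {S T : Type*} [TopologicalSpace S] [TopologicalSpace T] {f : S → T}

theorem IsDisc.comp {φ : Plane → S} (hφ : IsDisc φ) (hf : Continuous f)
    (hi : Function.Injective f) : IsDisc fun w => f (φ w) :=
  ⟨hf.comp_continuousOn hφ.1, hi.comp_injOn hφ.2⟩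

theorem TracesIn.comp {k : ℕ} {γ : Circle → S} {φ : Plane → S} {e : Fin k → ℝ → Circle}
    {pos : Fin k → ℝ → Plane} (h : TracesIn γ φ e pos) (hi : Function.Injective f) :
    TracesIn (fun t => f (γ t)) (fun w => f (φ w)) e pos := by
  refine ⟨?_, fun j u hu => ⟨(h.2 j u hu).1, congrArg f (h.2 j u hu).2⟩⟩
  rw [← h.1]
  ext t
  simp [hi.eq_iff]

theorem CrossesAt.comp {γ : Circle → S} {s t : Circle} (h : CrossesAt γ s t) (hf : Continuous f)
    (hi : Function.Injective f) : CrossesAt (fun t => f (γ t)) s t := by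
  obtain ⟨φ, e, h1, h2, h3, h4⟩ := h
  exact ⟨_, e, h1.comp hf hi, h2, h3.comp hi, h4⟩

/-- The image of a diagram under an embedding of the surface in another one. -/
def Diagram.map (f : S → T) (hf : Continuous f) (hi : Function.Injective f) (D : Diagram S) :
    Diagram T where
  curve t := f (D.curve t)
  upper := D.upper
  continuous_curve := hf.comp D.continuous_curve
  finite_double := by simpa only [hi.eq_iff] using D.finite_double
  no_triple := by simpa only [hi.eq_iff] using D.no_triple
  crosses s t hne h := (D.crosses s t hne (hi h)).comp hf hi
  upper_subset := by simpa only [hi.eq_iff] using D.upper_subset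
  upper_iff s t hne h := D.upper_iff s t hne (hi h)

theorem ChangesBy.map {k : ℕ} {P Q : Picture k} {D D' : Diagram S} (h : ChangesBy P Q D D')
    (hf : Continuous f) (hi : Function.Injective f) :
    ChangesBy P Q (D.map f hf hi) (D'.map f hf hi) := by
  obtain ⟨φ, e, h1, h2, h3, h4, h5⟩ := h
  exact ⟨_, e, h1.comp hf hi, h2, ⟨h3.1.comp hi, h3.2⟩, ⟨h4.1.comp hi, h4.2⟩,
    fun t ht => ⟨congrArg f (h5 t ht).1, (h5 t ht).2⟩⟩

theorem IsMove.map {D D' : Diagram S} (h : IsMove D D') (hf : Continuous f)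
    (hi : Function.Injective f) : IsMove (D.map f hf hi) (D'.map f hf hi) := by
  rcases h with h | h | ⟨σ, h⟩
  · exact Or.inl (h.map hf hi)
  · exact Or.inr (Or.inl (h.map hf hi))
  · exact Or.inr (Or.inr ⟨σ, h.map hf hi⟩)

end Embed

/-! ## The central projection of the plane to the sphere -/

/-- The distance of the origin from the point of the plane at height one over `x`. -/
def liftNorm (x : Plane) : ℝ := ‖(!₂[x 0, x 1, 1] : Space)‖

theorem liftNorm_pos (x : Plane) : 0 < liftNorm x := by
  refine norm_pos_iff.2 fun h => ?_
  have := congrArg (fun v : Space => v 2) h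
  simp at this

theorem continuous_liftNorm : Continuous liftNorm := by
  unfold liftNorm
  have h : Continuous fun x : Plane => (!₂[x 0, x 1, 1] : Space) := by
    refine (PiLp.continuous_toLp 2 _).comp (continuous_pi fun i => ?_)
    fin_cases i <;> simp <;> fun_prop
  exact h.norm

/-- The central projection of the plane at height one to the sphere. -/
def toSphere (x : Plane) : Sphere2 :=
  ⟨(liftNorm x)⁻¹ • !₂[x 0, x 1, 1], by
    have h := liftNorm_pos x
    rw [mem_sphere_zero_iff_norm, norm_smul, norm_inv, Real.norm_of_nonneg h.le]
    exact inv_mul_cancel₀ h.ne'⟩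

theorem continuous_toSphere : Continuous toSphere := by
  refine Continuous.subtype_mk ?_ _
  have h : Continuous fun x : Plane => (!₂[x 0, x 1, 1] : Space) := by
    refine (PiLp.continuous_toLp 2 _).comp (continuous_pi fun i => ?_)
    fin_cases i <;> simp <;> fun_prop
  exact (continuous_liftNorm.inv₀ fun x => (liftNorm_pos x).ne').smul h

theorem toSphere_injective : Function.Injective toSphere := by
  intro x y h
  have h := congrArg Subtype.val h
  have h2 := congrArg (fun v : Space => v 2) h
  have h0 := congrArg (fun v : Space => v 0) h
  have h1 := congrArg (fun v : Space => v 1) h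
  simp only [toSphere, PiLp.smul_apply, smul_eq_mul, Matrix.cons_val, mul_one] at h0 h1 h2
  have hx := (inv_pos.2 (liftNorm_pos x)).ne'
  rw [← h2] at h0 h1
  exact plane_ext (mul_left_cancel₀ hx h0) (mul_left_cancel₀ hx h1)

/-- The shift by `log (liftNorm x)` measures heights on the ray through `(x, 1)` from that point, so
height `z` becomes the point `exp z • (x, 1)`. -/
theorem sphereLift_toSphere (x : Plane) (z : ℝ) :
    sphereLift (toSphere x) (z + Real.log (liftNorm x)) =
      planeLift (Real.exp z • x) (Real.exp z) := by
  have h := liftNorm_pos x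
  unfold sphereLift planeLift
  congr 1
  rw [Real.exp_add, Real.exp_log h]
  ext i
  fin_cases i <;> simp [toSphere] <;> field_simp

/-- The truncation of a real number to `[-M, M]`. -/
def trunc (M z : ℝ) : ℝ := max (-M) (min z M)

theorem trunc_bounds {M : ℝ} (hM : 0 ≤ M) (z : ℝ) : -M ≤ trunc M z ∧ trunc M z ≤ M :=
  ⟨le_max_left _ _, max_le (by linarith) (min_le_right _ _)⟩

theorem trunc_mono {M z z' : ℝ} (h : z ≤ z') : trunc M z ≤ trunc M z' :=
  max_le_max le_rfl (min_le_min h le_rfl)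

theorem sub_trunc_mono {M z z' : ℝ} (h : z ≤ z') : z - trunc M z ≤ z' - trunc M z' := by
  unfold trunc
  rcases max_cases (-M) (min z M) with ⟨h1, h2⟩ | ⟨h1, h2⟩ <;>
  rcases max_cases (-M) (min z' M) with ⟨h3, h4⟩ | ⟨h3, h4⟩ <;>
  rcases min_cases z M with ⟨h5, h6⟩ | ⟨h5, h6⟩ <;>
  rcases min_cases z' M with ⟨h7, h8⟩ | ⟨h7, h8⟩ <;> linarith

theorem continuous_trunc (M : ℝ) : Continuous (trunc M) := by
  unfold trunc
  fun_prop

/-- Scaling the horizontal plane at height `z` by `exp z`, and moving it to height `exp z`, does not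
change a knot. -/
theorem exp_isotopic {ι : Type*} (w : ι → Plane) (z : ι → ℝ) {M : ℝ} (hM : 0 ≤ M)
    (hz : ∀ i, |z i| ≤ M) :
    AmbientIsotopic (range fun i => planeLift (w i) (z i))
      (range fun i => planeLift (Real.exp (z i) • w i) (Real.exp (z i))) := by
  have hct := continuous_trunc M
  have hB : ∀ z, 0 ≤ Real.exp (trunc M z) - trunc M z ∧
      Real.exp (trunc M z) - trunc M z ≤ Real.exp M + M := by
    intro z
    have h := trunc_bounds hM z
    have h1 := Real.add_one_le_exp (trunc M z)
    have h2 := Real.exp_le_exp.2 h.2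
    constructor <;> linarith
  -- The heights of the knot lie in `[-M, M]`, where truncation has no effect and `k 1` is `exp`.
  -- Truncation makes `k s` a bounded perturbation of the identity, hence onto; it is increasing as
  -- a convex combination of increasing functions.
  let k : ℝ → ℝ → ℝ := fun s z => z + s * (Real.exp (trunc M z) - trunc M z)
  have hkmono : ∀ s ∈ unitInterval, StrictMono (k s) := by
    intro s hs z z' h
    have h1 := trunc_mono (M := M) h.le
    have h2 := sub_trunc_mono (M := M) h.le
    have h3 := Real.exp_le_exp.2 h1
    have h4 : z + (Real.exp (trunc M z) - trunc M z) < z' + (Real.exp (trunc M z') - trunc M z') := by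
      rcases h1.lt_or_eq with h5 | h5
      · linarith [Real.exp_lt_exp.2 h5]
      · rw [h5]; linarith
    simp only [k]
    rcases hs.1.lt_or_eq with h5 | h5
    · nlinarith [hs.2]
    · rw [← h5]; linarith
  have hksurj : ∀ s ∈ unitInterval, Function.Surjective (k s) := by
    intro s hs
    have hc : Continuous (k s) := by fun_prop
    refine hc.surjective ?_ ?_
    · refine Filter.tendsto_atTop_mono (fun z => ?_) Filter.tendsto_id
      have := mul_nonneg hs.1 (hB z).1
      simp only [k, id]; linarith
    · refine Filter.tendsto_atBot_mono (f := fun z => z + (Real.exp M + M)) (g := k s) (fun z => ?_)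
        (Filter.tendsto_atBot_add_const_right _ _ Filter.tendsto_id)
      have := mul_le_of_le_one_left (hB z).1 hs.2
      simp only [k]; linarith [(hB z).2]
  have := lift_isotopic (fun q => (Real.exp (q.1 * trunc M q.2.2) • q.2.1, k q.1 q.2.2))
    (by fun_prop) ?_ ?_ ?_ (fun i => (w i, z i))
  · have ht : ∀ i, trunc M (z i) = z i := fun i => by
      have := abs_le.1 (hz i)
      rw [trunc, min_eq_left this.2, max_eq_right this.1]
    simpa [k, ht] using this
  · intro t
    constructor
    · rintro ⟨x, a⟩ ⟨y, b⟩ h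
      obtain ⟨h1, h2⟩ := Prod.ext_iff.1 h
      have h2 : a = b := (hkmono t t.2).injective h2
      subst h2
      exact Prod.ext (smul_right_injective _ (Real.exp_pos _).ne' h1) rfl
    · rintro ⟨y, b⟩
      obtain ⟨a, rfl⟩ := hksurj t t.2 b
      exact ⟨⟨(Real.exp (t * trunc M a))⁻¹ • y, a⟩,
        Prod.ext (smul_inv_smul₀ (Real.exp_pos _).ne' y) rfl⟩
  · intro p
    simp [k]
  · intro R
    refine ⟨max (Real.exp M * R) (R + (Real.exp M + M)), fun t p hp => ?_⟩
    rw [Prod.norm_def, sup_le_iff] at hp ⊢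
    simp only [norm_smul, Real.norm_of_nonneg (Real.exp_pos _).le] at hp
    have h1 := trunc_bounds hM p.2
    refine ⟨le_trans ?_ (le_max_left _ _), le_trans ?_ (le_max_right _ _)⟩
    · have h2 : -M ≤ t * trunc M p.2 := by nlinarith [t.2.1, t.2.2]
      have h3 : 1 ≤ Real.exp M * Real.exp (t * trunc M p.2) := by
        rw [← Real.exp_add]; exact Real.one_le_exp (by linarith)
      calc ‖p.1‖ ≤ (Real.exp M * Real.exp (t * trunc M p.2)) * ‖p.1‖ :=
            le_mul_of_one_le_left (norm_nonneg _) h3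
        _ = Real.exp M * (Real.exp (t * trunc M p.2) * ‖p.1‖) := by ring
        _ ≤ _ := mul_le_mul_of_nonneg_left hp.1 (Real.exp_pos _).le
    · have h2 := hp.2
      have h3 := mul_nonneg t.2.1 (hB p.2).1
      have h4 := mul_le_of_le_one_left (hB p.2).1 t.2.2
      have h5 := (hB p.2).2
      rw [Real.norm_eq_abs, abs_le] at h2 ⊢
      simp only [k] at h2
      constructor <;> linarith

/-- The heights are corrected by a function of the point of the plane, so over and under are
preserved at every crossing; the lifted curve is then the one of `exp_isotopic`. -/
theorem Diagram.Represents.toSphere {D : Diagram Plane} {K : Set Sphere3}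
    (h : D.Represents planeLift K) :
    (D.map toSphere continuous_toSphere toSphere_injective).Represents sphereLift K := by
  obtain ⟨z, hz, hu, hK⟩ := h
  refine ⟨fun t => z t + Real.log (liftNorm (D.curve t)), ?_, ?_, ?_⟩
  · refine hz.add (Continuous.log (continuous_liftNorm.comp D.continuous_curve) fun t => ?_)
    exact (liftNorm_pos _).ne'
  · intro s t hne hst hs
    have hst := toSphere_injective hst
    simp only [hst]
    linarith [hu s t hne hst hs]
  · obtain ⟨M, hM⟩ := (isCompact_univ (X := Circle)).exists_bound_of_continuousOn hz.continuousOn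
    have := exp_isotopic D.curve z ((norm_nonneg _).trans (hM 1 (mem_univ _)))
      fun t => hM t (mem_univ _)
    refine AmbientIsotopic.trans ?_ hK
    simpa only [Diagram.map, sphereLift_toSphere] using this.symm

/-! ## A complete minor in a cube -/

/-- Two subsets of a set with four elements differ in one element. -/
def CubeAdj (s t : Finset (Fin 4)) : Prop :=
  ∃ i, (i ∉ s ∧ t = insert i s) ∨ (i ∉ t ∧ s = insert i t)

instance : DecidableRel CubeAdj := fun _ _ => by unfold CubeAdj; infer_instance

/-- Branch sets of a complete minor in the cube of dimension four. -/
def cubeBranch : Fin 5 → Finset (Finset (Fin 4)) :=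
  ![{∅}, {{0}, {0, 1}}, {{1}, {1, 2}}, {{2}, {2, 0}}, {{3}, {3, 0}, {3, 1}, {3, 2}}]

/-- A vertex of the branch set which is joined to all others. -/
def cubeRoot : Fin 5 → Finset (Fin 4) := ![∅, {0}, {1}, {2}, {3}]

theorem CubeAdj.symm {s t : Finset (Fin 4)} (h : CubeAdj s t) : CubeAdj t s := by
  obtain ⟨i, h⟩ := h
  exact ⟨i, h.symm⟩

theorem cubeRoot_mem : ∀ i, cubeRoot i ∈ cubeBranch i := by decide

theorem eq_or_cubeAdj_cubeRoot : ∀ i, ∀ s ∈ cubeBranch i, s = cubeRoot i ∨ CubeAdj s (cubeRoot i) := by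
  decide

theorem disjoint_cubeBranch : ∀ i j, i ≠ j → Disjoint (cubeBranch i) (cubeBranch j) := by decide

theorem exists_cubeAdj : ∀ i j, i ≠ j → ∃ s ∈ cubeBranch i, ∃ t ∈ cubeBranch j, CubeAdj s t := by
  decide

/-- Each branch set is a star around its root, so connectedness reduces to going through the root.
-/
theorem hasMinor_of_cube {V E : Type*} {G : Graph V E} (v : Finset (Fin 4) → V)
    (hv : Function.Injective v) (hG : ∀ s, v s ∈ G.vertexSet)
    (hadj : ∀ s t, CubeAdj s t → G.Adj (v s) (v t)) :
    HasMinor (SimpleGraph.completeGraph (Fin 5)) G := by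
  refine ⟨fun i => v '' (cubeBranch i : Set (Finset (Fin 4))), fun i => ⟨?_, ?_, ?_⟩, fun i j h => ?_,
    fun i j h => ?_⟩
  · rintro _ ⟨s, -, rfl⟩
    exact hG s
  · exact ⟨_, mem_image_of_mem v (cubeRoot_mem i)⟩
  · rintro _ ⟨s, hs, rfl⟩ _ ⟨t, ht, rfl⟩
    have hr := mem_image_of_mem v (cubeRoot_mem i)
    refine Relation.ReflTransGen.trans (b := v (cubeRoot i)) ?_ ?_
    · rcases eq_or_cubeAdj_cubeRoot i s hs with h | h
      · rw [h]
      · exact .single ⟨mem_image_of_mem v hs, hr, hadj _ _ h⟩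
    · rcases eq_or_cubeAdj_cubeRoot i t ht with h | h
      · rw [h]
      · exact .single ⟨hr, mem_image_of_mem v ht, hadj _ _ h.symm⟩
  · rw [disjoint_image_iff hv]
    exact_mod_cast disjoint_cubeBranch i j h
  · obtain ⟨s, hs, t, ht, hst⟩ := exists_cubeAdj i j h
    exact ⟨v s, mem_image_of_mem v hs, v t, mem_image_of_mem v ht, hadj _ _ hst⟩

/-! ## Cubes in Reidemeister graphs -/

/-- The diagrams `D s` of the knot `K` form a cube: a single move adds an element to `s`. -/
structure IsMoveCube {S : Type*} [TopologicalSpace S] (lift : S → ℝ → Sphere3) (K : Set Sphere3)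
    (D : Finset (Fin 4) → Diagram S) : Prop where
  represents : ∀ s, (D s).Represents lift K
  isMove : ∀ s, ∀ i ∉ s, IsMove (D s) (D (insert i s))
  eq_of_eq : ∀ s t, (∀ m, (shortSet (D s).curve m).ncard = (shortSet (D t).curve m).ncard) → s = t

theorem IsMoveCube.hasMinor {S : Type*} [TopologicalSpace S] {lift : S → ℝ → Sphere3}
    {K : Set Sphere3} {D : Finset (Fin 4) → Diagram S} (h : IsMoveCube lift K D) :
    HasMinor (SimpleGraph.completeGraph (Fin 5)) (reidemeisterGraph lift K) := by
  have hvert : ∀ s, ∃ D' : Diagram S, Quotient.mk (diagramSetoid S) D' =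
      Quotient.mk (diagramSetoid S) (D s) ∧ D'.Represents lift K := fun s => ⟨D s, rfl, h.represents s⟩
  refine hasMinor_of_cube (fun s => Quotient.mk (diagramSetoid S) (D s)) (fun s t hst => ?_) hvert ?_
  · obtain ⟨k, -, c⟩ := Quotient.exact hst
    exact h.eq_of_eq s t c.ncard_shortSet
  · rintro s t ⟨i, ⟨hi, rfl⟩ | ⟨hi, rfl⟩⟩
    · exact ⟨Quotient.mk (moveSetoid S) ⟨(D s, D (insert i s)), h.isMove s i hi⟩, hvert _, hvert _, _,
        rfl, Or.inl ⟨rfl, rfl⟩⟩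
    · exact ⟨Quotient.mk (moveSetoid S) ⟨(D t, D (insert i t)), h.isMove t i hi⟩, hvert _, hvert _, _,
        rfl, Or.inr ⟨rfl, rfl⟩⟩

theorem exists_isMoveCube {D : Diagram Plane} {Φ : Plane ≃ₜ Plane} {a b : ℝ} (hb : 0 < b)
    (hbπ : b < Real.pi) (F : FlatAt D.curve Φ fun u => Circle.exp (a + b * u)) {K : Set Sphere3}
    (hD : D.Represents planeLift K) : ∃ D', IsMoveCube planeLift K D' := by
  -- The starting numbers `1, 2, 3, 4` are the ones for which the invariant separates the pieces.
  let H : Finset (Fin 4) → Fin 4 → ℕ := fun s i => i + 1 + if i ∈ s then 1 else 0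
  have hH : ∀ s i, H s i = i + 1 ∨ H s i = i + 2 := fun s i => by
    by_cases h : i ∈ s <;> simp [H, h]
  choose D' hD' hK using fun s => exists_isNest F hD (H s)
  refine ⟨D', hK, fun s i hi => (hD' s).isMove F (i := i) ?_, fun s t h => ?_⟩
  · convert hD' (insert i s) using 1
    funext j
    rcases eq_or_ne j i with rfl | hj
    · simp [H, hi]
    · simp [H, hj]
  · have := eq_of_shortSet_eq hb hbπ F (hD' s) (hD' t) (hH s) (hH t) h
    ext i
    have := congrFun this i
    by_cases h1 : i ∈ s <;> by_cases h2 : i ∈ t <;> simp [H, h1, h2] at this ⊢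

theorem IsMoveCube.toSphere {K : Set Sphere3} {D : Finset (Fin 4) → Diagram Plane}
    (h : IsMoveCube planeLift K D) :
    IsMoveCube sphereLift K fun s => (D s).map toSphere continuous_toSphere toSphere_injective where
  represents s := (h.represents s).toSphere
  isMove s i hi := (h.isMove s i hi).map _ _
  eq_of_eq s t hst := h.eq_of_eq s t <| by
    simpa only [Diagram.map, shortSet_comp toSphere_injective] using hst

/-! ## Curves which are linear near a point -/

/-- The determinant of two vectors of the plane. -/
def det₂ (v w : Plane) : ℝ := v 0 * w 1 - v 1 * w 0

theorem eq_of_smul_add_smul_eq {v w : Plane} (h : det₂ v w ≠ 0) {a b a' b' : ℝ}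
    (e : a • v + b • w = a' • v + b' • w) : a = a' ∧ b = b' := by
  have h0 := congrArg (fun x : Plane => x 0) e
  have h1 := congrArg (fun x : Plane => x 1) e
  simp only [PiLp.add_apply, PiLp.smul_apply, smul_eq_mul] at h0 h1
  unfold det₂ at h
  constructor
  · refine mul_right_cancel₀ h ?_
    linear_combination w 1 * h0 - w 0 * h1
  · refine mul_right_cancel₀ h ?_
    linear_combination v 0 * h1 - v 1 * h0

/-- Near the parameter `s` the curve moves with velocity `v`. -/
def LinearNear (γ : Circle → Plane) (s : Circle) (v : Plane) : Prop :=
  ∃ ε > 0, ∀ u, |u| < ε → γ (s * Circle.exp u) = γ s + u • v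

theorem isOpen_arc (s : Circle) (ε : ℝ) : IsOpen ((fun u => s * Circle.exp u) '' Ioo (-ε) ε) := by
  have : (fun u => s * Circle.exp u) = (s * ·) ∘ Circle.exp := rfl
  rw [this, image_comp]
  exact isOpenMap_mul_left s _ (isLocalHomeomorph_circleExp.isOpenMap _ isOpen_Ioo)

/-- Points of the curve near `γ s` come from arcs around the parameters of `γ s`. -/
theorem exists_forall_mem_arc {γ : Circle → Plane} (hγ : Continuous γ) {s : Circle} {U : Set Circle}
    (hU : IsOpen U) (h : ∀ r, γ r = γ s → r ∈ U) : ∃ ρ > 0, ∀ r, ‖γ r - γ s‖ < ρ → r ∈ U := by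
  have hc : IsClosed (γ '' Uᶜ) := (hU.isClosed_compl.isCompact.image hγ).isClosed
  have hs : γ s ∈ (γ '' Uᶜ)ᶜ := by
    rintro ⟨r, hr, hrs⟩
    exact hr (h r hrs)
  obtain ⟨ρ, hρ, hb⟩ := Metric.isOpen_iff.1 hc.isOpen_compl _ hs
  refine ⟨ρ, hρ, fun r hr => ?_⟩
  by_contra hrU
  exact hb (show γ r ∈ Metric.ball (γ s) ρ by rwa [mem_ball_iff_norm]) ⟨r, hrU, rfl⟩

theorem abs_le_one_of_mem_disc {w : Plane} (hw : w ∈ disc) : |w 0| ≤ 1 ∧ |w 1| ≤ 1 := by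
  rw [mem_disc_iff] at hw
  constructor <;> rw [← sq_le_one_iff_abs_le_one] <;> nlinarith [sq_nonneg (w 0), sq_nonneg (w 1)]

theorem norm_smul_add_smul_lt {v w x : Plane} {δ ρ : ℝ} (hδ : 0 < δ)
    (h : δ * (‖v‖ + ‖w‖) < ρ) (hx : x ∈ disc) : ‖(δ * x 0) • v + (δ * x 1) • w‖ < ρ := by
  obtain ⟨h0, h1⟩ := abs_le_one_of_mem_disc hx
  refine (norm_add_le _ _).trans_lt (lt_of_le_of_lt ?_ h)
  rw [norm_smul, norm_smul, norm_mul, norm_mul, Real.norm_of_nonneg hδ.le, Real.norm_eq_abs,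
    Real.norm_eq_abs, mul_add]
  gcongr
  · exact mul_le_of_le_one_right hδ.le h0
  · exact mul_le_of_le_one_right hδ.le h1

/-- In a small enough disc around the crossing every point of the curve comes from parameters near
`s` or `t`, where the curve is linear. The affine map with axes along the two velocities then shows
a pair of diameters. -/
theorem crossesAt_of_linearNear {γ : Circle → Plane} (hγ : Continuous γ) {s t : Circle}
    (hst : s ≠ t) (he : γ s = γ t) (h : ∀ r, γ r = γ s → r = s ∨ r = t) {v w : Plane}
    (hs : LinearNear γ s v) (ht : LinearNear γ t w) (hvw : det₂ v w ≠ 0) : CrossesAt γ s t := by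
  obtain ⟨ε, hε, hs⟩ := hs
  obtain ⟨ε', hε', ht⟩ := ht
  obtain ⟨ρ, hρ, hr⟩ := exists_forall_mem_arc hγ ((isOpen_arc s ε).union (isOpen_arc t ε'))
    (s := s) (by
      intro r hr
      rcases h r hr with rfl | rfl
      · exact Or.inl ⟨0, by simpa using hε, by simp⟩
      · exact Or.inr ⟨0, by simpa using hε', by simp⟩)
  -- The bounds by `ε` and `ε'` keep the arcs in the linear range; the bound by `ρ` keeps out all
  -- other parts of the curve.
  obtain ⟨δ, hδ, hδε, hδε', hδρ⟩ : ∃ δ > 0, δ < ε ∧ δ < ε' ∧ δ * (‖v‖ + ‖w‖) < ρ := by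
    have hN : 0 < ‖v‖ + ‖w‖ + 1 := by positivity
    have hm : 0 < min (min ε ε') (ρ / (‖v‖ + ‖w‖ + 1)) :=
      lt_min (lt_min hε hε') (div_pos hρ hN)
    obtain ⟨δ, hδ, hlt⟩ := exists_between hm
    rw [lt_min_iff, lt_min_iff, lt_div_iff₀ hN] at hlt
    exact ⟨δ, hδ, hlt.1.1, hlt.1.2, by nlinarith [hlt.2]⟩
  have hs' : ∀ u ∈ Icc (-1 : ℝ) 1, γ (s * Circle.exp (δ * u)) = γ s + (δ * u) • v := fun u hu => by
    refine hs _ ?_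
    rw [abs_mul, abs_of_pos hδ]
    exact (mul_le_of_le_one_right hδ.le (abs_le.2 hu)).trans_lt hδε
  have ht' : ∀ u ∈ Icc (-1 : ℝ) 1, γ (t * Circle.exp (δ * u)) = γ s + (δ * u) • w := fun u hu => by
    rw [he]
    refine ht _ ?_
    rw [abs_mul, abs_of_pos hδ]
    exact (mul_le_of_le_one_right hδ.le (abs_le.2 hu)).trans_lt hδε'
  have key : ∀ a b a' b' : ℝ, γ s + ((δ * a) • v + (δ * b) • w) =
      γ s + ((δ * a') • v + (δ * b') • w) → a = a' ∧ b = b' := fun a b a' b' hab => by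
    have := eq_of_smul_add_smul_eq hvw (add_left_cancel hab)
    exact ⟨mul_left_cancel₀ hδ.ne' this.1, mul_left_cancel₀ hδ.ne' this.2⟩
  let e : Fin 2 → ℝ → Circle := ![fun u => s * Circle.exp (δ * u), fun u => t * Circle.exp (δ * u)]
  let φ : Plane → Plane := fun x => γ s + ((δ * x 0) • v + (δ * x 1) • w)
  have hφe : ∀ j, ∀ u ∈ Icc (-1 : ℝ) 1, γ (e j u) = φ (crossPos j u) := by
    intro j u hu
    fin_cases j
    · simpa [φ, e, crossPos] using hs' u hu
    · simpa [φ, e, crossPos] using ht' u hu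
  have hφi : Function.Injective φ := fun x y hxy =>
    plane_ext (key _ _ _ _ hxy).1 (key _ _ _ _ hxy).2
  refine ⟨φ, e, ⟨by fun_prop, hφi.injOn⟩, ⟨?_, ?_⟩, ⟨Subset.antisymm ?_ ?_, ?_⟩, by simp [e],
    by simp [e]⟩
  · intro j
    fin_cases j <;> simp only [e] <;> dsimp <;> fun_prop
  · rintro ⟨j, u⟩ ⟨-, hu⟩ ⟨k, u'⟩ ⟨-, hu'⟩ huu
    dsimp only at hu hu' huu
    have h1 : crossPos j u = crossPos k u' :=
      hφi (by rw [← hφe j u hu, ← hφe k u' hu', huu])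
    have h2 := congrArg (fun x : Plane => x 0) h1
    have h3 := congrArg (fun x : Plane => x 1) h1
    fin_cases j <;> fin_cases k <;> simp [crossPos] at h2 h3
    · rw [h2]
    · subst h2 h3
      simp [e, hst] at huu
    · subst h2 h3
      simp [e, hst.symm] at huu
    · rw [h3]
  · rintro r ⟨x, hx, hxr⟩
    obtain ⟨hx0, hx1⟩ := abs_le_one_of_mem_disc hx
    have hlt : ‖γ r - γ s‖ < ρ := by
      rw [← hxr, add_sub_cancel_left]
      exact norm_smul_add_smul_lt hδ hδρ hx
    rcases hr r hlt with ⟨u, hu, rfl⟩ | ⟨u, hu, rfl⟩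
    · have h1 := hs u (abs_lt.2 hu)
      have h2 : φ x = γ s + ((δ * (u / δ)) • v + (δ * 0) • w) := by
        rw [hxr, h1, mul_div_cancel₀ _ hδ.ne']; simp
      have h3 := (key _ _ _ _ h2).1
      refine ⟨0, x 0, abs_le.1 hx0, ?_⟩
      simp [e, h3, mul_div_cancel₀ _ hδ.ne']
    · have h1 := ht u (abs_lt.2 hu)
      have h2 : φ x = γ s + ((δ * 0) • v + (δ * (u / δ)) • w) := by
        rw [hxr, h1, mul_div_cancel₀ _ hδ.ne', he]; simp
      have h3 := (key _ _ _ _ h2).2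
      refine ⟨1, x 1, abs_le.1 hx1, ?_⟩
      simp [e, h3, mul_div_cancel₀ _ hδ.ne']
  · rintro _ ⟨j, u, hu, rfl⟩
    exact ⟨_, crossPos_mem_disc j hu, (hφe j u hu).symm⟩
  · exact fun j u hu => ⟨crossPos_mem_disc j hu, hφe j u hu⟩

/-- The affine chart of the plane with origin `x` and basis `v`, `w`. -/
def affineChart (x v w : Plane) (h : det₂ v w ≠ 0) : Plane ≃ₜ Plane where
  toFun y := x + (y 0 • v + y 1 • w)
  invFun y := !₂[det₂ (y - x) w / det₂ v w, det₂ v (y - x) / det₂ v w]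
  left_inv y := by
    refine plane_ext ?_ ?_ <;> simp only [Matrix.cons_val] <;> rw [div_eq_iff h] <;>
      simp [det₂] <;> ring
  right_inv y := by
    refine plane_ext ?_ ?_ <;> simp only [Matrix.cons_val, PiLp.add_apply, PiLp.smul_apply,
      smul_eq_mul] <;> field_simp <;> simp [det₂] <;> ring
  continuous_toFun := by fun_prop
  continuous_invFun := by
    refine (PiLp.continuous_toLp 2 _).comp (continuous_pi fun i => ?_)
    fin_cases i <;> simp [det₂] <;> fun_prop

theorem exists_flatAt_of_linearNear {γ : Circle → Plane} (hγ : Continuous γ) {a : ℝ}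
    (h : ∀ r, γ r = γ (Circle.exp a) → r = Circle.exp a) {v : Plane} (hv : v ≠ 0)
    (hs : LinearNear γ (Circle.exp a) v) :
    ∃ (Φ : Plane ≃ₜ Plane) (b : ℝ), 0 < b ∧ b < Real.pi ∧
      FlatAt γ Φ fun u => Circle.exp (a + b * u) := by
  obtain ⟨ε, hε, hs⟩ := hs
  set s := Circle.exp a with hsa
  obtain ⟨ρ, hρ, hr⟩ := exists_forall_mem_arc hγ (isOpen_arc s ε)
    (s := s) (by
      intro r hr
      rw [h r hr]
      exact ⟨0, by simpa using hε, by simp⟩)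
  -- The velocity turned by a right angle; its determinant with `v` is `‖v‖²`.
  let w : Plane := !₂[-v 1, v 0]
  have hvw : det₂ v w ≠ 0 := by
    intro h0
    simp only [det₂, w, Matrix.cons_val] at h0
    refine hv (plane_ext ?_ ?_) <;> simp <;> nlinarith [sq_nonneg (v 0), sq_nonneg (v 1)]
  obtain ⟨δ, hδ, hδε, hδπ, hδρ⟩ : ∃ δ > 0, δ < ε ∧ δ < Real.pi ∧ δ * (‖v‖ + ‖w‖) < ρ := by
    have hN : 0 < ‖v‖ + ‖w‖ + 1 := by positivity
    have hm : 0 < min (min ε Real.pi) (ρ / (‖v‖ + ‖w‖ + 1)) :=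
      lt_min (lt_min hε Real.pi_pos) (div_pos hρ hN)
    obtain ⟨δ, hδ, hlt⟩ := exists_between hm
    rw [lt_min_iff, lt_min_iff, lt_div_iff₀ hN] at hlt
    exact ⟨δ, hδ, hlt.1.1, hlt.1.2, by nlinarith [hlt.2]⟩
  have hs' : ∀ u ∈ Icc (-1 : ℝ) 1, γ (Circle.exp (a + δ * u)) = γ s + (δ * u) • v := fun u hu => by
    rw [Circle.exp_add]
    refine hs _ ?_
    rw [abs_mul, abs_of_pos hδ]
    exact (mul_le_of_le_one_right hδ.le (abs_le.2 hu)).trans_lt hδε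
  have hdet : det₂ (δ • v) (δ • w) ≠ 0 := by
    have : det₂ (δ • v) (δ • w) = δ ^ 2 * det₂ v w := by simp [det₂]; ring
    rw [this]
    positivity
  refine ⟨affineChart (γ s) (δ • v) (δ • w) hdet, δ, hδ, hδπ, ?_, ?_, ?_, ?_⟩
  · fun_prop
  · intro u hu u' hu' he
    dsimp only at he
    have h1 := hs' u hu
    rw [he, hs' u' hu'] at h1
    have := smul_left_injective ℝ hv (add_left_cancel h1)
    exact (mul_left_cancel₀ hδ.ne' this).symm
  · intro u hu
    rw [hs' u hu]
    simp [affineChart, smul_smul, mul_comm]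
  · intro r hmem
    set x := (affineChart (γ s) (δ • v) (δ • w) hdet).symm (γ r) with hx
    have hxr : γ r = γ s + ((δ * x 0) • v + (δ * x 1) • w) := by
      have := (affineChart (γ s) (δ • v) (δ • w) hdet).apply_symm_apply (γ r)
      rw [← hx] at this
      rw [← this]
      simp [affineChart, smul_smul, mul_comm]
    obtain ⟨hx0, hx1⟩ := abs_le_one_of_mem_disc hmem
    have hlt : ‖γ r - γ s‖ < ρ := by
      rw [hxr, add_sub_cancel_left]
      exact norm_smul_add_smul_lt hδ hδρ hmem
    obtain ⟨u, hu, rfl⟩ := hr r hlt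
    have h1 := hs u (abs_lt.2 hu)
    rw [hxr] at h1
    have h2 : (δ * x 0) • v + (δ * x 1) • w = u • v + (0 : ℝ) • w := by
      rw [add_left_cancel h1]; simp
    have h3 := (eq_of_smul_add_smul_eq hvw h2).1
    refine ⟨x 0, abs_le.1 hx0, ?_⟩
    simp [h3, Circle.exp_add, hsa]

/-! ## Parametrization of a polygon by the circle -/

section Path

variable {n : ℕ} (p : ZMod n → Space)

/-- The point of the `i`-th edge of the polygon with parameter `r`. -/
def edgePoint (i : ZMod n) (r : ℝ) : Space := AffineMap.lineMap (p i) (p (i + 1)) r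

/-- The polygon, parametrized periodically such that the edges have length one. -/
def polyPath (x : ℝ) : Space := edgePoint p (⌊x⌋ : ZMod n) (Int.fract x)

theorem polyPath_apply (m : ℤ) {r : ℝ} (hr : r ∈ Icc (0 : ℝ) 1) :
    polyPath p (m + r) = edgePoint p (m : ZMod n) r := by
  unfold polyPath
  rcases hr.2.lt_or_eq with h | rfl
  · rw [Int.fract_intCast_add, Int.floor_intCast_add, Int.fract_eq_self.2 ⟨hr.1, h⟩,
      Int.floor_eq_zero_iff.2 ⟨hr.1, h⟩, add_zero]
  · have : (m : ℝ) + 1 = ((m + 1 : ℤ) : ℝ) := by push_cast; ring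
    rw [this, Int.fract_intCast, Int.floor_intCast]
    simp [edgePoint]

/-- The intervals `[m, m + 1]` are a locally finite closed cover of the line, and on each of them
the path is affine, since consecutive edges share a vertex. -/
theorem continuous_polyPath : Continuous (polyPath p) := by
  refine (locallyFinite_Icc_of_tendsto (f := fun m : ℤ => (m : ℝ)) (g := fun m : ℤ => (m : ℝ) + 1)
    tendsto_intCast_atTop_atTop (Filter.tendsto_atBot_add_const_right _ _
      (tendsto_intCast_atBot_iff.2 Filter.tendsto_id))).continuous ?_ (fun m => isClosed_Icc) fun m => ?_
  · exact eq_univ_of_forall fun x => mem_iUnion.2 ⟨⌊x⌋, Int.floor_le x, (Int.lt_floor_add_one x).le⟩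
  · have : ContinuousOn (fun x : ℝ => edgePoint p (m : ZMod n) (x - m)) (Icc m (m + 1)) := by
      unfold edgePoint
      exact (AffineMap.lineMap_continuous.comp (continuous_id.sub continuous_const)).continuousOn
    refine this.congr fun x hx => ?_
    simp only
    rw [← polyPath_apply p m ⟨sub_nonneg.2 hx.1, by linarith [hx.2]⟩, add_sub_cancel]

theorem polyPath_add_int (x : ℝ) (m : ℤ) : polyPath p (x + m * n) = polyPath p x := by
  have : x + m * n = x + ((m * n : ℤ) : ℝ) := by push_cast; ring
  unfold polyPath
  rw [this, Int.fract_add_intCast, Int.floor_add_intCast]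
  simp

/-- The parameter in the circle of the point `x` of the periodic parametrization. -/
def polyParam (n : ℕ) (x : ℝ) : Circle := Circle.exp (2 * Real.pi / n * x)

/-- The parametrization of the polygon by the circle. -/
def polyCurve (t : Circle) : Space := polyPath p (n / (2 * Real.pi) * Complex.arg t)

theorem polyParam_add (x y : ℝ) :
    polyParam n (x + y) = polyParam n x * Circle.exp (2 * Real.pi / n * y) := by
  rw [polyParam, mul_add, Circle.exp_add, polyParam]

variable [NeZero n]

theorem natCast_ne_zero_real : (n : ℝ) ≠ 0 := Nat.cast_ne_zero.2 (NeZero.ne n)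

theorem polyCurve_polyParam (x : ℝ) : polyCurve p (polyParam n x) = polyPath p x := by
  have hn := natCast_ne_zero_real (n := n)
  have hpi := Real.pi_ne_zero
  obtain ⟨m, hm⟩ := Circle.exp_eq_exp.1 (Circle.exp_arg (polyParam n x))
  unfold polyCurve
  rw [hm, ← polyPath_add_int p x m]
  congr 1
  field_simp

theorem exists_eq_polyParam (t : Circle) :
    ∃ (m : ℤ) (r : ℝ), r ∈ Ico (0 : ℝ) 1 ∧ t = polyParam n (m + r) := by
  have hn := natCast_ne_zero_real (n := n)
  have hpi := Real.pi_ne_zero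
  obtain ⟨θ, rfl⟩ := Circle.exp_surjective t
  refine ⟨⌊n / (2 * Real.pi) * θ⌋, Int.fract (n / (2 * Real.pi) * θ),
    ⟨Int.fract_nonneg _, Int.fract_lt_one _⟩, ?_⟩
  rw [Int.floor_add_fract, polyParam]
  congr 1
  field_simp

/-- Since `arg` jumps, continuity is checked after composing with the quotient map `Circle.exp`,
where periodicity removes the jump. -/
theorem continuous_polyCurve : Continuous (polyCurve p) := by
  have hq : Topology.IsQuotientMap Circle.exp :=
    isLocalHomeomorph_circleExp.isOpenMap.isQuotientMap Circle.exp.continuous Circle.exp_surjective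
  rw [hq.continuous_iff]
  have : polyCurve p ∘ Circle.exp = fun θ => polyPath p (n / (2 * Real.pi) * θ) := by
    funext θ
    have hn := natCast_ne_zero_real (n := n)
    have hpi := Real.pi_ne_zero
    rw [← polyCurve_polyParam, polyParam]
    simp only [Function.comp_apply]
    congr 2
    field_simp
  rw [this]
  exact (continuous_polyPath p).comp (by fun_prop)

theorem polyParam_eq {m m' : ℤ} (h : (m : ZMod n) = m') (r : ℝ) :
    polyParam n (m + r) = polyParam n (m' + r) := by
  have hn := natCast_ne_zero_real (n := n)
  obtain ⟨k, hk⟩ := (ZMod.intCast_eq_intCast_iff_dvd_sub m m' n).1 h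
  refine (Circle.exp_eq_exp.2 ⟨k, ?_⟩).symm
  have : (m' : ℝ) = m + n * k := by
    have := congrArg (fun z : ℤ => (z : ℝ)) hk
    push_cast at this
    linarith
  rw [this]
  field_simp
  ring

theorem range_polyCurve : range (polyCurve p) =
    (fun q : ZMod n × ℝ => edgePoint p q.1 q.2) '' (univ ×ˢ Ico (0 : ℝ) 1) := by
  ext x
  constructor
  · rintro ⟨t, rfl⟩
    obtain ⟨m, r, hr, rfl⟩ := exists_eq_polyParam (n := n) t
    exact ⟨(m, r), ⟨mem_univ _, hr⟩, by
      rw [polyCurve_polyParam, polyPath_apply p m ⟨hr.1, hr.2.le⟩]⟩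
  · rintro ⟨⟨i, r⟩, ⟨-, hr⟩, rfl⟩
    obtain ⟨m, rfl⟩ := ZMod.intCast_surjective i
    exact ⟨polyParam n (m + r), by
      rw [polyCurve_polyParam, polyPath_apply p m ⟨hr.1, hr.2.le⟩]⟩

end Path

/-! ## Generic directions -/

/-- The determinant of three vectors of space. -/
def det₃ (u v w : Space) : ℝ :=
  (u 1 * v 2 - u 2 * v 1) * w 0 + (u 2 * v 0 - u 0 * v 2) * w 1 + (u 0 * v 1 - u 1 * v 0) * w 2

/-- If a line in direction `w` meets the lines `x + ℝ u`, `y + ℝ v` and `z + ℝ c`, then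
`tripleForm x y z u v c w = 0`. -/
def tripleForm (x y z u v c w : Space) : ℝ :=
  det₃ v c w * det₃ x u w + det₃ c u w * det₃ y v w + det₃ u v w * det₃ z c w

/-- The product of the nonzero polynomials among the `P k` is nonzero, so it does not vanish
everywhere on the infinite field `ℝ`. -/
theorem exists_forall_eval_eq_zero_imp {κ : Type*} [Finite κ] (P : κ → MvPolynomial (Fin 3) ℝ) :
    ∃ d : Fin 3 → ℝ, ∀ k, MvPolynomial.eval d (P k) = 0 → P k = 0 := by
  classical
  have := Fintype.ofFinite κ
  have hne : ∏ k with P k ≠ 0, P k ≠ 0 :=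
    Finset.prod_ne_zero_iff.2 fun k hk => (Finset.mem_filter.1 hk).2
  obtain ⟨d, hd⟩ : ∃ d, MvPolynomial.eval d (∏ k with P k ≠ 0, P k) ≠ 0 := by
    by_contra! h
    exact hne (MvPolynomial.funext fun d => by rw [h d, map_zero])
  refine ⟨d, fun k hk => ?_⟩
  by_contra hk0
  rw [map_prod] at hd
  exact Finset.prod_ne_zero_iff.1 hd k (Finset.mem_filter.2 ⟨Finset.mem_univ _, hk0⟩) hk

/-- Both forms are polynomial in the direction, and there are finitely many of them; a form that
vanishes at a generic direction vanishes identically. -/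
theorem exists_generic {κ : Type*} [Finite κ] (x u : κ → Space) : ∃ d : Space,
    (∀ i j, det₃ (u i) (u j) d = 0 → ∀ w, det₃ (u i) (u j) w = 0) ∧
    ∀ i j k, tripleForm (x i) (x j) (x k) (u i) (u j) (u k) d = 0 →
      ∀ w, tripleForm (x i) (x j) (x k) (u i) (u j) (u k) w = 0 := by
  let L : Space → Space → MvPolynomial (Fin 3) ℝ := fun a b =>
    .C (a 1 * b 2 - a 2 * b 1) * .X 0 + .C (a 2 * b 0 - a 0 * b 2) * .X 1 +
      .C (a 0 * b 1 - a 1 * b 0) * .X 2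
  have hL : ∀ a b w, MvPolynomial.eval w (L a b) = det₃ a b (WithLp.toLp 2 w) := fun a b w => by
    simp [L, det₃]
  let Q : κ → κ → κ → MvPolynomial (Fin 3) ℝ := fun i j k =>
    L (u j) (u k) * L (x i) (u i) + L (u k) (u i) * L (x j) (u j) + L (u i) (u j) * L (x k) (u k)
  have hQ : ∀ i j k w, MvPolynomial.eval w (Q i j k) =
      tripleForm (x i) (x j) (x k) (u i) (u j) (u k) (WithLp.toLp 2 w) := fun i j k w => by
    simp only [Q, map_add, map_mul, hL, tripleForm]
  obtain ⟨d, hd⟩ := exists_forall_eval_eq_zero_imp (κ := (κ × κ) ⊕ (κ × κ × κ))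
    (Sum.elim (fun q => L (u q.1) (u q.2)) fun q => Q q.1 q.2.1 q.2.2)
  refine ⟨WithLp.toLp 2 d, fun i j h w => ?_, fun i j k h w => ?_⟩
  · have := hd (Sum.inl (i, j)) ((hL _ _ _).trans h)
    have h2 := hL (u i) (u j) w
    rw [show L (u i) (u j) = 0 from this, map_zero] at h2
    exact h2.symm
  · have := hd (Sum.inr (i, j, k)) ((hQ _ _ _ _).trans h)
    have h2 := hQ i j k w
    rw [show Q i j k = 0 from this, map_zero] at h2
    exact h2.symm

/-- The direction `d` is generic for the polygon `p`: it has no special position with respect to two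
or three edges unless all directions have it. -/
structure IsGeneric {n : ℕ} (p : ZMod n → Space) (d : Space) : Prop where
  apply_two_ne : d 2 ≠ 0
  not_parallel : ∀ i, p (i + 1) ≠ p i → ∃ w, det₃ d (p (i + 1) - p i) w ≠ 0
  edge_edge : ∀ i j, det₃ (p (i + 1) - p i) (p (j + 1) - p j) d = 0 →
    ∀ w, det₃ (p (i + 1) - p i) (p (j + 1) - p j) w = 0
  vertex_edge : ∀ i j, det₃ (p j - p i) (p (i + 1) - p i) d = 0 →
    ∀ w, det₃ (p j - p i) (p (i + 1) - p i) w = 0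
  triple : ∀ i j k, tripleForm (p i) (p j) (p k) (p (i + 1) - p i) (p (j + 1) - p j)
      (p (k + 1) - p k) d = 0 →
    ∀ w, tripleForm (p i) (p j) (p k) (p (i + 1) - p i) (p (j + 1) - p j) (p (k + 1) - p k) w = 0

theorem exists_isGeneric {n : ℕ} [NeZero n] (p : ZMod n → Space) : ∃ d, IsGeneric p d := by
  let b : Fin 3 → Space := fun c => EuclideanSpace.single c 1
  -- The family consists of the edges with their initial vertices, the differences of vertices, and
  -- the basis vectors. The last ones force `d 2 ≠ 0` and that `d` is parallel to no edge.
  obtain ⟨d, h1, h2⟩ := exists_generic (κ := ZMod n ⊕ (ZMod n × ZMod n) ⊕ Fin 3)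
    (Sum.elim p fun _ => 0)
    (Sum.elim (fun i => p (i + 1) - p i) (Sum.elim (fun q => p q.1 - p q.2) b))
  refine ⟨d, ?_, fun i hi => ?_, fun i j => h1 (.inl i) (.inl j),
    fun i j => h1 (.inr (.inl (j, i))) (.inl i), fun i j k => h2 (.inl i) (.inl j) (.inl k)⟩
  · intro h
    have := h1 (.inr (.inr 0)) (.inr (.inr 1)) (by simp [b, det₃, h]) (b 2)
    simp [b, det₃] at this
  · by_contra! h
    set e := p (i + 1) - p i with he
    have key : ∀ c w, det₃ e (b c) w = 0 := fun c => by
      refine h1 (.inl i) (.inr (.inr c)) ?_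
      have := h (b c)
      simp only [det₃, Sum.elim_inl, Sum.elim_inr] at this ⊢
      linear_combination this
    have h01 := key 0 (b 1)
    have h02 := key 0 (b 2)
    have h12 := key 1 (b 2)
    simp [b, det₃] at h01 h02 h12
    refine hi (sub_eq_zero.1 ?_)
    rw [← he]
    ext c
    fin_cases c <;> simp [h01, h02, h12]

/-! ## Generic projections of a polygon -/

theorem edgePoint_eq {n : ℕ} (p : ZMod n → Space) (i : ZMod n) (r : ℝ) :
    edgePoint p i r = p i + r • (p (i + 1) - p i) := by
  rw [edgePoint, AffineMap.lineMap_apply, vsub_eq_sub, vadd_eq_add, add_comm]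

/-- The projection of space to the horizontal plane in direction `d`. -/
def shadow (d : Space) (x : Space) : Plane :=
  !₂[x 0 - d 0 / d 2 * x 2, x 1 - d 1 / d 2 * x 2]

theorem shadow_add_smul (d x v : Space) (r : ℝ) :
    shadow d (x + r • v) = shadow d x + r • shadow d v := by
  refine plane_ext ?_ ?_ <;> simp [shadow] <;> ring

theorem continuous_shadow (d : Space) : Continuous (shadow d) := by
  refine (PiLp.continuous_toLp 2 _).comp (continuous_pi fun i => ?_)
  fin_cases i <;> simp <;> fun_prop

theorem det₂_shadow {d : Space} (hd : d 2 ≠ 0) (u v : Space) :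
    det₂ (shadow d u) (shadow d v) * d 2 = det₃ u v d := by
  simp only [det₂, det₃, shadow, Matrix.cons_val]
  field_simp
  ring

theorem eq_add_smul_of_shadow_eq {d x y : Space} (hd : d 2 ≠ 0) (h : shadow d x = shadow d y) :
    y = x + ((y 2 - x 2) / d 2) • d := by
  have h0 := congrArg (fun w : Plane => w 0) h
  have h1 := congrArg (fun w : Plane => w 1) h
  simp only [shadow, Matrix.cons_val] at h0 h1
  ext c
  fin_cases c <;> simp <;> field_simp at h0 h1 ⊢ <;> linarith

section Generic

variable {n : ℕ} {p : ZMod n → Space} {d : Space}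

theorem edge_ne (hp : InjOn (fun q : ZMod n × ℝ => edgePoint p q.1 q.2) (univ ×ˢ Ico (0 : ℝ) 1))
    (i : ZMod n) : p (i + 1) ≠ p i := by
  intro h
  have := hp (x₁ := (i, 0)) (x₂ := (i, 1 / 2)) ⟨mem_univ _, by norm_num⟩ ⟨mem_univ _, by norm_num⟩
    (by simp [edgePoint_eq, h])
  simp at this

/-- Points of a generic polygon with the same shadow are on edges with independent shadows. -/
theorem IsGeneric.det_ne (hg : IsGeneric p d)
    (hp : InjOn (fun q : ZMod n × ℝ => edgePoint p q.1 q.2) (univ ×ˢ Ico (0 : ℝ) 1))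
    {i j : ZMod n} {s t : ℝ} (hs : s ∈ Ico (0 : ℝ) 1) (ht : t ∈ Ico (0 : ℝ) 1)
    (hne : (i, s) ≠ (j, t)) (h : shadow d (edgePoint p i s) = shadow d (edgePoint p j t)) :
    det₃ (p (i + 1) - p i) (p (j + 1) - p j) d ≠ 0 := by
  intro h0
  have h1 := hg.edge_edge i j h0
  have hl := eq_add_smul_of_shadow_eq hg.apply_two_ne h
  set l := ((edgePoint p j t) 2 - (edgePoint p i s) 2) / d 2
  have hl0 : l ≠ 0 := by
    intro hl0
    rw [hl0, zero_smul, add_zero] at hl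
    exact hne (hp ⟨mem_univ _, hs⟩ ⟨mem_univ _, ht⟩ hl.symm)
  rw [edgePoint_eq, edgePoint_eq] at hl
  have hji : p j - p i = s • (p (i + 1) - p i) + l • d - t • (p (j + 1) - p j) := by
    rw [sub_eq_iff_eq_add, ← sub_eq_zero]
    rw [← sub_eq_zero] at hl
    rw [← hl]
    abel
  -- The edges are parallel by `h1`, so only the term with `d` remains. It vanishes at `w = d`,
  -- hence identically by `vertex_edge`, which would make `d` parallel to the edge `i`.
  have key : ∀ w, det₃ (p j - p i) (p (i + 1) - p i) w =
      l * det₃ d (p (i + 1) - p i) w + t * det₃ (p (i + 1) - p i) (p (j + 1) - p j) w := by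
    intro w
    rw [hji]
    simp only [det₃, PiLp.add_apply, PiLp.sub_apply, PiLp.smul_apply, smul_eq_mul]
    ring
  obtain ⟨w, hw⟩ := hg.not_parallel i (edge_ne hp i)
  have h2 := hg.vertex_edge i j (by
    rw [key, h0]
    simp only [det₃]
    ring) w
  rw [key, h1, mul_zero, add_zero] at h2
  exact mul_ne_zero hl0 hw h2

/-- A vertex of a generic polygon does not have the same shadow as another point. -/
theorem IsGeneric.pos (hg : IsGeneric p d)
    (hp : InjOn (fun q : ZMod n × ℝ => edgePoint p q.1 q.2) (univ ×ˢ Ico (0 : ℝ) 1))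
    {i j : ZMod n} {s t : ℝ} (hs : s ∈ Ico (0 : ℝ) 1) (ht : t ∈ Ico (0 : ℝ) 1)
    (hne : (i, s) ≠ (j, t)) (h : shadow d (edgePoint p i s) = shadow d (edgePoint p j t)) :
    0 < s := by
  by_contra! hs0
  obtain rfl : s = 0 := le_antisymm hs0 hs.1
  have hl := eq_add_smul_of_shadow_eq hg.apply_two_ne h
  set l := ((edgePoint p j t) 2 - (edgePoint p i 0) 2) / d 2
  have hl0 : l ≠ 0 := by
    intro hl0
    rw [hl0, zero_smul, add_zero] at hl
    exact hne (hp ⟨mem_univ _, hs⟩ ⟨mem_univ _, ht⟩ hl.symm)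
  rw [edgePoint_eq, edgePoint_eq, zero_smul, add_zero] at hl
  have hij : p i - p j = t • (p (j + 1) - p j) - l • d := by
    rw [sub_eq_iff_eq_add, ← sub_eq_zero]
    rw [← sub_eq_zero] at hl
    rw [← neg_eq_zero, ← hl]
    abel
  have key : ∀ w, det₃ (p i - p j) (p (j + 1) - p j) w = -l * det₃ d (p (j + 1) - p j) w := by
    intro w
    rw [hij]
    simp only [det₃, PiLp.sub_apply, PiLp.smul_apply, smul_eq_mul]
    ring
  obtain ⟨w, hw⟩ := hg.not_parallel j (edge_ne hp j)
  have h2 := hg.vertex_edge j i (by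
    rw [key]
    simp only [det₃]
    ring) w
  rw [key] at h2
  exact mul_ne_zero (neg_ne_zero.2 hl0) hw h2

theorem tripleForm_self (x u v c d : Space) (r s t l m : ℝ) :
    tripleForm (x - r • u) (x + l • d - s • v) (x + m • d - t • c) u v c d = 0 := by
  simp only [tripleForm, det₃, PiLp.add_apply, PiLp.sub_apply, PiLp.smul_apply, smul_eq_mul]
  ring

theorem tripleForm_add (x u v c d : Space) (r s t l m : ℝ) :
    tripleForm (x - r • u) (x + l • d - s • v) (x + m • d - t • c) u v c (u + d) =
      (m - l) * (det₃ c u d * det₃ u v d) := by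
  simp only [tripleForm, det₃, PiLp.add_apply, PiLp.sub_apply, PiLp.smul_apply, smul_eq_mul]
  ring

/-- A triple point is a line in direction `d` meeting three edges, so `tripleForm` vanishes at `d`
and therefore everywhere. At `u + d`, however, it is a product of the gap between two of the points
and two determinants, which are nonzero by `det_ne`. -/
theorem IsGeneric.no_triple (hg : IsGeneric p d)
    (hp : InjOn (fun q : ZMod n × ℝ => edgePoint p q.1 q.2) (univ ×ˢ Ico (0 : ℝ) 1))
    {i j k : ZMod n} {r s t : ℝ} (hr : r ∈ Ico (0 : ℝ) 1) (hs : s ∈ Ico (0 : ℝ) 1)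
    (ht : t ∈ Ico (0 : ℝ) 1) (hij : (i, r) ≠ (j, s)) (hki : (k, t) ≠ (i, r)) (hjk : (j, s) ≠ (k, t))
    (h : shadow d (edgePoint p i r) = shadow d (edgePoint p j s))
    (h' : shadow d (edgePoint p i r) = shadow d (edgePoint p k t)) : False := by
  have h1 := hg.det_ne hp hr hs hij h
  have h2 := hg.det_ne hp ht hr hki h'.symm
  have hl := eq_add_smul_of_shadow_eq hg.apply_two_ne h
  have hm := eq_add_smul_of_shadow_eq hg.apply_two_ne h'
  set l := ((edgePoint p j s) 2 - (edgePoint p i r) 2) / d 2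
  set m := ((edgePoint p k t) 2 - (edgePoint p i r) 2) / d 2
  have hlm : m - l ≠ 0 := by
    intro hlm
    rw [sub_eq_zero.1 hlm, ← hl] at hm
    exact hjk (hp ⟨mem_univ _, hs⟩ ⟨mem_univ _, ht⟩ hm.symm)
  have e1 := eq_sub_of_add_eq (edgePoint_eq p i r).symm
  have e2 := eq_sub_of_add_eq (edgePoint_eq p j s).symm
  have e3 := eq_sub_of_add_eq (edgePoint_eq p k t).symm
  rw [hl] at e2
  rw [hm] at e3
  have key := hg.triple i j k
  generalize p (i + 1) - p i = u at *
  generalize p (j + 1) - p j = v at *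
  generalize p (k + 1) - p k = c at *
  rw [e1, e2, e3] at key
  have h3 := key (tripleForm_self _ _ _ _ _ _ _ _ _ _) (u + d)
  rw [tripleForm_add] at h3
  exact mul_ne_zero hlm (mul_ne_zero h2 h1) h3

variable [NeZero n]

/-- The closed curve of the shadows of a polygon. -/
def shadowCurve (p : ZMod n → Space) (d : Space) (t : Circle) : Plane := shadow d (polyCurve p t)

theorem continuous_shadowCurve : Continuous (shadowCurve p d) :=
  (continuous_shadow d).comp (continuous_polyCurve p)

theorem polyCurve_eq_edgePoint (m : ℤ) {r : ℝ} (hr : r ∈ Ico (0 : ℝ) 1) :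
    polyCurve p (polyParam n (m + r)) = edgePoint p m r := by
  rw [polyCurve_polyParam, polyPath_apply p m ⟨hr.1, hr.2.le⟩]

theorem prod_ne_of_polyParam_ne {m m' : ℤ} {r r' : ℝ}
    (h : polyParam n (m + r) ≠ polyParam n (m' + r')) : ((m : ZMod n), r) ≠ ((m' : ZMod n), r') := by
  intro he
  obtain ⟨h1, rfl⟩ := Prod.mk.inj he
  exact h (polyParam_eq h1 r)

theorem polyCurve_injective
    (hp : InjOn (fun q : ZMod n × ℝ => edgePoint p q.1 q.2) (univ ×ˢ Ico (0 : ℝ) 1)) :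
    Function.Injective (polyCurve p) := by
  intro s t h
  obtain ⟨m, r, hr, rfl⟩ := exists_eq_polyParam (n := n) s
  obtain ⟨m', r', hr', rfl⟩ := exists_eq_polyParam (n := n) t
  rw [polyCurve_eq_edgePoint m hr, polyCurve_eq_edgePoint m' hr'] at h
  by_contra hne
  exact prod_ne_of_polyParam_ne hne (hp ⟨mem_univ _, hr⟩ ⟨mem_univ _, hr'⟩ h)

theorem linearNear_shadowCurve (m : ℤ) {r : ℝ} (hr : r ∈ Ioo (0 : ℝ) 1) :
    LinearNear (shadowCurve p d) (polyParam n (m + r))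
      ((n / (2 * Real.pi)) • shadow d (p (m + 1) - p m)) := by
  have hn : (0 : ℝ) < n := Nat.cast_pos.2 (NeZero.pos n)
  have hc : 0 < n / (2 * Real.pi) := div_pos hn (by positivity)
  set c := n / (2 * Real.pi) with hcd
  have hmin : 0 < min r (1 - r) := lt_min hr.1 (sub_pos.2 hr.2)
  refine ⟨min r (1 - r) / c, div_pos hmin hc, fun u hu => ?_⟩
  rw [lt_div_iff₀ hc, lt_min_iff] at hu
  have hcu : |u * c| = |u| * c := by rw [abs_mul, abs_of_pos hc]
  rw [← hcu, abs_lt, abs_lt] at hu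
  have hru : r + c * u ∈ Ico (0 : ℝ) 1 := ⟨by linarith [hu.1.1], by linarith [hu.2.2]⟩
  have : polyParam n (m + r) * Circle.exp u = polyParam n (m + (r + c * u)) := by
    rw [← add_assoc, polyParam_add (m + r)]
    congr 2
    rw [hcd]
    field_simp
  unfold shadowCurve
  rw [this, polyCurve_eq_edgePoint m hru, polyCurve_eq_edgePoint m ⟨hr.1.le, hr.2⟩, edgePoint_eq,
    edgePoint_eq, shadow_add_smul, shadow_add_smul, add_smul, add_assoc, smul_smul, mul_comm u c]

/-- An ordered pair of edges contributes at most one parameter, since their shadows lie on lines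
with independent directions. -/
theorem IsGeneric.finite_doubles (hg : IsGeneric p d)
    (hp : InjOn (fun q : ZMod n × ℝ => edgePoint p q.1 q.2) (univ ×ˢ Ico (0 : ℝ) 1)) :
    (doubles (shadowCurve p d)).Finite := by
  let A : ZMod n × ZMod n → Set Circle := fun ij => {t | ∃ (m m' : ℤ) (r r' : ℝ),
    r ∈ Ico (0 : ℝ) 1 ∧ r' ∈ Ico (0 : ℝ) 1 ∧ (m : ZMod n) = ij.1 ∧ (m' : ZMod n) = ij.2 ∧
    t = polyParam n (m + r) ∧ polyParam n (m' + r') ≠ polyParam n (m + r) ∧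
    shadow d (edgePoint p m r) = shadow d (edgePoint p m' r')}
  refine (finite_iUnion (f := A) fun ij => Set.Subsingleton.finite ?_).subset ?_
  · rintro _ ⟨m, m', r, r', hr, hr', hm, hm', rfl, hne, h⟩ _
      ⟨l, l', s, s', hs, hs', hl, hl', rfl, -, h'⟩
    have hd := hg.det_ne hp hr hr' (prod_ne_of_polyParam_ne hne.symm) h
    rw [← det₂_shadow hg.apply_two_ne] at hd
    rw [hl, hl', ← hm, ← hm'] at h'
    rw [edgePoint_eq, edgePoint_eq, shadow_add_smul, shadow_add_smul] at h h'
    have : r • shadow d (p (m + 1) - p m) + s' • shadow d (p (m' + 1) - p m') =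
        s • shadow d (p (m + 1) - p m) + r' • shadow d (p (m' + 1) - p m') := by
      have := congrArg₂ (· - ·) h h'
      simp only [add_sub_add_left_eq_sub] at this
      rw [← sub_eq_zero] at this ⊢
      rw [← this]
      abel
    obtain rfl := (eq_of_smul_add_smul_eq (left_ne_zero_of_mul hd) this).1
    exact polyParam_eq (hm.trans hl.symm) r
  · rintro t ⟨s, hst, h⟩
    obtain ⟨m, r, hr, rfl⟩ := exists_eq_polyParam (n := n) t
    obtain ⟨m', r', hr', rfl⟩ := exists_eq_polyParam (n := n) s
    refine mem_iUnion.2 ⟨(m, m'), m, m', r, r', hr, hr', rfl, rfl, rfl, hst, ?_⟩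
    unfold shadowCurve at h
    rw [polyCurve_eq_edgePoint m hr, polyCurve_eq_edgePoint m' hr'] at h
    exact h.symm

theorem IsGeneric.no_triple_shadowCurve (hg : IsGeneric p d)
    (hp : InjOn (fun q : ZMod n × ℝ => edgePoint p q.1 q.2) (univ ×ˢ Ico (0 : ℝ) 1))
    (r s t : Circle) (h : shadowCurve p d r = shadowCurve p d s)
    (h' : shadowCurve p d s = shadowCurve p d t) : r = s ∨ s = t ∨ r = t := by
  by_contra! hne
  obtain ⟨h1, h2, h3⟩ := hne
  obtain ⟨m, x, hx, rfl⟩ := exists_eq_polyParam (n := n) r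
  obtain ⟨m', y, hy, rfl⟩ := exists_eq_polyParam (n := n) s
  obtain ⟨m'', z, hz, rfl⟩ := exists_eq_polyParam (n := n) t
  unfold shadowCurve at h h'
  rw [polyCurve_eq_edgePoint m hx, polyCurve_eq_edgePoint m' hy] at h
  rw [polyCurve_eq_edgePoint m' hy, polyCurve_eq_edgePoint m'' hz] at h'
  exact hg.no_triple hp hx hy hz (prod_ne_of_polyParam_ne h1) (prod_ne_of_polyParam_ne h3.symm)
    (prod_ne_of_polyParam_ne h2) h (h.trans h')

theorem IsGeneric.crossesAt (hg : IsGeneric p d)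
    (hp : InjOn (fun q : ZMod n × ℝ => edgePoint p q.1 q.2) (univ ×ˢ Ico (0 : ℝ) 1))
    (s t : Circle) (hst : s ≠ t) (h : shadowCurve p d s = shadowCurve p d t) :
    CrossesAt (shadowCurve p d) s t := by
  have htr : ∀ r, shadowCurve p d r = shadowCurve p d s → r = s ∨ r = t := fun r hr => by
    rcases hg.no_triple_shadowCurve hp r s t hr h with h1 | h1 | h1
    · exact Or.inl h1
    · exact absurd h1 hst
    · exact Or.inr h1
  have he := h
  obtain ⟨m, x, hx, rfl⟩ := exists_eq_polyParam (n := n) s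
  obtain ⟨m', y, hy, rfl⟩ := exists_eq_polyParam (n := n) t
  unfold shadowCurve at h
  rw [polyCurve_eq_edgePoint m hx, polyCurve_eq_edgePoint m' hy] at h
  have hne := prod_ne_of_polyParam_ne hst
  have hd := hg.det_ne hp hx hy hne h
  rw [← det₂_shadow hg.apply_two_ne] at hd
  refine crossesAt_of_linearNear continuous_shadowCurve hst he htr
    (linearNear_shadowCurve m ⟨hg.pos hp hx hy hne h, hx.2⟩)
    (linearNear_shadowCurve m' ⟨hg.pos hp hy hx hne.symm h.symm, hy.2⟩) ?_
  set c := (n : ℝ) / (2 * Real.pi) with hcd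
  have hc : c ≠ 0 := div_ne_zero natCast_ne_zero_real (by positivity)
  have : ∀ v w : Plane, det₂ (c • v) (c • w) = c ^ 2 * det₂ v w := fun v w => by
    simp [det₂]; ring
  rw [this]
  exact mul_ne_zero (pow_ne_zero 2 hc) (left_ne_zero_of_mul hd)

theorem IsGeneric.height_ne (hg : IsGeneric p d)
    (hp : InjOn (fun q : ZMod n × ℝ => edgePoint p q.1 q.2) (univ ×ˢ Ico (0 : ℝ) 1))
    {s t : Circle} (hst : s ≠ t) (h : shadowCurve p d s = shadowCurve p d t) :
    polyCurve p s 2 ≠ polyCurve p t 2 := by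
  intro he
  have := eq_add_smul_of_shadow_eq hg.apply_two_ne h
  rw [he, sub_self, zero_div, zero_smul, add_zero] at this
  exact hst (polyCurve_injective hp this.symm)

/-- The parameters at which the polygon passes over another piece of the polygon. -/
def overSet (p : ZMod n → Space) (d : Space) : Set Circle :=
  {t | ∃ s, s ≠ t ∧ shadowCurve p d s = shadowCurve p d t ∧ polyCurve p s 2 < polyCurve p t 2}

theorem IsGeneric.mem_overSet (hg : IsGeneric p d)
    (hp : InjOn (fun q : ZMod n × ℝ => edgePoint p q.1 q.2) (univ ×ˢ Ico (0 : ℝ) 1))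
    {s t : Circle} (hst : s ≠ t) (h : shadowCurve p d s = shadowCurve p d t) :
    s ∈ overSet p d ↔ polyCurve p t 2 < polyCurve p s 2 := by
  refine ⟨?_, fun hlt => ⟨t, hst.symm, h.symm, hlt⟩⟩
  rintro ⟨r, hrs, hr, hlt⟩
  rcases hg.no_triple_shadowCurve hp r s t hr h with h1 | h1 | rfl
  · exact absurd h1 hrs
  · exact absurd h1 hst
  · exact hlt

/-- The diagram of a polygon for a generic direction. -/
def IsGeneric.diagram (hg : IsGeneric p d)
    (hp : InjOn (fun q : ZMod n × ℝ => edgePoint p q.1 q.2) (univ ×ˢ Ico (0 : ℝ) 1)) :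
    Diagram Plane where
  curve := shadowCurve p d
  upper := overSet p d
  continuous_curve := continuous_shadowCurve
  finite_double := hg.finite_doubles hp
  no_triple := hg.no_triple_shadowCurve hp
  crosses := hg.crossesAt hp
  upper_subset := fun t ⟨s, hst, h, _⟩ => ⟨s, hst, h⟩
  upper_iff s t hst h := by
    rw [hg.mem_overSet hp hst h, hg.mem_overSet hp hst.symm h.symm, not_lt]
    exact ⟨le_of_lt, fun hle => lt_of_le_of_ne hle (hg.height_ne hp hst h).symm⟩

/-- Shearing space does not change a knot. -/
theorem shear_isotopic (a : Space) (ha : a 2 = 0) (A : Set Space) :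
    AmbientIsotopic ((fun x : Space => (x : Sphere3)) '' A)
      ((fun x : Space => (x : Sphere3)) '' ((fun x => x - x 2 • a) '' A)) := by
  have := ambientIsotopic_of_proper (fun q => q.2 - ((q.1 : ℝ) * q.2 2) • a) (by fun_prop) ?_ ?_ ?_ A
  · simpa using this
  · intro t
    refine Function.bijective_iff_has_inverse.2 ⟨fun x => x + ((t : ℝ) * x 2) • a,
      fun x => by simp [ha], fun x => by simp [ha]⟩
  · intro x
    simp
  · intro R
    refine ⟨R + R * ‖a‖, fun t x hx => ?_⟩
    have h1 : |x 2| ≤ R := by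
      have := (PiLp.norm_apply_le (x - ((t : ℝ) * x 2) • a) 2).trans hx
      simpa [ha] using this
    calc ‖x‖ = ‖(x - ((t : ℝ) * x 2) • a) + ((t : ℝ) * x 2) • a‖ := by rw [sub_add_cancel]
      _ ≤ R + |(t : ℝ) * x 2| * ‖a‖ := (norm_add_le _ _).trans (add_le_add hx (norm_smul _ _).le)
      _ ≤ R + R * ‖a‖ := by
        gcongr
        rw [abs_mul, abs_of_nonneg t.2.1]
        exact (mul_le_of_le_one_left (abs_nonneg _) t.2.2).trans h1

/-- A shear that makes `d` vertical turns the projection along `d` into the vertical one and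
preserves the third coordinate, which serves as the height function. -/
theorem IsGeneric.represents (hg : IsGeneric p d)
    (hp : InjOn (fun q : ZMod n × ℝ => edgePoint p q.1 q.2) (univ ×ˢ Ico (0 : ℝ) 1))
    {K : Set Sphere3}
    (hK : AmbientIsotopic ((fun x : Space => (x : Sphere3)) ''
      ((fun q : ZMod n × ℝ => edgePoint p q.1 q.2) '' (univ ×ˢ Ico (0 : ℝ) 1))) K) :
    (hg.diagram hp).Represents planeLift K := by
  refine ⟨fun t => polyCurve p t 2, ?_, fun s t hst h hs => (hg.mem_overSet hp hst h).1 hs, ?_⟩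
  · have := continuous_polyCurve p
    fun_prop
  · rw [← range_polyCurve] at hK
    refine AmbientIsotopic.trans ?_ hK
    have := (shear_isotopic !₂[d 0 / d 2, d 1 / d 2, 0] rfl (range (polyCurve p))).symm
    rw [← range_comp, ← range_comp] at this
    convert this using 2
    funext t
    simp only [Function.comp_apply, planeLift]
    congr 1
    ext c
    fin_cases c <;> simp [IsGeneric.diagram, shadowCurve, shadow, mul_comm]

/-- An open edge has infinitely many parameters, only finitely many of which are double; near any
other one the shadow is a straight arc with nonzero velocity. -/
theorem IsGeneric.exists_flatAt (hg : IsGeneric p d)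
    (hp : InjOn (fun q : ZMod n × ℝ => edgePoint p q.1 q.2) (univ ×ˢ Ico (0 : ℝ) 1)) (m : ℤ) :
    ∃ (Φ : Plane ≃ₜ Plane) (a b : ℝ), 0 < b ∧ b < Real.pi ∧
      FlatAt (shadowCurve p d) Φ fun u => Circle.exp (a + b * u) := by
  have hinj : InjOn (fun r : ℝ => polyParam n (m + r)) (Ioo 0 1) := by
    intro r hr s hs h
    by_contra hne
    have h1 := congrArg (polyCurve p) h
    dsimp only at h1
    rw [polyCurve_eq_edgePoint m ⟨hr.1.le, hr.2⟩, polyCurve_eq_edgePoint m ⟨hs.1.le, hs.2⟩] at h1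
    have := hp (x₁ := ((m : ZMod n), r)) (x₂ := ((m : ZMod n), s))
      ⟨mem_univ _, hr.1.le, hr.2⟩ ⟨mem_univ _, hs.1.le, hs.2⟩ h1
    exact hne (Prod.mk.inj this).2
  obtain ⟨_, ⟨r, hr, rfl⟩, hdbl⟩ :=
    ((infinite_image_iff hinj).2 (Ioo_infinite one_pos)).exists_notMem_finite (hg.finite_doubles hp)
  have hv : (n / (2 * Real.pi)) • shadow d (p (m + 1) - p m) ≠ 0 := by
    refine smul_ne_zero (div_ne_zero natCast_ne_zero_real (by positivity)) fun h0 => ?_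
    obtain ⟨w, hw⟩ := hg.not_parallel _ (edge_ne hp (m : ZMod n))
    have h1 : shadow d (0 : Space) = shadow d (p (m + 1) - p m) := by
      rw [h0]; refine plane_ext ?_ ?_ <;> simp [shadow]
    have h2 := eq_add_smul_of_shadow_eq hg.apply_two_ne h1
    rw [h2] at hw
    refine hw ?_
    simp only [det₃, PiLp.add_apply, PiLp.smul_apply, PiLp.zero_apply, smul_eq_mul]
    ring
  obtain ⟨Φ, b, hb, hbπ, F⟩ := exists_flatAt_of_linearNear continuous_shadowCurve
    (a := 2 * Real.pi / n * (m + r)) (fun t ht => by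
      by_contra hne
      exact hdbl ⟨t, hne, ht⟩) hv (linearNear_shadowCurve m hr)
  exact ⟨Φ, _, b, hb, hbπ, F⟩

end Generic

theorem exists_isMoveCube_of_isTameKnot {K : Set Sphere3} (hK : IsTameKnot K) :
    ∃ D, IsMoveCube planeLift K D := by
  obtain ⟨-, A, ⟨n, hn, p, hp, rfl⟩, hA⟩ := hK
  obtain ⟨d, hg⟩ := exists_isGeneric p
  obtain ⟨Φ, a, b, hb, hbπ, F⟩ := hg.exists_flatAt hp 0
  exact exists_isMoveCube (D := hg.diagram hp) hb hbπ F (hg.represents hp hA)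

end Reidemeister

end

theorem proposition4p2 (K : Set Reidemeister.Sphere3) (hK : Reidemeister.IsTameKnot K) :
    (Reidemeister.HasMinor (SimpleGraph.completeGraph (Fin 5)) (Reidemeister.planarGraph K) ∧
      ¬ Reidemeister.IsPlanar (Reidemeister.planarGraph K)) ∧
    (Reidemeister.HasMinor (SimpleGraph.completeGraph (Fin 5)) (Reidemeister.sphericalGraph K) ∧
      ¬ Reidemeister.IsPlanar (Reidemeister.sphericalGraph K)) := by
  obtain ⟨D, h⟩ := Reidemeister.exists_isMoveCube_of_isTameKnot hK
  have h₁ : Reidemeister.HasMinor (SimpleGraph.completeGraph (Fin 5)) (Reidemeister.planarGraph K) :=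
    h.hasMinor
  have h₂ : Reidemeister.HasMinor (SimpleGraph.completeGraph (Fin 5))
      (Reidemeister.sphericalGraph K) := h.toSphere.hasMinor
  exact ⟨⟨h₁, Reidemeister.not_isPlanar_of_hasMinor _ h₁⟩,
    ⟨h₂, Reidemeister.not_isPlanar_of_hasMinor _ h₂⟩⟩
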